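/- Let $K$ be a field, let $S=K[x_1,\dots,x_n]$ be the polynomial ring with the standard grading, let $M$ be a finitely generated $\mathbb Z$-graded $S$-module and let $I\subseteq S$ be a graded ideal. For a finitely generated graded $S$-module $T$ of Krull dimension $d$ put $H_0(T,c)=\dim_K T_c$ and $H_i(T,c)=\sum_{b\le c}H_{i-1}(T,b)$ for $i\ge 1$. The iterated Hilbert coefficients $e^i_j(T)\in\mathbb Z$ are the unique integers with $$H_i(T,c)=\sum_{j=0}^{d+i-1}(-1)^j e^i_j(T)\binom{c+d+i-j-1}{d+i-j-1}\qquad\text{for all } c\gg 0,$$ and $e^i_j(T)=0$ for $j>d+i-1$; if $T=0$, all $e^i_j(T)$ are $0$. The modules $\operatorname{Tor}_l^S(M,S/I^k)$ carry their natural grading. Let $l>1$. Then the coefficients $e^i_j(\operatorname{Tor}_l^S(M,S/I^k))$ exist for all $i,j,k\ge 0$, and for all $i,j\ge 0$ there is a polynomial $q\in\mathbb Q[x]$ such that $e^i_j(\operatorname{Tor}_l^S(M,S/I^k))=q(k)$ for all $k\gg 0$, and such that: (a) either $q=0$ or $\deg q\le v(I)+j-1$, where $v(I)$ is the minimal number of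 generators of $I$; (b) if $I$ is generated by homogeneous elements of one single degree, then either $q=0$ or $\deg q\le \dim\bigl(\mathcal R(I)/\operatorname{Ann}_S(M)\mathcal R(I)\bigr)+j-1$, where $\mathcal R(I)=\bigoplus_{k\ge 0}I^k$ is the Rees ring of $I$ and $\dim$ is Krull dimension. -/

import Mathlib

open MvPolynomial TensorProduct

attribute [local instance] MvPolynomial.gradedAlgebra

noncomputable section

namespace GradedTor

/-- The component of degree `c : ℤ` of the standard graded polynomial ring
`S = K[x₁, …, xₙ]` (zero for negative `c`). -/
def polyGrading (K : Type*) [Field K] (n : ℕ) (c : ℤ) : Submodule K (MvPolynomial (Fin n) K) :=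
  if 0 ≤ c then homogeneousSubmodule (Fin n) K c.toNat else ⊥

/-- `𝓜` makes the `S`-module `M` a `ℤ`-graded module over the standard graded ring `S`. -/
structure IsGrading {K : Type*} [Field K] {n : ℕ} {M : Type*} [AddCommGroup M] [Module K M]
    [Module (MvPolynomial (Fin n) K) M] (𝓜 : ℤ → Submodule K M) : Prop where
  isInternal : DirectSum.IsInternal 𝓜
  smul_mem : ∀ (b c : ℤ) (f : MvPolynomial (Fin n) K) (x : M),
    f ∈ polyGrading K n b → x ∈ 𝓜 c → f • x ∈ 𝓜 (b + c)

/-- The grading of the free module `⊕ₛ S(-aₛ)`. -/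
def freeGrading (K : Type*) [Field K] (n : ℕ) {r : ℕ} (a : Fin r → ℤ) (c : ℤ) :
    Submodule K (Fin r → MvPolynomial (Fin n) K) :=
  Submodule.pi Set.univ fun s => polyGrading K n (c - a s)

/-- The grading of the cyclic module `S ⧸ J` induced by that of `S`
(meaningful when `J` is a graded ideal). -/
def quotientGrading {K : Type*} [Field K] {n : ℕ} (J : Ideal (MvPolynomial (Fin n) K)) (c : ℤ) :
    Submodule K (MvPolynomial (Fin n) K ⧸ J) :=
  (polyGrading K n c).map (Ideal.Quotient.mkₐ K J).toLinearMap

/-- The grading of a tensor product over `S`: the component of degree `c` is spanned by the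
`x ⊗ y` with `x`, `y` homogeneous and `deg x + deg y = c`. -/
def tensorGrading {K : Type*} [Field K] {n : ℕ} {P N : Type*}
    [AddCommGroup P] [Module K P] [Module (MvPolynomial (Fin n) K) P]
    [IsScalarTower K (MvPolynomial (Fin n) K) P]
    [AddCommGroup N] [Module K N] [Module (MvPolynomial (Fin n) K) N]
    (𝓟 : ℤ → Submodule K P) (𝓝 : ℤ → Submodule K N) (c : ℤ) :
    Submodule K (P ⊗[MvPolynomial (Fin n) K] N) :=
  Submodule.span K {z | ∃ a b : ℤ, a + b = c ∧ ∃ x ∈ 𝓟 a, ∃ y ∈ 𝓝 b,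
    z = x ⊗ₜ[MvPolynomial (Fin n) K] y}

/-- A resolution `⋯ → F₁ → F₀ → M → 0` of the graded module `M` by finitely generated graded free
modules `Fᵣ = ⊕ₛ S(-shift r s)`, with maps homogeneous of degree `0`. -/
structure FreeResolution {K : Type*} [Field K] {n : ℕ} {M : Type*} [AddCommGroup M] [Module K M]
    [Module (MvPolynomial (Fin n) K) M] (𝓜 : ℤ → Submodule K M) where
  rank : ℕ → ℕ
  shift : ∀ r, Fin (rank r) → ℤ
  d : ∀ r, (Fin (rank (r + 1)) → MvPolynomial (Fin n) K) →ₗ[MvPolynomial (Fin n) K]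
    (Fin (rank r) → MvPolynomial (Fin n) K)
  aug : (Fin (rank 0) → MvPolynomial (Fin n) K) →ₗ[MvPolynomial (Fin n) K] M
  d_mem : ∀ r c v, v ∈ freeGrading K n (shift (r + 1)) c → d r v ∈ freeGrading K n (shift r) c
  aug_mem : ∀ c v, v ∈ freeGrading K n (shift 0) c → aug v ∈ 𝓜 c
  exact_d : ∀ r, Function.Exact (d (r + 1)) (d r)
  exact_aug : Function.Exact (d 0) aug
  aug_surjective : Function.Surjective aug

/-! Every finitely generated graded module has such a resolution. -/

section Existence

variable {K : Type*} [Field K] {n : ℕ}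

lemma mem_polyGrading {c : ℤ} {f : MvPolynomial (Fin n) K} :
    f ∈ polyGrading K n c ↔ ∀ m, f.coeff m ≠ 0 → (m.degree : ℤ) = c := by
  unfold polyGrading
  split_ifs with h
  · rw [mem_homogeneousSubmodule]
    constructor
    · intro hf m hm
      have := hf hm
      rw [Pi.one_def, ← Finsupp.degree_eq_weight_one] at this
      omega
    · intro hf m hm
      have := hf m hm
      rw [Pi.one_def, ← Finsupp.degree_eq_weight_one]
      omega
  · rw [Submodule.mem_bot]
    constructor
    · rintro rfl m hm
      simp at hm
    · intro hf
      ext m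
      by_contra hm
      have := hf m (by simpa using hm)
      omega

lemma mem_freeGrading {r : ℕ} {a : Fin r → ℤ} {c : ℤ} {v : Fin r → MvPolynomial (Fin n) K} :
    v ∈ freeGrading K n a c ↔ ∀ s m, (v s).coeff m ≠ 0 → (m.degree : ℤ) + a s = c := by
  simp only [freeGrading, Submodule.mem_pi, Set.mem_univ, forall_true_left, mem_polyGrading,
    eq_sub_iff_add_eq]

lemma iSupIndep_freeGrading {r : ℕ} (a : Fin r → ℤ) : iSupIndep (freeGrading K n a) := by
  classical
  rw [iSupIndep_iff_forall_dfinsupp]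
  intro c x y h
  ext s m
  by_contra hx
  have h1 := mem_freeGrading.1 x.2 s m (by simpa using hx)
  apply hx
  rw [← h]
  have h2 : ∀ z : Π₀ i, freeGrading K n a i,
      (((DFinsupp.lsum ℕ fun i => (freeGrading K n a i).subtype) (z.erase c)) s).coeff m = 0 := by
    intro z
    rw [DFinsupp.lsum_apply_apply, DFinsupp.sumAddHom_apply, DFinsupp.sum, Finset.sum_apply,
      MvPolynomial.coeff_sum]
    refine Finset.sum_eq_zero fun i _ => ?_
    by_contra h3
    by_cases hi : i = c
    · subst hi
      simp at h3
    · exact hi ((mem_freeGrading.1 ((z.erase c) i).2 s m h3).symm.trans h1)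
  simpa using h2 y

lemma iSup_freeGrading {r : ℕ} (a : Fin r → ℤ) : ⨆ c, freeGrading K n a c = ⊤ := by
  rw [eq_top_iff]
  intro v _
  have hv : v = ∑ s, Pi.single s (v s) := by
    simp [Finset.univ_sum_single]
  rw [hv]
  refine Submodule.sum_mem _ fun s _ => ?_
  have hs : (Pi.single s (v s) : Fin r → MvPolynomial (Fin n) K)
      = ∑ m ∈ (v s).support, Pi.single s (monomial m ((v s).coeff m)) := by
    conv_lhs => rw [(v s).as_sum]
    exact map_sum (AddMonoidHom.single _ s) _ _
  rw [hs]
  refine Submodule.sum_mem _ fun m _ => ?_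
  refine Submodule.mem_iSup_of_mem ((m.degree : ℤ) + a s) (mem_freeGrading.2 ?_)
  intro t m' h
  by_cases ht : t = s
  · subst ht
    rw [Pi.single_eq_same, coeff_monomial] at h
    split_ifs at h with hm
    · rw [hm]
    · simp at h
  · simp [Pi.single_eq_of_ne ht] at h

lemma isGrading_freeGrading {r : ℕ} (a : Fin r → ℤ) : IsGrading (n := n) (freeGrading K n a) where
  isInternal := by
    rw [DirectSum.isInternal_submodule_iff_iSupIndep_and_iSup_eq_top]
    exact ⟨iSupIndep_freeGrading a, iSup_freeGrading a⟩
  smul_mem := by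
    intro b c f x hf hx
    rw [mem_freeGrading]
    intro s m hm
    rw [Pi.smul_apply, smul_eq_mul, coeff_mul] at hm
    obtain ⟨p, hp, hne⟩ := Finset.exists_ne_zero_of_sum_ne_zero hm
    have h1 := mem_polyGrading.1 hf p.1 (left_ne_zero_of_mul hne)
    have h2 := mem_freeGrading.1 hx s p.2 (right_ne_zero_of_mul hne)
    rw [← Finset.HasAntidiagonal.mem_antidiagonal.1 hp, map_add]
    push_cast
    omega

variable {M : Type*} [AddCommGroup M] [Module K M] [Module (MvPolynomial (Fin n) K) M]

/-- A submodule generated by homogeneous elements. -/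
def GeneratedByHomogeneous (𝓜 : ℤ → Submodule K M) (Z : Submodule (MvPolynomial (Fin n) K) M) :
    Prop :=
  Submodule.span (MvPolynomial (Fin n) K) {x | x ∈ Z ∧ ∃ c, x ∈ 𝓜 c} = Z

lemma generatedByHomogeneous_top {𝓜 : ℤ → Submodule K M} (h𝓜 : IsGrading (n := n) 𝓜)
    [IsScalarTower K (MvPolynomial (Fin n) K) M] :
    GeneratedByHomogeneous (n := n) 𝓜 ⊤ := by
  unfold GeneratedByHomogeneous
  rw [eq_top_iff]
  have h : (⊤ : Submodule K M) ≤ (Submodule.span (MvPolynomial (Fin n) K)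
      {x | x ∈ (⊤ : Submodule (MvPolynomial (Fin n) K) M) ∧ ∃ c, x ∈ 𝓜 c}).restrictScalars K := by
    rw [← h𝓜.isInternal.submodule_iSup_eq_top]
    exact iSup_le fun c x hx => Submodule.subset_span ⟨trivial, c, hx⟩
  exact fun x _ => h (trivial : x ∈ (⊤ : Submodule K M))

lemma generatedByHomogeneous_ker {𝓜 : ℤ → Submodule K M} (h𝓜 : IsGrading (n := n) 𝓜)
    [IsScalarTower K (MvPolynomial (Fin n) K) M] {r : ℕ} (a : Fin r → ℤ)
    (f : (Fin r → MvPolynomial (Fin n) K) →ₗ[MvPolynomial (Fin n) K] M)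
    (hf : ∀ c v, v ∈ freeGrading K n a c → f v ∈ 𝓜 c) :
    GeneratedByHomogeneous (freeGrading K n a) (LinearMap.ker f) := by
  classical
  refine le_antisymm (Submodule.span_le.2 ?_) fun v hv => ?_
  · rintro x ⟨hx, -⟩
    exact hx
  have hv' : v ∈ ⨆ c, freeGrading K n a c := by rw [iSup_freeGrading]; trivial
  obtain ⟨w, hw⟩ := (Submodule.mem_iSup_iff_exists_dfinsupp' _ v).1 hv'
  have key : ∀ c, f (w c) = 0 := by
    let g : Π₀ c, 𝓜 c := w.mapRange (fun c x => ⟨f (x : freeGrading K n a c).1, hf c _ x.2⟩) (fun c => by ext; simp)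
    have hg : DirectSum.coeAddMonoidHom 𝓜 g = 0 := by
      change DFinsupp.sumAddHom _ g = 0
      rw [DFinsupp.sumAddHom_apply, DFinsupp.sum_mapRange_index (by simp)]
      have := congrArg f hw
      rw [DFinsupp.sum, map_sum, LinearMap.mem_ker.1 hv] at this
      exact this
    have hg0 : g = 0 := h𝓜.isInternal.injective (by rw [hg, map_zero])
    intro c
    have := congrArg (fun u : Π₀ c, 𝓜 c => ((u c : 𝓜 c) : M)) hg0
    simpa [g] using this
  rw [← hw]
  refine Submodule.sum_mem _ fun c _ => Submodule.subset_span ⟨key c, c, (w c).2⟩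

lemma exists_cover {𝓜 : ℤ → Submodule K M} (h𝓜 : IsGrading (n := n) 𝓜)
    [IsScalarTower K (MvPolynomial (Fin n) K) M]
    {Z : Submodule (MvPolynomial (Fin n) K) M} (hZ : GeneratedByHomogeneous 𝓜 Z) (hfg : Z.FG) :
    ∃ (r : ℕ) (a : Fin r → ℤ)
      (f : (Fin r → MvPolynomial (Fin n) K) →ₗ[MvPolynomial (Fin n) K] M),
      (∀ c v, v ∈ freeGrading K n a c → f v ∈ 𝓜 c) ∧ LinearMap.range f = Z := by
  unfold GeneratedByHomogeneous at hZ
  rw [← hZ] at hfg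
  obtain ⟨t, ht, hspan⟩ := Submodule.fg_span_iff_fg_span_finset_subset _ |>.1 hfg
  choose deg hdeg using fun x : t => (ht x.2).2
  let e := t.equivFin
  refine ⟨t.card, fun s => deg (e.symm s),
    Fintype.linearCombination (MvPolynomial (Fin n) K) fun s => ((e.symm s : t) : M), ?_, ?_⟩
  · intro c v hv
    rw [Fintype.linearCombination_apply]
    refine Submodule.sum_mem _ fun s _ => ?_
    have h1 : v s ∈ polyGrading K n (c - deg (e.symm s)) := hv s trivial
    have := h𝓜.smul_mem _ _ _ _ h1 (hdeg (e.symm s))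
    rwa [sub_add_cancel] at this
  · rw [Fintype.range_linearCombination, ← hZ, hspan]
    congr 1
    ext x
    constructor
    · rintro ⟨s, rfl⟩
      exact (e.symm s).2
    · intro hx
      exact ⟨e ⟨x, hx⟩, by simp⟩

variable (K n) in
/-- A graded free module together with a submodule generated by homogeneous elements. -/
structure Stage where
  r : ℕ
  a : Fin r → ℤ
  Z : Submodule (MvPolynomial (Fin n) K) (Fin r → MvPolynomial (Fin n) K)
  hZ : GeneratedByHomogeneous (freeGrading K n a) Z

lemma Stage.exists_next (X : Stage K n) : ∃ (Y : Stage K n)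
    (f : (Fin Y.r → MvPolynomial (Fin n) K) →ₗ[MvPolynomial (Fin n) K]
      (Fin X.r → MvPolynomial (Fin n) K)),
    (∀ c v, v ∈ freeGrading K n Y.a c → f v ∈ freeGrading K n X.a c) ∧
      LinearMap.range f = X.Z ∧ LinearMap.ker f = Y.Z := by
  obtain ⟨r, a, f, hf, hr⟩ := exists_cover (isGrading_freeGrading X.a) X.hZ
    (IsNoetherian.noetherian X.Z)
  exact ⟨⟨r, a, LinearMap.ker f, generatedByHomogeneous_ker (isGrading_freeGrading X.a) a f hf⟩,
    f, hf, hr, rfl⟩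

theorem FreeResolution.nonempty {𝓜 : ℤ → Submodule K M} (h𝓜 : IsGrading (n := n) 𝓜)
    [IsScalarTower K (MvPolynomial (Fin n) K) M] [Module.Finite (MvPolynomial (Fin n) K) M] :
    Nonempty (FreeResolution (n := n) 𝓜) := by
  obtain ⟨r, a, f, hf, hr⟩ := exists_cover h𝓜 (generatedByHomogeneous_top h𝓜)
    Module.Finite.fg_top
  choose next g hg hrange hker using Stage.exists_next (K := K) (n := n)
  let X : ℕ → Stage K n := fun m =>
    Nat.rec ⟨r, a, LinearMap.ker f, generatedByHomogeneous_ker h𝓜 a f hf⟩ (fun _ Y => next Y) m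
  exact ⟨{
    rank := fun m => (X m).r
    shift := fun m => (X m).a
    d := fun m => g (X m)
    aug := f
    d_mem := fun m => hg (X m)
    aug_mem := hf
    exact_d := fun m => LinearMap.exact_iff.2 ((hker (X m)).trans (hrange (X (m + 1))).symm)
    exact_aug := LinearMap.exact_iff.2 (hrange (X 0)).symm
    aug_surjective := LinearMap.range_eq_top.1 hr }⟩

end Existence

section Tor

/-- The subquotient `Z / (B ∩ Z)`. -/
abbrev Subquotient {R P : Type*} [CommRing R] [AddCommGroup P] [Module R P]
    (Z B : Submodule R P) : Type _ :=
  Z ⧸ B.submoduleOf Z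

/-- The grading of `Z / (B ∩ Z)` induced by a grading of the ambient module: classes of
homogeneous elements of `Z`. -/
def subquotientGrading {K R P : Type*} [Field K] [CommRing R] [Algebra K R] [AddCommGroup P]
    [Module K P] [Module R P] [IsScalarTower K R P] (𝓟 : ℤ → Submodule K P) (Z B : Submodule R P)
    (c : ℤ) : Submodule K (Subquotient Z B) :=
  ((𝓟 c).comap (Z.subtype.restrictScalars K)).map ((B.submoduleOf Z).mkQ.restrictScalars K)

variable {K : Type*} [Field K] {n : ℕ} {M : Type*} [AddCommGroup M] [Module K M]
  [Module (MvPolynomial (Fin n) K) M] {𝓜 : ℤ → Submodule K M}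
  (N : Type*) [AddCommGroup N] [Module K N] [Module (MvPolynomial (Fin n) K) N]

namespace FreeResolution

/-- The term `F_l ⊗ N` of the complex `F ⊗ N`. -/
abbrev tensorTerm (F : FreeResolution (n := n) 𝓜) (l : ℕ) : Type _ :=
  (Fin (F.rank l) → MvPolynomial (Fin n) K) ⊗[MvPolynomial (Fin n) K] N

/-- The cycles of `F ⊗ N` in homological degree `l`. -/
def cycles (F : FreeResolution (n := n) 𝓜) :
    (l : ℕ) → Submodule (MvPolynomial (Fin n) K) (F.tensorTerm N l)
  | 0 => ⊤
  | l + 1 => LinearMap.ker ((F.d l).rTensor N)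

/-- The boundaries of `F ⊗ N` in homological degree `l`. -/
def boundaries (F : FreeResolution (n := n) 𝓜) (l : ℕ) :
    Submodule (MvPolynomial (Fin n) K) (F.tensorTerm N l) :=
  LinearMap.range ((F.d l).rTensor N)

/-- The homology `H_l(F ⊗ N)`. -/
abbrev homology (F : FreeResolution (n := n) 𝓜) (l : ℕ) : Type _ :=
  Subquotient (F.cycles N l) (F.boundaries N l)

variable {N} in
/-- The grading of `H_l(F ⊗ N)`: classes of homogeneous cycles. -/
def homologyGrading (F : FreeResolution (n := n) 𝓜) (𝓝 : ℤ → Submodule K N)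
    [IsScalarTower K (MvPolynomial (Fin n) K) N] (l : ℕ)
    (c : ℤ) : Submodule K (F.homology N l) :=
  subquotientGrading (tensorGrading (freeGrading K n (F.shift l)) 𝓝) (F.cycles N l)
    (F.boundaries N l) c

end FreeResolution

variable [IsScalarTower K (MvPolynomial (Fin n) K) M] [Module.Finite (MvPolynomial (Fin n) K) M]

/-- A chosen resolution of the finitely generated graded module `M` by finitely generated graded
free modules. -/
def resolution (h𝓜 : IsGrading (n := n) 𝓜) : FreeResolution (n := n) 𝓜 :=
  (FreeResolution.nonempty h𝓜).some

/-- The `S`-module `Tor_l^S(M, N)`, where `M` is a finitely generated graded module. -/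
abbrev Tor (h𝓜 : IsGrading (n := n) 𝓜) (l : ℕ) : Type _ :=
  (resolution h𝓜).homology N l

variable {N} in
/-- The natural grading of `Tor_l^S(M, N)` for graded modules `M` and `N`. -/
def torGrading (h𝓜 : IsGrading (n := n) 𝓜) (𝓝 : ℤ → Submodule K N)
    [IsScalarTower K (MvPolynomial (Fin n) K) N] (l : ℕ) : ℤ → Submodule K (Tor N h𝓜 l) :=
  (resolution h𝓜).homologyGrading 𝓝 l

end Tor

section Hilbert

variable {K : Type*} [Field K] {n : ℕ} {T : Type*} [AddCommGroup T] [Module K T]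
  [Module (MvPolynomial (Fin n) K) T]

/-- The iterated Hilbert functions `H_i(T, c)`: `H_0(T, c) = dim_K T_c` and
`H_i(T, c) = ∑_{b ≤ c} H_{i-1}(T, b)`. The sum is finite for finitely generated `T`. -/
def iteratedHilbert (𝓣 : ℤ → Submodule K T) : ℕ → ℤ → ℤ
  | 0, c => Module.finrank K (𝓣 c)
  | i + 1, c => ∑ᶠ b ∈ Set.Iic c, iteratedHilbert 𝓣 i b

variable (n) in
/-- The number `D = dim T + i`, so that the `i`th Hilbert polynomial has degree `D - 1`.
The Krull dimension is that of the `S`-module `T`; for `T = 0` it is replaced by `0`, which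
is harmless, all Hilbert coefficients being zero then. -/
def hilbertLength (T : Type*) [AddCommGroup T] [Module (MvPolynomial (Fin n) K) T] (i : ℕ) : ℕ :=
  ((Module.supportDim (MvPolynomial (Fin n) K) T).unbotD 0).toNat + i

variable (n) in
/-- `e 0, e 1, …` are the `i`th iterated Hilbert coefficients of `T`: with `d = dim T`, for `c ≫ 0`
`H_i(T, c) = ∑_{j=0}^{d+i-1} (-1)^j e_j binom(c + d + i - j - 1, d + i - j - 1)`,
and `e_j = 0` for `j > d + i - 1`. (`Ring.choose x r` is `x (x-1) ⋯ (x-r+1) / r!`.) -/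
def IsHilbertCoeffs (𝓣 : ℤ → Submodule K T) (i : ℕ) (e : ℕ → ℤ) : Prop :=
  (∀ᶠ c : ℤ in Filter.atTop, iteratedHilbert 𝓣 i c =
    ∑ j ∈ Finset.range (hilbertLength (K := K) n T i), (-1) ^ j * e j *
      Ring.choose (c + (hilbertLength (K := K) n T i - 1 - j : ℕ))
        (hilbertLength (K := K) n T i - 1 - j)) ∧
  ∀ j, hilbertLength (K := K) n T i ≤ j → e j = 0

open Classical in
variable (n) in
/-- The iterated Hilbert coefficient `e^i_j(T)`. -/
def hilbertCoeff (𝓣 : ℤ → Submodule K T) (i j : ℕ) : ℤ :=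
  if h : ∃ e, IsHilbertCoeffs n 𝓣 i e then h.choose j else 0

end Hilbert

/-- The Krull dimension of `R(I) / J R(I)`, where `R(I) = ⊕ₖ Iᵏ` is the Rees ring of `I`. -/
def reesQuotientDim {S : Type*} [CommRing S] (I J : Ideal S) : WithBot ℕ∞ :=
  ringKrullDim (reesAlgebra I ⧸ J.map (algebraMap S (reesAlgebra I)))

end GradedTor

end

/-! Resolve `M` by graded free modules F. By exactness of F, the differential d : F_{l+1} → F_l
identifies the homology of F ⊗ S/J in degree l+1 with (im d ∩ J F_l) / J im d, inside a free module
that does not depend on J (`finrank_homologyGrading`). For J = I^k put U_k = im d ∩ I^k F_l and W_k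
= I^k im d. Multiplication by I sends U_k to U_{k+1} and W_k to W_{k+1}, so the Tor modules for all
k together form a subquotient of a free module of finite rank over the noetherian Rees ring R(I),
bigraded by the internal degree c and by k.

By Hilbert–Serre (`NoetherianFamily.finite_support_bdiffs`) the bigraded Hilbert function becomes
finitely supported after one difference (1,0) per variable and one difference (deg f_s, 1) per
homogeneous generator f_s of I. Hence its sums over c are polynomial in (c,k) on a slanted region k
≥ k₀, c ≥ c₁ + δk, where δ bounds the deg f_s (`regionPoly_sumUp`). For fixed k, the coefficients of
the binomial expansion in c are the Hilbert coefficients. If the total degree is less than m and the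
expansion has D terms, the j-th coefficient is a polynomial in k of degree less than m + j + 1 - D
(`IsPoly.polyLT_coeff`).

It remains to find m. By Artin–Rees the annihilator of Tor is a constant ideal 𝔞 for large k
(`exists_liftedAnnihilator_stable`). Let d = dim S/𝔞, which is then the dimension of Tor, and β =
dim R(I)/𝔞R(I). By Noether normalization the Hilbert function summed over a box of size N is O(N^β)
(`exists_growth_sliceHilbert`). For a nonnegative polynomial function, monotone in c, such growth
bounds the total degree (`IsPoly.of_growth`). This gives m = β + i - 1 for the i-th Hilbert
function, and D = d + i, so the j-th coefficient has degree less than β - d + j. Since R(I) is a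
quotient of a polynomial ring over S in v(I) variables, β ≤ d + v(I), which is (a). Since a
null-homotopy puts Ann M inside 𝔞, β ≤ dim R(I)/Ann(M)R(I), which is (b).

Existence of the coefficients for each single k is the same argument for a constant family over the
unit ideal (`evPoly_iterSum_finrank`). -/

noncomputable section
-- Polynomial functions of two variables and their leading forms
namespace GradedTor

/-- Polynomial functions `ℕ × ℕ → ℤ` of total degree less than `m`, described by the vanishing of
all differences of order `m`. -/
def IsPoly : ℕ → (ℕ → ℕ → ℤ) → Prop
  | 0, g => ∀ a b, g a b = 0
  | m + 1, g => IsPoly m (fun a b => g (a + 1) b - g a b) ∧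
      IsPoly m (fun a b => g a (b + 1) - g a b)

namespace IsPoly

lemma zero (m : ℕ) : IsPoly m (fun _ _ => 0) := by
  induction m with
  | zero => intro a b; rfl
  | succ m ih => exact ⟨by simpa using ih, by simpa using ih⟩

lemma add {m : ℕ} {g h : ℕ → ℕ → ℤ} (hg : IsPoly m g) (hh : IsPoly m h) :
    IsPoly m (fun a b => g a b + h a b) := by
  induction m generalizing g h with
  | zero => intro a b; simp [hg a b, hh a b]
  | succ m ih =>
    refine ⟨?_, ?_⟩
    · convert ih hg.1 hh.1 using 3; ring
    · convert ih hg.2 hh.2 using 3; ring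

lemma sum {m : ℕ} {ι : Type*} (s : Finset ι) {g : ι → ℕ → ℕ → ℤ} (hg : ∀ i ∈ s, IsPoly m (g i)) :
    IsPoly m (fun a b => ∑ i ∈ s, g i a b) := by
  classical
  induction s using Finset.induction_on with
  | empty => simpa using zero m
  | insert i s hi ih =>
    simp only [Finset.sum_insert hi]
    exact (hg i (Finset.mem_insert_self i s)).add
      (ih fun j hj => hg j (Finset.mem_insert_of_mem hj))

lemma shift {m : ℕ} {g : ℕ → ℕ → ℤ} (s t : ℕ) (hg : IsPoly m g) :
    IsPoly m (fun a b => g (a + s) (b + t)) := by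
  induction m generalizing g with
  | zero => intro a b; exact hg _ _
  | succ m ih =>
    refine ⟨?_, ?_⟩
    · refine (congrArg (IsPoly m) ?_).mp (ih hg.1)
      ext a b; simp only [add_right_comm]
    · refine (congrArg (IsPoly m) ?_).mp (ih hg.2)
      ext a b; simp only [add_right_comm]

lemma succ {m : ℕ} {g : ℕ → ℕ → ℤ} (hg : IsPoly m g) : IsPoly (m + 1) g := by
  induction m generalizing g with
  | zero => exact ⟨fun a b => by simp [hg _ _], fun a b => by simp [hg _ _]⟩
  | succ m ih => exact ⟨ih hg.1, ih hg.2⟩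

lemma mono {m m' : ℕ} {g : ℕ → ℕ → ℤ} (hg : IsPoly m g) (h : m ≤ m') : IsPoly m' g := by
  induction m', h using Nat.le_induction with
  | base => exact hg
  | succ k _ ih => exact ih.succ

lemma diff_fst {m : ℕ} {g : ℕ → ℕ → ℤ} (hg : IsPoly m g) :
    IsPoly (m - 1) (fun a b => g (a + 1) b - g a b) := by
  cases m with
  | zero => intro a b; simp [hg _ _]
  | succ m => exact hg.1

lemma diff_snd {m : ℕ} {g : ℕ → ℕ → ℤ} (hg : IsPoly m g) :
    IsPoly (m - 1) (fun a b => g a (b + 1) - g a b) := by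
  cases m with
  | zero => intro a b; simp [hg _ _]
  | succ m => exact hg.2

/-- A step (u, v) is a sum of unit steps, each of which lowers the degree by one. -/
lemma diff_dir {m : ℕ} {g : ℕ → ℕ → ℤ} (u v : ℕ) (hg : IsPoly m g) :
    IsPoly (m - 1) (fun a b => g (a + u) (b + v) - g a b) := by
  have h1 : ∀ u, IsPoly (m - 1) (fun a b => g (a + u) b - g a b) := by
    intro u
    induction u with
    | zero => simpa using zero _
    | succ u ih => 
      refine (congrArg (IsPoly (m - 1)) ?_).mp ((hg.diff_fst.shift u 0).add ih)
      ext a b; simp only [add_zero, add_assoc]; ring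
  have h2 : IsPoly (m - 1) (fun a b => g a (b + v) - g a b) := by
    induction v with
    | zero => simpa using zero _
    | succ v ih => 
      refine (congrArg (IsPoly (m - 1)) ?_).mp ((hg.diff_snd.shift 0 v).add ih)
      ext a b; simp only [add_zero, add_assoc]; ring
  convert ((h1 u).shift 0 v).add h2 using 3
  simp

end IsPoly

/-- The difference of `g` in the direction `(u, 1)`. -/
def dirDiff (u : ℕ) (g : ℕ → ℕ → ℤ) : ℕ → ℕ → ℤ := fun a b => g (a + u) (b + 1) - g a b

/-- The polynomial in `u` whose value is the `r`th difference in the direction `(u, 1)` of a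
polynomial function of total degree at most `r`. -/
def leadPoly : ℕ → (ℕ → ℕ → ℤ) → Polynomial ℤ
  | 0, g => Polynomial.C (g 0 0)
  | r + 1, g => Polynomial.X * leadPoly r (fun a b => g (a + 1) b - g a b) +
      leadPoly r (fun a b => g a (b + 1) - g a b)

lemma dirDiff_iterate_add (u r : ℕ) (g h : ℕ → ℕ → ℤ) (a b : ℕ) :
    (dirDiff u)^[r] (fun a b => g a b + h a b) a b =
      (dirDiff u)^[r] g a b + (dirDiff u)^[r] h a b := by
  induction r generalizing g h with
  | zero => rfl
  | succ r ih =>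
    rw [Function.iterate_succ_apply, Function.iterate_succ_apply, Function.iterate_succ_apply,
      ← ih]
    refine congrArg (fun G : ℕ → ℕ → ℤ => (dirDiff u)^[r] G a b) ?_
    ext a b
    simp only [dirDiff]
    ring

lemma dirDiff_iterate_const_mul (u r : ℕ) (s : ℤ) (g : ℕ → ℕ → ℤ) (a b : ℕ) :
    (dirDiff u)^[r] (fun a b => s * g a b) a b = s * (dirDiff u)^[r] g a b := by
  induction r generalizing g with
  | zero => rfl
  | succ r ih =>
    rw [Function.iterate_succ_apply, Function.iterate_succ_apply, ← ih]
    refine congrArg (fun G : ℕ → ℕ → ℤ => (dirDiff u)^[r] G a b) ?_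
    ext a b
    simp only [dirDiff]
    ring

lemma IsPoly.dirDiff_iterate_eq_zero {r : ℕ} {g : ℕ → ℕ → ℤ} (hg : IsPoly r g) (u a b : ℕ) :
    (dirDiff u)^[r] g a b = 0 := by
  induction r generalizing g with
  | zero => exact hg a b
  | succ r ih => exact ih (hg.diff_dir u 1)

lemma IsPoly.dirDiff_iterate {r : ℕ} {g : ℕ → ℕ → ℤ} (hg : IsPoly (r + 1) g) (u a b : ℕ) :
    (dirDiff u)^[r] g a b = (leadPoly r g).eval (u : ℤ) := by
  induction r generalizing g with
  | zero =>
    have h1 : ∀ a b, g (a + 1) b = g a b := fun a b => sub_eq_zero.1 (hg.1 a b)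
    have h2 : ∀ a b, g a (b + 1) = g a b := fun a b => sub_eq_zero.1 (hg.2 a b)
    have h3 : ∀ a b, g a b = g 0 0 := by
      intro a b
      induction a with
      | zero => induction b with
        | zero => rfl
        | succ b ih => rw [h2, ih]
      | succ a ih => rw [h1, ih]
    simp [leadPoly, h3 a b]
  | succ r ih =>
    set g1 : ℕ → ℕ → ℤ := fun a b => g (a + 1) b - g a b with hg1
    set g2 : ℕ → ℕ → ℤ := fun a b => g a (b + 1) - g a b with hg2
    -- Replacing the shifted values of g1 by g1 itself costs terms of one degree less, which the
    -- remaining r differences kill.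
    have hrem : IsPoly r (fun a b => ∑ t ∈ Finset.range u, (g1 (a + t) (b + 1) - g1 a b)) :=
      IsPoly.sum _ fun t _ => IsPoly.diff_dir (m := r + 1) t 1 hg.1
    have key : dirDiff u g = fun a b => ((u : ℤ) * g1 a b + g2 a b) +
        ∑ t ∈ Finset.range u, (g1 (a + t) (b + 1) - g1 a b) := by
      ext a b
      rw [Finset.sum_sub_distrib]
      have := Finset.sum_range_sub (fun t => g (a + t) (b + 1)) u
      have h4 : ∑ t ∈ Finset.range u, g1 (a + t) (b + 1) = g (a + u) (b + 1) - g a (b + 1) := by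
        rw [add_zero] at this
        rw [← this]
        rfl
      rw [h4]
      simp only [dirDiff, hg1, hg2, Finset.sum_const, Finset.card_range, nsmul_eq_mul]
      ring
    rw [Function.iterate_succ_apply, key, dirDiff_iterate_add, hrem.dirDiff_iterate_eq_zero,
      dirDiff_iterate_add, dirDiff_iterate_const_mul, ih hg.1, ih hg.2]
    simp [leadPoly]

/-- The difference in the first variable. -/
def fstDiff (g : ℕ → ℕ → ℤ) : ℕ → ℕ → ℤ := fun a b => g (a + 1) b - g a b

/-- The difference in the second variable. -/
def sndDiff (g : ℕ → ℕ → ℤ) : ℕ → ℕ → ℤ := fun a b => g a (b + 1) - g a b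

lemma fstDiff_sndDiff (g : ℕ → ℕ → ℤ) : fstDiff (sndDiff g) = sndDiff (fstDiff g) := by
  ext a b
  simp only [fstDiff, sndDiff]
  ring

lemma fstDiff_sndDiff_iterate (j : ℕ) (g : ℕ → ℕ → ℤ) :
    fstDiff (sndDiff^[j] g) = sndDiff^[j] (fstDiff g) :=
  ((Function.Commute.iterate_right fstDiff_sndDiff j) : _) g

/-- Binomial theorem for (X Δ₁ + Δ₂)^r, where Δ₁ and Δ₂ are the two commuting difference operators.
-/
lemma coeff_leadPoly (r : ℕ) (g : ℕ → ℕ → ℤ) (i : ℕ) :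
    (leadPoly r g).coeff i = r.choose i * fstDiff^[i] (sndDiff^[r - i] g) 0 0 := by
  induction r generalizing g i with
  | zero =>
    cases i with
    | zero => simp [leadPoly]
    | succ i => rw [leadPoly, Polynomial.coeff_C_succ]; simp
  | succ r ih =>
    have h1 := fun i => ih (fstDiff g) i
    have h2 := fun i => ih (sndDiff g) i
    change (Polynomial.X * leadPoly r (fstDiff g) + leadPoly r (sndDiff g)).coeff i = _
    cases i with
    | zero =>
      rw [Polynomial.coeff_add, Polynomial.coeff_X_mul_zero, h2]
      simp
    | succ i =>
      rw [Polynomial.coeff_add, Polynomial.coeff_X_mul, h1, h2]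
      have e1 : fstDiff^[i] (sndDiff^[r - i] (fstDiff g)) =
          fstDiff^[i + 1] (sndDiff^[r - i] g) := by
        rw [← fstDiff_sndDiff_iterate, Function.iterate_succ_apply]
      rw [e1, Nat.choose_succ_succ, Nat.succ_sub_succ]
      rcases Nat.lt_or_ge i r with h | h
      · have e2 : sndDiff^[r - (i + 1)] (sndDiff g) = sndDiff^[r - i] g := by
          rw [← Function.iterate_succ_apply]
          congr 2
          omega
        rw [e2]
        push_cast
        ring
      · rw [Nat.choose_eq_zero_of_lt (show r < i + 1 by omega)]
        simp

/-- The differences of order r are constant here, so it suffices to test them at the origin. -/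
lemma IsPoly.of_iterate {r : ℕ} {g : ℕ → ℕ → ℤ} (hg : IsPoly (r + 1) g)
    (h : ∀ i j, i + j = r → fstDiff^[i] (sndDiff^[j] g) 0 0 = 0) : IsPoly r g := by
  induction r generalizing g with
  | zero =>
    intro a b
    have h0 := hg.dirDiff_iterate (u := 0) a b
    have h1 := h 0 0 rfl
    simp only [Function.iterate_zero, id_eq] at h1
    simpa [leadPoly, h1] using h0
  | succ r ih =>
    refine ⟨ih hg.1 fun i j hij => ?_, ih hg.2 fun i j hij => ?_⟩
    · have := h (i + 1) j (by omega)
      rw [Function.iterate_succ_apply, fstDiff_sndDiff_iterate] at this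
      exact this
    · have := h i (j + 1) (by omega)
      rw [Function.iterate_succ_apply] at this
      exact this

lemma IsPoly.of_leadPoly_eq_zero {r : ℕ} {g : ℕ → ℕ → ℤ} (hg : IsPoly (r + 1) g)
    (h : leadPoly r g = 0) : IsPoly r g := by
  refine hg.of_iterate fun i j hij => ?_
  have := coeff_leadPoly r g i
  rw [h, Polynomial.coeff_zero, eq_comm, mul_eq_zero] at this
  rcases this with h0 | h0
  · exact absurd (Nat.choose_eq_zero_iff.1 (by exact_mod_cast h0)) (by omega)
  · rwa [show r - i = j by omega] at h0

/-! ### Integer-valued polynomial functions of one variable -/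

/-- Integer valued functions on `ℕ` given by a rational polynomial of degree less than `p`. -/
def PolyLT (p : ℕ) (e : ℕ → ℤ) : Prop :=
  ∃ q ∈ Polynomial.degreeLT ℚ p, ∀ b : ℕ, (e b : ℚ) = q.eval (b : ℚ)

namespace PolyLT

lemma add {p : ℕ} {e f : ℕ → ℤ} (he : PolyLT p e) (hf : PolyLT p f) :
    PolyLT p (fun b => e b + f b) := by
  obtain ⟨q, hq, h⟩ := he
  obtain ⟨q', hq', h'⟩ := hf
  exact ⟨q + q', Submodule.add_mem _ hq hq', fun b => by simp [h, h']⟩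

lemma zero (p : ℕ) : PolyLT p (fun _ => 0) := ⟨0, Submodule.zero_mem _, by simp⟩

lemma const_mul {p : ℕ} {e : ℕ → ℤ} (r : ℤ) (he : PolyLT p e) : PolyLT p (fun b => r * e b) := by
  obtain ⟨q, hq, h⟩ := he
  exact ⟨(r : ℚ) • q, Submodule.smul_mem _ _ hq, fun b => by simp [h]⟩

lemma sub {p : ℕ} {e f : ℕ → ℤ} (he : PolyLT p e) (hf : PolyLT p f) :
    PolyLT p (fun b => e b - f b) := by
  convert he.add (hf.const_mul (-1)) using 2; ring

lemma sum {p : ℕ} {ι : Type*} (s : Finset ι) {e : ι → ℕ → ℤ} (he : ∀ i ∈ s, PolyLT p (e i)) :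
    PolyLT p (fun b => ∑ i ∈ s, e i b) := by
  classical
  induction s using Finset.induction_on with
  | empty => simpa using zero p
  | insert i s hi ih =>
    simp only [Finset.sum_insert hi]
    exact (he i (Finset.mem_insert_self i s)).add
      (ih fun j hj => he j (Finset.mem_insert_of_mem hj))

lemma mono {p p' : ℕ} {e : ℕ → ℤ} (he : PolyLT p e) (h : p ≤ p') : PolyLT p' e := by
  obtain ⟨q, hq, h'⟩ := he
  exact ⟨q, Polynomial.degreeLT_mono h hq, h'⟩

lemma mul {p r : ℕ} {e f : ℕ → ℤ} (he : PolyLT p e) (hf : PolyLT (r + 1) f) :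
    PolyLT (p + r) (fun b => e b * f b) := by
  obtain ⟨q, hq, h⟩ := he
  obtain ⟨q', hq', h'⟩ := hf
  refine ⟨q * q', ?_, fun b => by simp [h, h']⟩
  rw [Polynomial.mem_degreeLT] at *
  by_cases h0 : q = 0
  · rw [h0, zero_mul, Polynomial.degree_zero]
    exact WithBot.bot_lt_coe _
  by_cases h1 : q' = 0
  · rw [h1, mul_zero, Polynomial.degree_zero]
    exact WithBot.bot_lt_coe _
  rw [Polynomial.degree_mul, Polynomial.degree_eq_natDegree h0, Polynomial.degree_eq_natDegree h1]
  rw [Polynomial.degree_eq_natDegree h0] at hq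
  rw [Polynomial.degree_eq_natDegree h1] at hq'
  norm_cast at *
  omega

lemma choose (r : ℕ) (s t : ℤ) : PolyLT (r + 1) (fun b => Ring.choose (s * b + t) r) := by
  refine ⟨(Nat.factorial r : ℚ)⁻¹ • ((descPochhammer ℚ r).comp
    (Polynomial.C (s : ℚ) * Polynomial.X + Polynomial.C (t : ℚ))), ?_, ?_⟩
  · refine Submodule.smul_mem _ _ (Polynomial.mem_degreeLT.2 ?_)
    refine lt_of_le_of_lt (Polynomial.degree_le_natDegree) ?_
    have h1 := Polynomial.natDegree_comp_le (p := descPochhammer ℚ r)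
      (q := Polynomial.C (s : ℚ) * Polynomial.X + Polynomial.C (t : ℚ))
    have h2 : (Polynomial.C (s : ℚ) * Polynomial.X + Polynomial.C (t : ℚ)).natDegree ≤ 1 :=
      Polynomial.natDegree_linear_le
    rw [descPochhammer_natDegree] at h1
    have h3 := h1.trans (Nat.mul_le_mul_left r h2)
    norm_cast
    omega
  · intro b
    have h := Ring.descPochhammer_eq_factorial_smul_choose (s * (b : ℤ) + t) r
    have h2 : ((descPochhammer ℤ r).eval (s * (b : ℤ) + t) : ℤ) =
        r.factorial * Ring.choose (s * (b : ℤ) + t) r := by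
      rw [← nsmul_eq_mul, ← h, Polynomial.eval_eq_smeval]
    have h3 : (descPochhammer ℚ r).eval ((s * (b : ℤ) + t : ℤ) : ℚ) =
        ((descPochhammer ℤ r).eval (s * (b : ℤ) + t) : ℤ) := by
      rw [← descPochhammer_map (Int.castRingHom ℚ) r]
      exact Polynomial.eval_intCast_map _ _ _
    rw [Polynomial.eval_smul, Polynomial.eval_comp]
    simp only [Polynomial.eval_add, Polynomial.eval_mul, Polynomial.eval_C, Polynomial.eval_X]
    rw [show (s : ℚ) * b + t = ((s * (b : ℤ) + t : ℤ) : ℚ) by push_cast; rfl, h3, h2]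
    have : (r.factorial : ℚ) ≠ 0 := by positivity
    push_cast
    rw [smul_eq_mul]
    field_simp

-- Newton's expansion f(n) = Σ binom(n, k) Δ^k f(0), which stops at k < m.
open Finset in
lemma of_fwdDiff {m : ℕ} {f : ℕ → ℤ} (h : ∀ k, m ≤ k → (fwdDiff 1)^[k] f 0 = 0) : PolyLT m f := by
  have hf : ∀ n : ℕ, f n = ∑ k ∈ range m, (fwdDiff 1)^[k] f 0 * Ring.choose (1 * (n : ℤ) + 0) k := by
    intro n
    have h1 := shift_eq_sum_fwdDiff_iter 1 f n 0
    simp only [smul_eq_mul, mul_one, zero_add] at h1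
    rw [h1]
    have h2 : ∀ k, (n.choose k • (fwdDiff 1)^[k] f 0 : ℤ) =
        (fwdDiff 1)^[k] f 0 * Ring.choose (1 * (n : ℤ) + 0) k := by
      intro k
      rw [one_mul, add_zero, Ring.choose_natCast, nsmul_eq_mul, mul_comm]
    simp_rw [h2]
    -- Both sums are extended to `max (n + 1) m`: the added terms vanish on one side because Δ^k
    -- f(0) = 0 or on the other because binom(n, k) = 0.
    rw [sum_subset (range_mono (le_max_left (n + 1) m)),
      sum_subset (range_mono (le_max_right (n + 1) m))]
    · intro k _ hk
      rw [h k (by simpa using hk), zero_mul]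
    · intro k _ hk
      rw [one_mul, add_zero, Ring.choose_natCast,
        Nat.choose_eq_zero_of_lt (by simp at hk; omega)]
      simp
  have : PolyLT m (fun n : ℕ => ∑ k ∈ range m, (fwdDiff 1)^[k] f 0 * Ring.choose (1 * (n : ℤ) + 0) k) :=
    sum _ fun k hk => ((choose k 1 0).const_mul _).mono (by simp at hk; omega)
  rwa [← (funext hf : f = _)] at this

lemma eq_of_eventually {p p' : ℕ} {e f : ℕ → ℤ} (he : PolyLT p e) (hf : PolyLT p' f)
    (h : ∀ᶠ a in Filter.atTop, e a = f a) (a : ℕ) : e a = f a := by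
  obtain ⟨q, -, hq⟩ := he
  obtain ⟨q', -, hq'⟩ := hf
  obtain ⟨N, hN⟩ := Filter.eventually_atTop.1 h
  have : q = q' := by
    refine Polynomial.eq_of_infinite_eval_eq q q' ?_
    refine Set.Infinite.mono (s := (fun n : ℕ => (n : ℚ)) '' Set.Ici N) ?_ ?_
    · rintro _ ⟨n, hn, rfl⟩
      change Polynomial.eval (n : ℚ) q = Polynomial.eval (n : ℚ) q'
      rw [← hq, ← hq', hN n hn]
    · exact (Set.Ici_infinite N).image (Nat.cast_injective.injOn)
  have h1 : (e a : ℚ) = f a := by rw [hq, hq', this]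
  exact_mod_cast h1

end PolyLT

lemma IsPoly.polyLT_snd {m : ℕ} {g : ℕ → ℕ → ℤ} (hg : IsPoly m g) (a : ℕ) : PolyLT m (g a) := by
  refine PolyLT.of_fwdDiff fun k hk => ?_
  have : ∀ k, ∀ g : ℕ → ℕ → ℤ, IsPoly k g → (fwdDiff 1)^[k] (g a) 0 = 0 := by
    intro k
    induction k with
    | zero => intro g hg; exact hg a 0
    | succ k ih => intro g hg; exact ih _ hg.2
  exact this k g (hg.mono hk)

lemma IsPoly.polyLT_fst {m : ℕ} {g : ℕ → ℕ → ℤ} (hg : IsPoly m g) (b : ℕ) :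
    PolyLT m (fun a => g a b) := by
  refine PolyLT.of_fwdDiff fun k hk => ?_
  have : ∀ k, ∀ g : ℕ → ℕ → ℤ, IsPoly k g → (fwdDiff 1)^[k] (fun a => g a b) 0 = 0 := by
    intro k
    induction k with
    | zero => intro g hg; exact hg 0 b
    | succ k ih => intro g hg; exact ih _ hg.1
  exact this k g (hg.mono hk)

end GradedTor
end

/-! ### Growth and degree -/

noncomputable section
namespace GradedTor

lemma natDegree_le_of_growth {Q : Polynomial ℚ} {C : ℚ} {D : ℕ}
    (h : ∀ N : ℕ, 1 ≤ N → |Q.eval (N : ℚ)| ≤ C * (N : ℚ) ^ D) : Q.natDegree ≤ D := by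
  by_contra hlt
  push Not at hlt
  have h1 : ((Polynomial.X ^ D : Polynomial ℚ)).degree < Q.degree := by
    rw [Polynomial.degree_X_pow]
    rw [Polynomial.degree_eq_natDegree (fun h => by simp [h] at hlt)]; exact_mod_cast hlt
  have h2 := Polynomial.abs_div_tendsto_atTop_atTop_of_degree_gt Q (Polynomial.X ^ D) h1
    (pow_ne_zero _ Polynomial.X_ne_zero)
  have h3 := h2.comp (tendsto_natCast_atTop_atTop (R := ℚ))
  obtain ⟨N, hN⟩ := Filter.eventually_atTop.1 (h3.eventually_gt_atTop C)
  have h4 := hN (max N 1) (le_max_left _ _)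
  have h5 := h (max N 1) (le_max_right _ _)
  have h6 : (0 : ℚ) < ((max N 1 : ℕ) : ℚ) ^ D := by positivity
  simp only [Function.comp, Polynomial.eval_pow, Polynomial.eval_X] at h4
  rw [abs_div, abs_of_pos h6, lt_div_iff₀ h6] at h4
  exact absurd h5 (not_le.2 h4)

lemma PolyLT.of_growth {m D : ℕ} {S : ℕ → ℤ} {C : ℤ} (hS : PolyLT m S)
    (h : ∀ N : ℕ, 1 ≤ N → |S N| ≤ C * (N : ℤ) ^ D) : PolyLT (D + 1) S := by
  obtain ⟨q, -, hq⟩ := hS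
  refine ⟨q, ?_, hq⟩
  rw [Polynomial.mem_degreeLT]
  refine lt_of_le_of_lt Polynomial.degree_le_natDegree ?_
  have := natDegree_le_of_growth (Q := q) (C := C) (D := D) fun N hN => by
    rw [← hq]; exact_mod_cast h N hN
  exact_mod_cast Nat.lt_succ_of_le this

lemma fwdDiff_iterate_cast (k : ℕ) (S : ℕ → ℤ) (n : ℕ) :
    (((fwdDiff 1)^[k] S n : ℤ) : ℚ) = (fwdDiff 1)^[k] (fun n => (S n : ℚ)) n := by
  induction k generalizing S with
  | zero => rfl
  | succ k ih =>
    rw [Function.iterate_succ_apply, Function.iterate_succ_apply, ih]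
    refine congrArg (fun G : ℕ → ℚ => (fwdDiff 1)^[k] G n) ?_
    ext n
    simp [fwdDiff]

lemma PolyLT.fwdDiff_eq_zero {m k : ℕ} {S : ℕ → ℤ} (hS : PolyLT m S) (hk : m ≤ k) (n : ℕ) :
    (fwdDiff 1)^[k] S n = 0 := by
  obtain ⟨q, hq, h⟩ := hS
  have h0 : (fwdDiff (1 : ℚ))^[k] q.eval = 0 := by
    by_cases hk0 : q = 0
    · subst hk0
      have : (Polynomial.eval · (0 : Polynomial ℚ)) = fun _ : ℚ => (0 : ℚ) := by ext; simp
      rw [this]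
      clear * -
      induction k with
      | zero => rfl
      | succ k ih => rw [Function.iterate_succ_apply]; simpa using ih
    · refine Polynomial.fwdDiff_iter_eq_zero_of_degree_lt ?_
      rw [Polynomial.mem_degreeLT] at hq
      exact ((Polynomial.natDegree_lt_iff_degree_lt hk0).2 hq).trans_le hk
  have h1 : ∀ (k : ℕ) (F : ℚ → ℚ) (n : ℕ), (fwdDiff 1)^[k] (fun n : ℕ => F n) n =
      (fwdDiff (1 : ℚ))^[k] F n := by
    intro k
    induction k with
    | zero => intro F n; rfl
    | succ k ih =>
      intro F n
      rw [Function.iterate_succ_apply, Function.iterate_succ_apply, ← ih]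
      refine congrArg (fun G : ℕ → ℚ => (fwdDiff 1)^[k] G _) ?_
      ext n
      simp [fwdDiff]
  have h2 := fwdDiff_iterate_cast k S n
  simp_rw [h] at h2
  rw [h1 k (fun x => q.eval x), h0, Pi.zero_apply] at h2
  exact_mod_cast h2

/-- A nonnegative polynomial function of two variables, monotone in the first one, whose sums over
boxes of size `N` are `O(N ^ D)`, has total degree less than `D`. -/
theorem IsPoly.of_growth {m D : ℕ} {g : ℕ → ℕ → ℤ} (hg : IsPoly m g) (h0 : ∀ a b, 0 ≤ g a b)
    (hmono : ∀ a b, g a b ≤ g (a + 1) b)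
    (hgrow : ∀ u : ℕ, ∃ C : ℤ, ∀ N : ℕ,
      ∑ b ∈ Finset.range (N + 1), g (u * N) b ≤ C * ((N : ℤ) + 1) ^ D) : IsPoly D g := by
  induction m with
  | zero => exact hg.mono (Nat.zero_le _)
  | succ m ih =>
    rcases Nat.lt_or_ge m D with hm | hm
    · exact hg.mono hm
    refine ih (hg.of_leadPoly_eq_zero ?_)
    -- Along the ray (u b, b) the m-th difference is constant, equal to the value of `leadPoly` at
    -- u. The partial sums S over this ray are a polynomial in N of degree at most D ≤ m, so their
    -- difference of order m + 1, which is that constant, vanishes.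
    have key : ∀ u : ℕ, (leadPoly m g).eval (u : ℤ) = 0 := by
      intro u
      obtain ⟨C, hC⟩ := hgrow u
      set p : ℕ → ℤ := fun b => g (u * b) b with hp
      have hp1 : ∀ (r : ℕ) (g : ℕ → ℕ → ℤ) (b : ℕ), (fwdDiff 1)^[r] (fun b => g (u * b) b) b =
          (dirDiff u)^[r] g (u * b) b := by
        intro r
        induction r with
        | zero => intro g b; rfl
        | succ r ihr =>
          intro g b
          rw [Function.iterate_succ_apply, Function.iterate_succ_apply, ← ihr]
          congr 1
      set S : ℕ → ℤ := fun N => ∑ b ∈ Finset.range N, p b with hS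
      have hS1 : fwdDiff 1 S = p := by
        ext N
        simp [fwdDiff, hS, Finset.sum_range_succ]
      have hS2 : PolyLT (m + 2) S := by
        refine PolyLT.of_fwdDiff fun k hk => ?_
        obtain ⟨k, rfl⟩ : ∃ k', k = k' + 1 := ⟨k - 1, by omega⟩
        rw [Function.iterate_succ_apply, hS1, hp, hp1]
        exact (hg.mono (by omega : m + 1 ≤ k)).dirDiff_iterate_eq_zero u _ _
      have hmono' : ∀ a a' b, a ≤ a' → g a b ≤ g a' b := by
        intro a a' b h
        induction a', h using Nat.le_induction with
        | base => exact le_rfl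
        | succ a' _ iha => exact iha.trans (hmono _ _)
      have hS3 : PolyLT (D + 1) S := by
        refine hS2.of_growth (C := C) fun N hN => ?_
        obtain ⟨N, rfl⟩ : ∃ N', N = N' + 1 := ⟨N - 1, by omega⟩
        rw [abs_of_nonneg (Finset.sum_nonneg fun b _ => h0 _ _)]
        -- Monotonicity compares the ray with the box: g(u b, b) ≤ g(u N, b) for b ≤ N.
        refine le_trans (Finset.sum_le_sum fun b hb => ?_) ((hC N).trans (by push_cast; rfl))
        exact hmono' _ _ _ (Nat.mul_le_mul_left _ (by simp at hb; omega))
      have h4 := hS3.fwdDiff_eq_zero (show D + 1 ≤ m + 1 by omega) 0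
      rw [Function.iterate_succ_apply, hS1, hp, hp1, hg.dirDiff_iterate] at h4
      exact h4
    refine Polynomial.eq_zero_of_infinite_isRoot _ ?_
    refine Set.Infinite.mono (s := Set.range (fun n : ℕ => (n : ℤ))) ?_
      (Set.infinite_range_of_injective Nat.cast_injective)
    rintro _ ⟨u, rfl⟩
    exact key u

/-! ### Coefficients of binomial expansions -/

/-- Coefficients of a polynomial function with respect to a binomial basis in one of the variables
are polynomial functions of the other variable. -/
theorem IsPoly.polyLT_coeff (D : ℕ) {m : ℕ} {g : ℕ → ℕ → ℤ} (δ t : ℤ) (e : ℕ → ℕ → ℤ)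
    (hg : IsPoly m g)
    (h : ∀ b : ℕ, ∀ᶠ a : ℕ in Filter.atTop, g a b = ∑ j ∈ Finset.range D, (-1) ^ j * e b j *
      Ring.choose ((a : ℤ) + δ * b + t + ((D - 1 - j : ℕ) : ℤ)) (D - 1 - j)) :
    ∀ j < D, PolyLT (m + j + 1 - D) (fun b => e b j) := by
  induction D generalizing m g t with
  | zero => intro j hj; omega
  | succ D ih =>
    -- By Pascal's rule a difference in a lowers `m` and the length by one, drops the constant term
    -- `e b D`, keeps the other coefficients and replaces `t` by `t + 1`.
    have h1 : ∀ j < D, PolyLT (m + j - D) (fun b => e b j) := by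
      intro j hj
      have := ih (m := m - 1) (g := fun a b => g (a + 1) b - g a b) (t + 1)
        hg.diff_fst ?_ j hj
      · exact this.mono (by omega)
      · intro b
        filter_upwards [h b, (Filter.tendsto_add_atTop_nat 1).eventually (h b)] with a h1 h2
        rw [h1, h2, Finset.sum_range_succ, Finset.sum_range_succ]
        simp only [Nat.add_sub_cancel, Nat.sub_self, Ring.choose_zero_right]
        rw [add_sub_add_right_eq_sub, ← Finset.sum_sub_distrib]
        refine Finset.sum_congr rfl fun j hj => ?_
        obtain ⟨s, hs⟩ : ∃ s, D - j = s + 1 := ⟨D - j - 1, by simp at hj; omega⟩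
        rw [hs, show D - 1 - j = s by omega, ← mul_sub]
        congr 1
        push_cast
        rw [show (a : ℤ) + 1 + δ * b + t + (s + 1) = ((a : ℤ) + δ * b + t + (s + 1)) + 1 by ring,
          Ring.choose_succ_succ, add_sub_cancel_right]
        congr 1; ring
    intro j hj
    rcases Nat.lt_succ_iff_lt_or_eq.1 hj with hj | rfl
    · exact (h1 j hj).mono (by omega)
    -- The expansion holds for large a between polynomials in a, hence also at a = 0, where it can
    -- be solved for the last coefficient.
    have h2 : ∀ b, (-1) ^ j * e b j = g 0 b - ∑ i ∈ Finset.range j, (-1) ^ i * e b i *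
        Ring.choose (δ * b + (t + ((j - i : ℕ) : ℤ))) (j - i) := by
      intro b
      have h3 : ∀ a : ℕ, g a b = ∑ i ∈ Finset.range (j + 1), (-1) ^ i * e b i *
          Ring.choose (1 * (a : ℤ) + (δ * b + t + ((j - i : ℕ) : ℤ))) (j - i) := by
        refine PolyLT.eq_of_eventually (hg.polyLT_fst b) (p' := j + 1) ?_ ?_
        · refine PolyLT.sum _ fun i hi => PolyLT.const_mul _ ?_
          exact (PolyLT.choose _ _ _).mono (by omega)
        · filter_upwards [h b] with a ha
          rw [ha]
          refine Finset.sum_congr rfl fun i hi => ?_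
          simp only [Nat.add_sub_cancel]
          congr 2
          ring
      have h4 := h3 0
      rw [Finset.sum_range_succ] at h4
      simp only [Nat.sub_self, Ring.choose_zero_right, mul_one] at h4
      rw [h4, eq_comm, sub_eq_iff_eq_add, add_comm]
      congr 1
      refine Finset.sum_congr rfl fun i _ => ?_
      congr 2
      push_cast
      ring
    have h5 : PolyLT m (fun b => (-1) ^ j * e b j) := by
      simp_rw [h2]
      refine (hg.polyLT_snd 0).sub (PolyLT.sum _ fun i hi => ?_)
      have hi' := Finset.mem_range.1 hi
      -- If `m + i < j`, the truncated bound `m + i - j` is 0 and the coefficient vanishes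
      -- identically; otherwise the degrees of the two factors add up to the bound `m`.
      rcases Nat.lt_or_ge (m + i) j with hlt | hge
      · have := ((h1 i hi').const_mul ((-1) ^ i))
        rw [show m + i - j = 0 by omega] at this
        obtain ⟨q, hq, hq'⟩ := this
        have hq0 : q = 0 := by
          rw [Polynomial.mem_degreeLT] at hq
          exact Polynomial.degree_eq_bot.1 (by
            by_contra hne
            rw [Polynomial.degree_eq_natDegree (fun h => hne (by simp [h]))] at hq
            norm_cast at hq)
        have hz : ∀ b : ℕ, (-1) ^ i * e b i = 0 := fun b => by
          have := hq' b
          rw [hq0, Polynomial.eval_zero] at this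
          exact_mod_cast this
        convert PolyLT.zero m using 2 with b
        rw [hz, zero_mul]
      · exact (((h1 i hi').const_mul ((-1) ^ i)).mul
          (PolyLT.choose (j - i) δ (t + ((j - i : ℕ) : ℤ)))).mono (by omega)
    have h6 := h5.const_mul ((-1) ^ j)
    refine PolyLT.mono ?_ (show m ≤ m + j + 1 - (j + 1) by omega)
    convert h6 using 2 with b
    rw [← mul_assoc, ← mul_pow]
    simp

/-- Functions `ℤ → ℤ` whose `D`th difference vanishes eventually. -/
def EvPoly : ℕ → (ℤ → ℤ) → Prop
  | 0, f => ∀ᶠ c in Filter.atTop, f c = 0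
  | D + 1, f => EvPoly D (fun c => f c - f (c - 1))

/-- A function whose `D`th difference vanishes eventually has an expansion in the binomial basis. -/
lemma EvPoly.exists_coeffs {D : ℕ} {f : ℤ → ℤ} (hf : EvPoly D f) : ∃ e : ℕ → ℤ,
    (∀ᶠ c : ℤ in Filter.atTop, f c = ∑ j ∈ Finset.range D, (-1) ^ j * e j *
      Ring.choose (c + ((D - 1 - j : ℕ) : ℤ)) (D - 1 - j)) ∧ ∀ j, D ≤ j → e j = 0 := by
  induction D generalizing f with
  | zero => exact ⟨fun _ => 0, by simpa [EvPoly] using hf, fun _ _ => rfl⟩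
  | succ D ih =>
    obtain ⟨e, he, he0⟩ := ih hf
    -- Summing the expansion of the difference recovers `f` up to `R`, which is eventually constant
    -- and, up to sign, is the missing last coefficient.
    set R : ℤ → ℤ := fun c => f c - ∑ j ∈ Finset.range D, (-1) ^ j * e j *
      Ring.choose (c + ((D - j : ℕ) : ℤ)) (D - j) with hR
    obtain ⟨c0, hc0⟩ := Filter.eventually_atTop.1 he
    have h1 : ∀ c, c0 ≤ c → R c = R (c - 1) := by
      intro c hc
      have h2 := hc0 c hc
      rw [← sub_eq_zero]
      simp only [hR]
      rw [sub_sub_sub_comm, ← Finset.sum_sub_distrib, h2, ← Finset.sum_sub_distrib]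
      refine Finset.sum_eq_zero fun j hj => ?_
      obtain ⟨s, hs⟩ : ∃ s, D - j = s + 1 := ⟨D - j - 1, by simp at hj; omega⟩
      rw [hs, show D - 1 - j = s by omega, ← mul_sub, ← mul_sub]
      push_cast
      rw [show c + ((s : ℤ) + 1) = (c + s) + 1 by ring, Ring.choose_succ_succ,
        show c - 1 + ((s : ℤ) + 1) = c + s by ring]
      ring
    have h2 : ∀ n : ℕ, R (c0 + n) = R c0 := by
      intro n
      induction n with
      | zero => simp
      | succ n ihn => rw [h1 _ (by push_cast; omega), ← ihn]; congr 1; push_cast; ring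
    refine ⟨fun j => if j = D then (-1) ^ D * R c0 else e j, ?_, ?_⟩
    · refine Filter.eventually_atTop.2 ⟨c0, fun c hc => ?_⟩
      obtain ⟨n, rfl⟩ : ∃ n : ℕ, c = c0 + n := ⟨(c - c0).toNat, by omega⟩
      rw [Finset.sum_range_succ]
      simp only [if_true, Nat.add_sub_cancel, Nat.sub_self, Ring.choose_zero_right, mul_one]
      rw [← mul_assoc, ← mul_pow]
      simp only [mul_neg, mul_one, neg_neg, one_pow, one_mul]
      rw [← h2 n, ← sub_eq_iff_eq_add']
      simp only [hR]
      congr 1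
      refine Finset.sum_congr rfl fun j hj => ?_
      rw [if_neg (by simp at hj; omega)]
    · intro j hj
      simp only
      rw [if_neg (by omega), he0 j (by omega)]

end GradedTor
end

/-! ### Summation, difference operators and polynomial behaviour on slanted regions -/

noncomputable section
namespace GradedTor

section Summation

/-- The summation `∑_{b ≤ c} f(b)`. -/
def sumUp (f : ℤ → ℤ) (c : ℤ) : ℤ := ∑ᶠ b ∈ Set.Iic c, f b

variable {f : ℤ → ℤ} {c₀ : ℤ}

lemma sumUp_eq_sum (hf : ∀ c < c₀, f c = 0) (c : ℤ) : sumUp f c = ∑ b ∈ Finset.Icc c₀ c, f b := by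
  unfold sumUp
  rw [finsum_mem_eq_sum_of_inter_support_eq]
  ext b
  simp only [Set.mem_inter_iff, Set.mem_Iic, Function.mem_support, Finset.coe_Icc, Set.mem_Icc]
  constructor
  · rintro ⟨h1, h2⟩
    exact ⟨⟨by by_contra h; exact h2 (hf b (by omega)), h1⟩, h2⟩
  · rintro ⟨h1, h2⟩
    exact ⟨h1.2, h2⟩

lemma sumUp_eq_zero (hf : ∀ c < c₀, f c = 0) {c : ℤ} (hc : c < c₀) : sumUp f c = 0 := by
  rw [sumUp_eq_sum hf, Finset.Icc_eq_empty (by omega), Finset.sum_empty]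

lemma sumUp_sub (hf : ∀ c < c₀, f c = 0) (c : ℤ) : sumUp f c - sumUp f (c - 1) = f c := by
  rcases lt_or_ge c c₀ with h | h
  · rw [sumUp_eq_zero hf h, sumUp_eq_zero hf (by omega), hf c h, sub_zero]
  · rw [sumUp_eq_sum hf, sumUp_eq_sum hf, ← Finset.insert_Icc_sub_one_right_eq_Icc h,
      Finset.sum_insert (by simp), add_sub_cancel_right]

lemma sumUp_nonneg (h0 : ∀ c, 0 ≤ f c) (c : ℤ) : 0 ≤ sumUp f c :=
  finsum_nonneg fun b => finsum_nonneg fun _ => h0 b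

lemma sumUp_mono (hf : ∀ c < c₀, f c = 0) (h0 : ∀ c, 0 ≤ f c) {c c' : ℤ} (h : c ≤ c') :
    sumUp f c ≤ sumUp f c' := by
  rw [sumUp_eq_sum hf, sumUp_eq_sum hf]
  exact Finset.sum_le_sum_of_subset_of_nonneg (Finset.Icc_subset_Icc_right h) fun b _ _ => h0 b

lemma sumUp_le (hf : ∀ c < c₀, f c = 0) (hmono : ∀ c c', c ≤ c' → f c ≤ f c')
    (c : ℤ) : sumUp f c ≤ ((c - c₀ + 1).toNat : ℤ) * f c := by
  rw [sumUp_eq_sum hf]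
  refine (Finset.sum_le_card_nsmul _ _ (f c) fun b hb => hmono _ _ (Finset.mem_Icc.1 hb).2).trans ?_
  rw [nsmul_eq_mul, Int.card_Icc, show c + 1 - c₀ = c - c₀ + 1 by ring]

lemma eq_of_sub_eq {F G : ℤ → ℤ} (hF : ∀ c < c₀, F c = 0) (hG : ∀ c < c₀, G c = 0)
    (h : ∀ c, F c - F (c - 1) = G c - G (c - 1)) (c : ℤ) : F c = G c := by
  have key : ∀ n : ℕ, F (c₀ - 1 + n) = G (c₀ - 1 + n) := by
    intro n
    induction n with
    | zero => rw [hF _ (by simp), hG _ (by simp)]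
    | succ n ih =>
      have := h (c₀ - 1 + (n + 1 : ℕ))
      rw [show c₀ - 1 + ((n + 1 : ℕ) : ℤ) - 1 = c₀ - 1 + n by push_cast; ring, ih] at this
      linarith
  rcases lt_or_ge c c₀ with hc | hc
  · rw [hF c hc, hG c hc]
  · have := key (c - c₀ + 1).toNat
    rwa [show c₀ - 1 + (((c - c₀ + 1).toNat : ℕ) : ℤ) = c by omega] at this

end Summation

section Differences

/-- The difference `f(a) - f(a - d)`. -/
def bdiff {ι : Type*} [AddCommGroup ι] (d : ι) (f : ι → ℤ) (a : ι) : ℤ := f a - f (a - d)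

/-- The composition of the difference operators attached to the members of a list. -/
def bdiffs {ι : Type*} [AddCommGroup ι] : List ι → (ι → ℤ) → ι → ℤ
  | [], f => f
  | d :: l, f => bdiffs l (bdiff d f)

variable {ι : Type*} [AddCommGroup ι]

lemma bdiff_comm (d d' : ι) (f : ι → ℤ) : bdiff d (bdiff d' f) = bdiff d' (bdiff d f) := by
  ext a
  simp only [bdiff]
  rw [sub_right_comm a d d']
  ring

lemma bdiffs_perm {l l' : List ι} (h : l.Perm l') (f : ι → ℤ) : bdiffs l f = bdiffs l' f := by
  induction h generalizing f with
  | nil => rfl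
  | cons x _ ih => exact ih _
  | swap x y l => exact congrArg (bdiffs l) (bdiff_comm _ _ _)
  | trans _ _ ih1 ih2 => rw [ih1, ih2]

/-- Used for the exact sequence of Hilbert–Serre, in which the kernel of an operator enters shifted
by the degree of the operator. -/
lemma bdiffs_sub_shift (l : List ι) (f g : ι → ℤ) (d : ι) :
    bdiffs l (fun a => f a - g (a - d)) = fun a => bdiffs l f a - bdiffs l g (a - d) := by
  induction l generalizing f g with
  | nil => rfl
  | cons x l ih =>
    simp only [bdiffs]
    rw [← ih]
    congr 1
    ext a
    simp only [bdiff]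
    rw [sub_right_comm a d x]
    ring

end Differences

/-- `F` is a polynomial function of total degree less than `m` on the region
`k ≥ k₀, c ≥ c₀ + δ k`. -/
def RegionPoly (m δ k₀ : ℕ) (c₀ : ℤ) (F : ℤ → ℤ → ℤ) : Prop :=
  IsPoly m fun a b => F (c₀ + δ * ((b : ℤ) + k₀) + a) ((b : ℤ) + k₀)

lemma RegionPoly.mono {m m' δ k₀ k₀' : ℕ} {c₀ c₀' : ℤ} {F : ℤ → ℤ → ℤ}
    (h : RegionPoly m δ k₀ c₀ F) (hm : m ≤ m') (hk : k₀ ≤ k₀') (hc : c₀ ≤ c₀') :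
    RegionPoly m' δ k₀' c₀' F := by
  obtain ⟨s, rfl⟩ := Int.le.dest hc
  obtain ⟨t, rfl⟩ := Nat.exists_eq_add_of_le hk
  refine (congrArg (IsPoly m') ?_).mp ((h.shift s t).mono hm)
  ext a b
  push_cast
  congr 1 <;> ring

/-- In the coordinates of the region a step in b is (δ, 1), that is, one step (d, 1) followed by δ -
d steps (1, 0). -/
lemma RegionPoly.of_differences {m δ k₀ d : ℕ} {c₀ : ℤ} {F : ℤ → ℤ → ℤ} (hd : d ≤ δ)
    (h1 : RegionPoly m δ k₀ c₀ fun c k => F c k - F (c - 1) k)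
    (h2 : RegionPoly m δ k₀ c₀ fun c k => F c k - F (c - d) (k - 1)) :
    RegionPoly (m + 1) δ k₀ c₀ F := by
  refine ⟨?_, ?_⟩
  · refine (congrArg (IsPoly m) ?_).mp (h1.shift 1 0)
    ext a b
    push_cast
    congr 2
    ring
  · have h3 : IsPoly m _ :=
      IsPoly.sum (Finset.range (δ - d)) fun t _ => IsPoly.shift (t + 1) 0 h1
    refine (congrArg (IsPoly m) ?_).mp ((h2.shift 0 1).add h3)
    ext a b
    have h4 := Finset.sum_range_sub (fun t : ℕ => F (c₀ + δ * ((b : ℤ) + k₀) + a + t) ((b : ℤ) + k₀))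
      (δ - d)
    have h5 : ∀ t : ℕ, F (c₀ + δ * (((b + 0 : ℕ) : ℤ) + k₀) + ((a + (t + 1) : ℕ) : ℤ))
        (((b + 0 : ℕ) : ℤ) + k₀) - F (c₀ + δ * (((b + 0 : ℕ) : ℤ) + k₀) + ((a + (t + 1) : ℕ) : ℤ) - 1)
        (((b + 0 : ℕ) : ℤ) + k₀) =
        F (c₀ + δ * ((b : ℤ) + k₀) + a + (t + 1 : ℕ)) ((b : ℤ) + k₀) -
        F (c₀ + δ * ((b : ℤ) + k₀) + a + t) ((b : ℤ) + k₀) := by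
      intro t
      push_cast
      congr 2 <;> ring
    simp_rw [h5]
    rw [h4]
    push_cast [Nat.cast_sub hd]
    rw [show c₀ + δ * ((b : ℤ) + 1 + k₀) + (a + 0) - d = c₀ + δ * ((b : ℤ) + k₀) + a + (δ - d) by ring,
      show (b : ℤ) + 1 + k₀ - 1 = b + k₀ by ring]
    simp

lemma bdiff_vanish {f : ℤ × ℤ → ℤ} {c₀ : ℤ} (hf : ∀ c k, c < c₀ ∨ k < 0 → f (c, k) = 0)
    {d e : ℕ} (c k : ℤ) (h : c < c₀ ∨ k < 0) : bdiff ((d : ℤ), (e : ℤ)) f (c, k) = 0 := by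
  rw [bdiff, hf c k h, Prod.mk_sub_mk, hf _ _ (by omega), sub_zero]

/-- Undoing a difference adds up values along steps (d, 1) with d ≤ δ, so finite support can spread
only inside a cone of slope δ. -/
lemma exists_cone_of_finite {δ : ℕ} {c₀ : ℤ} (L : List ℕ) (hL : ∀ d ∈ L, d ≤ δ) (f : ℤ × ℤ → ℤ)
    (hf : ∀ c k, c < c₀ ∨ k < 0 → f (c, k) = 0)
    (hfin : {p | bdiffs (L.map fun d : ℕ => ((d : ℤ), (1 : ℤ))) f p ≠ 0}.Finite) :
    ∃ c₁ : ℤ, ∀ c k : ℤ, c₁ + δ * k < c → f (c, k) = 0 := by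
  induction L generalizing f with
  | nil =>
    obtain ⟨c₁, hc₁⟩ := (hfin.image Prod.fst).bddAbove
    refine ⟨c₁, fun c k h => ?_⟩
    rcases lt_or_ge k 0 with hk | hk
    · exact hf c k (Or.inr hk)
    · by_contra hne
      have := hc₁ ⟨(c, k), hne, rfl⟩
      have : (0 : ℤ) ≤ δ * k := by positivity
      simp only at *
      omega
  | cons d L ih =>
    obtain ⟨c₁, hc₁⟩ := ih (fun x hx => hL x (List.mem_cons_of_mem _ hx)) (bdiff ((d : ℤ), 1) f)
      (fun c k h => bdiff_vanish (e := 1) hf c k h) hfin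
    have hd : (d : ℤ) ≤ δ := by exact_mod_cast hL d List.mem_cons_self
    have key : ∀ (n : ℕ) (c k : ℤ), k < n → c₁ + δ * k < c → f (c, k) = 0 := by
      intro n
      induction n with
      | zero => intro c k hk _; exact hf c k (Or.inr (by exact_mod_cast hk))
      | succ n ihn =>
        intro c k hk h
        have h1 := hc₁ c k h
        rw [bdiff, Prod.mk_sub_mk, ihn (c - d) (k - 1) (by push_cast at hk; omega) (by linarith [mul_sub (δ : ℤ) k 1]),
          sub_zero] at h1
        exact h1
    exact ⟨c₁, fun c k h => key (k + 1).toNat c k (by omega) h⟩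

/-- Undoing a difference (1, 0) does not change k, so the support stays bounded in k. -/
lemma exists_bound_of_finite {c₀ : ℤ} (n : ℕ) (f : ℤ × ℤ → ℤ)
    (hf : ∀ c k, c < c₀ ∨ k < 0 → f (c, k) = 0)
    (hfin : {p | bdiffs (List.replicate n ((1 : ℤ), (0 : ℤ))) f p ≠ 0}.Finite) :
    ∃ k₁ : ℕ, ∀ c k : ℤ, k₁ < k → f (c, k) = 0 := by
  induction n generalizing f with
  | zero =>
    obtain ⟨k₁, hk₁⟩ := (hfin.image Prod.snd).bddAbove
    refine ⟨k₁.toNat, fun c k h => ?_⟩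
    by_contra hne
    have := hk₁ ⟨(c, k), hne, rfl⟩
    simp only at this
    omega
  | succ n ih =>
    obtain ⟨k₁, hk₁⟩ := ih (bdiff (1, 0) f)
      (fun c k h => bdiff_vanish (d := 1) (e := 0) hf c k h) hfin
    refine ⟨k₁, fun c k h => ?_⟩
    refine eq_of_sub_eq (F := fun c => f (c, k)) (G := fun _ => 0) (c₀ := c₀)
      (fun c hc => hf c k (Or.inl hc)) (fun _ _ => rfl) (fun c => ?_) c
    have := hk₁ c k h
    rw [bdiff, Prod.mk_sub_mk, sub_zero k] at this
    simpa using this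

lemma sumUp_bdiff {f : ℤ × ℤ → ℤ} {c₀ : ℤ} (hf : ∀ c k, c < c₀ ∨ k < 0 → f (c, k) = 0)
    (d e : ℕ) (c k : ℤ) : sumUp (fun b => bdiff ((d : ℤ), (e : ℤ)) f (b, k)) c =
      sumUp (fun b => f (b, k)) c - sumUp (fun b => f (b, k - e)) (c - d) := by
  have hx : ∀ c k, sumUp (fun b => f (b, k)) c - sumUp (fun b => f (b, k)) (c - 1) = f (c, k) :=
    fun c k => sumUp_sub (c₀ := c₀) (fun c hc => hf c k (Or.inl hc)) c
  have h0 : ∀ c < c₀, bdiff ((d : ℤ), (e : ℤ)) f (c, k) = 0 :=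
    fun c hc => bdiff_vanish hf c k (Or.inl hc)
  refine eq_of_sub_eq (c₀ := c₀)
    (F := fun c => sumUp (fun b => bdiff ((d : ℤ), (e : ℤ)) f (b, k)) c)
    (G := fun c => sumUp (fun b => f (b, k)) c - sumUp (fun b => f (b, k - e)) (c - d))
    (fun c hc => sumUp_eq_zero h0 hc) (fun c hc => ?_) (fun c => ?_) c
  · rw [sumUp_eq_zero (c₀ := c₀) (fun c hc => hf c k (Or.inl hc)) hc,
      sumUp_eq_zero (c₀ := c₀) (fun c hc => hf c (k - e) (Or.inl hc)) (by omega), sub_zero]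
  · rw [sumUp_sub h0, bdiff, Prod.mk_sub_mk, ← hx c k, ← hx (c - d) (k - e),
      sub_right_comm c (d : ℤ) 1]
    ring

/-- If enough differences of `f` have finite support, then the summation of `f` in the first
variable is polynomial on a region `k ≥ k₀, c ≥ c₀ + δ k`. -/
theorem regionPoly_sumUp {δ : ℕ} {c₀ : ℤ} (L : List ℕ) (hL : ∀ d ∈ L, d ≤ δ) (n : ℕ)
    (f : ℤ × ℤ → ℤ) (hf : ∀ c k, c < c₀ ∨ k < 0 → f (c, k) = 0)
    (hfin : {p | bdiffs (List.replicate n ((1 : ℤ), (0 : ℤ)) ++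
      L.map fun d : ℕ => ((d : ℤ), (1 : ℤ))) f p ≠ 0}.Finite) :
    ∃ m k₁ c₁, RegionPoly m δ k₁ c₁ fun c k => sumUp (fun b => f (b, k)) c := by
  induction L generalizing f n with
  | nil =>
    rw [List.map_nil, List.append_nil] at hfin
    obtain ⟨k₁, hk₁⟩ := exists_bound_of_finite n f hf hfin
    refine ⟨0, k₁ + 1, 0, fun a b => ?_⟩
    simp only
    have : ∀ x, f (x, (b : ℤ) + (k₁ + 1 : ℕ)) = 0 := fun x => hk₁ _ _ (by push_cast; omega)
    simp_rw [this]
    simp [sumUp]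
  | cons d L ih =>
    have hd : d ≤ δ := hL d List.mem_cons_self
    induction n generalizing f with
    | zero =>
      -- With no difference (1, 0) available, `f` vanishes beyond a cone, so its sums over c are
      -- constant in c there.
      obtain ⟨c₂, hc₂⟩ := exists_cone_of_finite (d :: L) hL f hf hfin
      obtain ⟨m, k₁, c₁, h⟩ := ih (fun x hx => hL x (List.mem_cons_of_mem _ hx)) 0
        (bdiff ((d : ℤ), 1) f) (fun c k h => bdiff_vanish (e := 1) hf c k h) hfin
      refine ⟨m + 1, k₁, max c₁ (c₂ + 1), RegionPoly.of_differences hd ?_ ?_⟩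
      · refine IsPoly.mono (m := 0) (fun a b => ?_) (Nat.zero_le m)
        simp only
        rw [sumUp_sub (c₀ := c₀) (fun c hc => hf c _ (Or.inl hc))]
        refine hc₂ _ _ ?_
        have := le_max_right c₁ (c₂ + 1)
        omega
      · refine (congrArg _ ?_).mp (h.mono le_rfl le_rfl (le_max_left c₁ (c₂ + 1)))
        ext c k
        exact sumUp_bdiff hf d 1 c k
    | succ n ihn =>
      -- Moving one (1, 0), respectively one (d, 1), from the list into `f` gives the two
      -- differences that `RegionPoly.of_differences` asks for.
      obtain ⟨m', k₁', c₁', h'⟩ := ihn (bdiff (1, 0) f)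
        (fun c k h => bdiff_vanish (d := 1) (e := 0) hf c k h) hfin
      obtain ⟨m, k₁, c₁, h⟩ := ih (fun x hx => hL x (List.mem_cons_of_mem _ hx)) (n + 1)
        (bdiff ((d : ℤ), 1) f) (fun c k h => bdiff_vanish (e := 1) hf c k h) (by
          rw [List.map_cons, bdiffs_perm (List.perm_middle)] at hfin
          exact hfin)
      refine ⟨max m m' + 1, max k₁ k₁', max c₁ c₁', RegionPoly.of_differences hd ?_ ?_⟩
      · refine (congrArg _ ?_).mp (h'.mono (le_max_right m m') (le_max_right k₁ k₁')
          (le_max_right c₁ c₁'))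
        ext c k
        have := sumUp_bdiff hf 1 0 c k
        rw [Nat.cast_zero, sub_zero] at this
        exact this
      · refine (congrArg _ ?_).mp (h.mono (le_max_left m m') (le_max_left k₁ k₁')
          (le_max_left c₁ c₁'))
        ext c k
        exact sumUp_bdiff hf d 1 c k

end GradedTor
end

/-! ### Closed families of subspaces and the Hilbert–Serre theorem -/

noncomputable section
namespace GradedTor

section Families

variable {K V ι τ : Type*} [Field K] [AddCommGroup V] [Module K V] [AddCommGroup ι]

/-- A family of subspaces of `V` indexed by degrees is closed under the operators `x t` of degree
`deg t`. -/
def ClosedFamily (x : τ → V →ₗ[K] V) (deg : τ → ι) (Y : ι → Submodule K V) : Prop :=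
  ∀ t a, ∀ y ∈ Y a, x t y ∈ Y (a + deg t)

/-- The ascending chain condition for closed families contained in `Z₀`. -/
def NoetherianFamily (x : τ → V →ₗ[K] V) (deg : τ → ι) (Z₀ : ι → Submodule K V) : Prop :=
  ∀ 𝒮 : Set (ι → Submodule K V), 𝒮.Nonempty → (∀ Y ∈ 𝒮, ClosedFamily x deg Y ∧ Y ≤ Z₀) →
    ∃ Y ∈ 𝒮, ∀ Y' ∈ 𝒮, Y ≤ Y' → Y' ≤ Y

variable {x : τ → V →ₗ[K] V} {deg : τ → ι} {Z₀ : ι → Submodule K V}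

lemma ClosedFamily.of_eq {Y : ι → Submodule K V} (hY : ClosedFamily x deg Y) {t : τ} {a b : ι}
    {y : V} (hy : y ∈ Y a) (h : a + deg t = b) : x t y ∈ Y b := h ▸ hY t a y hy

/-- Among the closed families generated by finitely many pieces of `Z`, a maximal one absorbs the
piece of every further degree. -/
theorem NoetherianFamily.exists_generators (hN : NoetherianFamily x deg Z₀)
    {Z : ι → Submodule K V} (hZ : ClosedFamily x deg Z) (hZ₀ : Z ≤ Z₀) : ∃ Φ : Finset ι,
      ∀ Y, ClosedFamily x deg Y → (∀ a ∈ Φ, Z a ≤ Y a) → Z ≤ Y := by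
  classical
  let gen : Finset ι → ι → Submodule K V := fun Φ b =>
    ⨅ Y : {Y : ι → Submodule K V // ClosedFamily x deg Y ∧ ∀ a ∈ Φ, Z a ≤ Y a}, Y.1 b
  have hgen : ∀ Φ, ClosedFamily x deg (gen Φ) := by
    intro Φ t a y hy
    simp only [gen, Submodule.mem_iInf] at hy ⊢
    exact fun Y => Y.2.1 t a y (hy Y)
  have hle : ∀ Φ Y, ClosedFamily x deg Y → (∀ a ∈ Φ, Z a ≤ Y a) → gen Φ ≤ Y :=
    fun Φ Y h1 h2 b => iInf_le (fun Y : {Y : ι → Submodule K V // ClosedFamily x deg Y ∧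
      ∀ a ∈ Φ, Z a ≤ Y a} => Y.1 b) ⟨Y, h1, h2⟩
  have hge : ∀ Φ, ∀ a ∈ Φ, Z a ≤ gen Φ a := fun Φ a ha => le_iInf fun Y => Y.2.2 a ha
  obtain ⟨_, ⟨Φ, rfl⟩, hmax⟩ := hN (Set.range gen) ⟨_, ∅, rfl⟩ (by
    rintro _ ⟨Φ, rfl⟩
    exact ⟨hgen Φ, (hle Φ Z hZ fun _ _ => le_rfl).trans hZ₀⟩)
  refine ⟨Φ, fun Y h1 h2 a => ?_⟩
  have h3 := hmax (gen (insert a Φ)) ⟨_, rfl⟩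
    (hle _ _ (hgen _) fun b hb => hge _ b (Finset.mem_insert_of_mem hb))
  exact (hge (insert a Φ) a (Finset.mem_insert_self a Φ)).trans ((h3 a).trans (hle Φ Y h1 h2 a))

/-- Rank–nullity for the map Z → V'/W induced by `f`, phrased without quotients. -/
lemma finrank_map_sup_add_finrank_inf_comap {V' : Type*} [AddCommGroup V'] [Module K V']
    (f : V →ₗ[K] V') (Z : Submodule K V) (W : Submodule K V') [FiniteDimensional K Z]
    [FiniteDimensional K W] :
    Module.finrank K (Z.map f ⊔ W : Submodule K V') +
      Module.finrank K (Z ⊓ W.comap f : Submodule K V) = Module.finrank K Z + Module.finrank K W := by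
  have key : ∀ (Z : Submodule K V) [FiniteDimensional K Z],
      Module.finrank K (Z.map f) + Module.finrank K (Z ⊓ LinearMap.ker f : Submodule K V) =
        Module.finrank K Z := by
    intro Z _
    have := LinearMap.finrank_range_add_finrank_ker (f.domRestrict Z)
    rw [LinearMap.range_domRestrict] at this
    rw [← this]
    congr 1
    rw [LinearMap.ker_domRestrict, (Submodule.equivSubtypeMap Z _).finrank_eq,
      Submodule.map_comap_subtype]
  have h1 := Submodule.finrank_sup_add_finrank_inf_eq (Z.map f) W
  have h2 := key Z
  have : FiniteDimensional K (Z ⊓ W.comap f : Submodule K V) :=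
    Submodule.finiteDimensional_of_le inf_le_left
  have h3 := key (Z ⊓ W.comap f)
  have h4 : Z ⊓ W.comap f ⊓ LinearMap.ker f = Z ⊓ LinearMap.ker f := by
    rw [inf_assoc, inf_eq_right.2 (LinearMap.ker_le_comap f)]
  have h5 : (Z ⊓ W.comap f).map f = Z.map f ⊓ W := by
    ext y
    constructor
    · rintro ⟨z, hz, rfl⟩
      exact ⟨⟨z, hz.1, rfl⟩, hz.2⟩
    · rintro ⟨⟨z, hz, rfl⟩, hw⟩
      exact ⟨z, ⟨hz, hw⟩, rfl⟩
  rw [h4, h5] at h3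
  omega

/-- The Hilbert–Serre theorem: the product of the difference operators attached to the operators
`x t`, applied to the Hilbert function of `Z / W`, has finite support. -/
theorem NoetherianFamily.finite_support_bdiffs (hN : NoetherianFamily x deg Z₀)
    (hcomm : ∀ s t v, x s (x t v) = x t (x s v)) (hfd : ∀ a, FiniteDimensional K (Z₀ a))
    (l : List τ) (Z W : ι → Submodule K V) (hZ : ClosedFamily x deg Z) (hW : ClosedFamily x deg W)
    (hWZ : W ≤ Z) (hZ₀ : Z ≤ Z₀) (hl : ∀ t ∉ l, ∀ a, ∀ z ∈ Z a, x t z ∈ W (a + deg t)) :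
    {a | bdiffs (l.map deg)
      (fun a => (Module.finrank K (Z a) : ℤ) - Module.finrank K (W a)) a ≠ 0}.Finite := by
  classical
  induction l generalizing Z W with
  | nil =>
    -- All operators map `Z` into `W`, so `Z` on a finite set of degrees and `W` elsewhere is a
    -- closed family. A maximal one shows that `Z` and `W` agree outside a finite set.
    obtain ⟨_, ⟨Φ, rfl⟩, hmax⟩ := hN
      (Set.range fun Φ : Finset ι => fun a => if a ∈ Φ then Z a else W a) ⟨_, ∅, rfl⟩ (by
        rintro _ ⟨Φ, rfl⟩
        have h1 : ∀ a, W a ≤ if a ∈ Φ then Z a else W a := by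
          intro a
          split_ifs
          exacts [hWZ a, le_rfl]
        have h2 : ∀ a, (if a ∈ Φ then Z a else W a) ≤ Z a := by
          intro a
          split_ifs
          exacts [le_rfl, hWZ a]
        exact ⟨fun t a y hy => h1 _ (hl t List.not_mem_nil a y (h2 a hy)),
          fun a => (h2 a).trans (hZ₀ a)⟩)
    refine Φ.finite_toSet.subset fun a ha => ?_
    by_contra hna
    apply ha
    have h3 := hmax _ ⟨insert a Φ, rfl⟩ (by
      intro b
      simp only [Finset.mem_insert]
      split_ifs with h4 h5 h5
      · exact le_rfl
      · exact absurd (Or.inr h4) h5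
      · exact hWZ b
      · exact le_rfl) a
    simp only [Finset.mem_insert_self, if_true] at h3
    rw [if_neg (by simpa using hna)] at h3
    simp only [List.map_nil, bdiffs]
    rw [le_antisymm h3 (hWZ a), sub_self]
  | cons t l ih =>
    -- Z'/W and Z/Y are the kernel and the cokernel of `x t` on Z/W; `x t` is zero on both, so the
    -- induction can drop `t`.
    set Z' : ι → Submodule K V := fun a => Z a ⊓ (W (a + deg t)).comap (x t) with hZ'
    set Y : ι → Submodule K V := fun a => (Z (a - deg t)).map (x t) ⊔ W a with hY
    have hZ'c : ClosedFamily x deg Z' := by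
      rintro s a y ⟨h1, h2⟩
      refine ⟨hZ s a y h1, ?_⟩
      rw [SetLike.mem_coe, Submodule.mem_comap, hcomm]
      exact hW.of_eq h2 (by abel)
    have hYc : ClosedFamily x deg Y := by
      intro s a y hy
      obtain ⟨_, ⟨z, hz, rfl⟩, w, hw, rfl⟩ := Submodule.mem_sup.1 hy
      rw [map_add, hcomm]
      exact Submodule.add_mem_sup (Submodule.mem_map_of_mem (hZ.of_eq hz (by abel))) (hW s a w hw)
    have hYZ : Y ≤ Z := fun a => sup_le (by
      rintro _ ⟨z, hz, rfl⟩
      exact hZ.of_eq hz (by abel)) (hWZ a)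
    have hWZ' : W ≤ Z' := fun a w hw => ⟨hWZ a hw, hW t a w hw⟩
    have fA := ih Z Y hZ hYc hYZ hZ₀ (by
      intro s hs a z hz
      by_cases hst : s = t
      · subst hst
        refine Submodule.mem_sup_left (Submodule.mem_map_of_mem ?_)
        rwa [add_sub_cancel_right]
      · exact Submodule.mem_sup_right (hl s (by simp [hst, hs]) a z hz))
    have fB := ih Z' W hZ'c hW hWZ' (fun a => inf_le_left.trans (hZ₀ a)) (by
      intro s hs a z hz
      by_cases hst : s = t
      · subst hst
        exact hz.2
      · exact hl s (by simp [hst, hs]) a z hz.1)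
    have hZfd : ∀ a, FiniteDimensional K (Z a) := fun a =>
      haveI := hfd a
      Submodule.finiteDimensional_of_le (hZ₀ a)
    have hWfd : ∀ a, FiniteDimensional K (W a) := fun a =>
      haveI := hZfd a
      Submodule.finiteDimensional_of_le (hWZ a)
    have key : bdiff (deg t) (fun a => (Module.finrank K (Z a) : ℤ) - Module.finrank K (W a)) =
        fun a => ((Module.finrank K (Z a) : ℤ) - Module.finrank K (Y a)) -
          (fun a => (Module.finrank K (Z' a) : ℤ) - Module.finrank K (W a)) (a - deg t) := by
      ext a
      have h1 := finrank_map_sup_add_finrank_inf_comap (x t) (Z (a - deg t)) (W a)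
      have h2 : Z (a - deg t) ⊓ (W a).comap (x t) = Z' (a - deg t) := by
        simp only [hZ', sub_add_cancel]
      rw [h2] at h1
      change Module.finrank K (Y a) + _ = _ at h1
      simp only [bdiff]
      omega
    rw [List.map_cons, bdiffs, key, bdiffs_sub_shift _
      (fun a => (Module.finrank K (Z a) : ℤ) - Module.finrank K (Y a))
      (fun a => (Module.finrank K (Z' a) : ℤ) - Module.finrank K (W a))]
    refine (fA.union (fB.image (· + deg t))).subset fun a ha => ?_
    by_contra hna
    rw [Set.mem_union, not_or] at hna
    apply ha
    have h1 := not_not.1 hna.1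
    have h2 : bdiffs (l.map deg)
        (fun a => (Module.finrank K (Z' a) : ℤ) - Module.finrank K (W a)) (a - deg t) = 0 := by
      by_contra h
      exact hna.2 ⟨a - deg t, h, sub_add_cancel _ _⟩
    simp only
    rw [h1, h2, sub_zero]

end Families

end GradedTor
end

/-! ### Krull dimension bounds growth in affine algebras -/

noncomputable section
namespace GradedTor

/-- Lying over lifts the smallest prime of a chain, going up the rest. -/
lemma ringKrullDim_le_of_isIntegral_of_injective (A B : Type*) [CommRing A] [CommRing B]
    [Algebra A B] [Algebra.IsIntegral A B] [FaithfulSMul A B] : ringKrullDim A ≤ ringKrullDim B := by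
  refine iSup_le fun l => ?_
  obtain ⟨P, hP, hPl⟩ := (Ideal.nonempty_primesOver (R := A) (S := B) l.head.asIdeal).some
  obtain ⟨L, hL, -⟩ := Ideal.exists_ltSeries_of_hasGoingUp (S := B) l P
  rw [← hL]
  exact le_iSup (fun L : LTSeries (PrimeSpectrum B) => ((L.length : ℕ∞) : WithBot ℕ∞)) L

lemma finrank_map₂_le {K A B C : Type*} [Field K] [AddCommGroup A] [Module K A] [AddCommGroup B]
    [Module K B] [AddCommGroup C] [Module K C] (f : A →ₗ[K] B →ₗ[K] C) (p : Submodule K A)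
    (q : Submodule K B) [FiniteDimensional K p] [FiniteDimensional K q] :
    Module.finrank K (Submodule.map₂ f p q) ≤ Module.finrank K p * Module.finrank K q := by
  rw [TensorProduct.map₂_eq_range_lift_comp_mapIncl, ← Module.finrank_tensorProduct]
  exact LinearMap.finrank_range_le _

lemma finrank_restrictDegree_le (K : Type*) [Field K] (s N : ℕ) :
    FiniteDimensional K (restrictDegree (Fin s) K N) ∧
    Module.finrank K (restrictDegree (Fin s) K N) ≤ (N + 1) ^ s := by
  have h : restrictDegree (Fin s) K N ≤ Submodule.span K (Set.range
      fun e : Fin s → Fin (N + 1) =>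
        monomial (Finsupp.equivFunOnFinite.symm fun i => (e i : ℕ)) (1 : K)) := by
    intro p hp
    rw [mem_restrictDegree] at hp
    rw [p.as_sum]
    refine Submodule.sum_mem _ fun m hm => ?_
    rw [← mul_one (coeff m p), ← smul_eq_mul, ← smul_monomial]
    refine Submodule.smul_mem _ _ (Submodule.subset_span
      ⟨fun i => ⟨m i, Nat.lt_succ_of_le (hp m hm i)⟩, ?_⟩)
    ext i
    simp
  have hfd := FiniteDimensional.span_of_finite K (Set.finite_range
    fun e : Fin s → Fin (N + 1) =>
      monomial (Finsupp.equivFunOnFinite.symm fun i => (e i : ℕ)) (1 : K))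
  refine ⟨Submodule.finiteDimensional_of_le h, (Submodule.finrank_mono h).trans ?_⟩
  exact (finrank_range_le_card _).trans (by simp)

lemma restrictDegree_mul_le (K : Type*) [Field K] (s M N : ℕ) :
    restrictDegree (Fin s) K M * restrictDegree (Fin s) K N ≤ restrictDegree (Fin s) K (M + N) := by
  classical
  refine Submodule.mul_le.2 fun p hp q hq => ?_
  rw [mem_restrictDegree] at *
  intro m hm i
  obtain ⟨a, ha, b, hb, rfl⟩ := Finset.mem_add.1 (support_mul p q hm)
  exact add_le_add (hp a ha i) (hq b hb i)

/-- The dimension of the powers of a finite dimensional subspace of an affine algebra grows at most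
like a polynomial whose degree is the Krull dimension. -/
theorem exists_finrank_pow_le {K B : Type*} [Field K] [CommRing B] [Algebra K B]
    [Algebra.FiniteType K B] {β : ℕ} (hβ : ringKrullDim B ≤ β) (V : Submodule K B)
    [hV : FiniteDimensional K V] : ∃ C : ℕ, ∀ N : ℕ, Module.finrank K (V ^ N : Submodule K B) ≤
      C * (N + 1) ^ β := by
  cases subsingleton_or_nontrivial B with
  | inl h => exact ⟨0, fun N => by simp [Module.finrank_zero_of_subsingleton]⟩
  | inr h =>
    -- Noether normalization: B is finite over a polynomial ring in s variables, and s is at most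
    -- the Krull dimension.
    obtain ⟨s, g, hg, hfin⟩ := exists_finite_inj_algHom_of_fg K B
    have hs : s ≤ β := by
      algebraize [g.toRingHom]
      have : FaithfulSMul (MvPolynomial (Fin s) K) B :=
        (faithfulSMul_iff_algebraMap_injective _ _).2 hg
      have : Module.Finite (MvPolynomial (Fin s) K) B := hfin
      have h1 := (ringKrullDim_le_of_isIntegral_of_injective (MvPolynomial (Fin s) K) B).trans hβ
      rw [MvPolynomial.ringKrullDim_of_isNoetherianRing, ringKrullDim_eq_zero_of_field] at h1
      simp only [Nat.card_eq_fintype_card, Fintype.card_fin, zero_add] at h1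
      exact_mod_cast h1
    set A : ℕ → Submodule K B := fun N => (restrictDegree (Fin s) K N).map g.toLinearMap with hA
    have hAmul : ∀ M N, A M * A N ≤ A (M + N) := by
      intro M N
      simp only [hA]
      rw [← Submodule.map_mul]
      exact Submodule.map_mono (restrictDegree_mul_le K s M N)
    have hAmono : ∀ {M N}, M ≤ N → A M ≤ A N := by
      intro M N h
      refine Submodule.map_mono fun p hp => ?_
      rw [mem_restrictDegree] at *
      exact fun m hm i => (hp m hm i).trans h
    have hAfd : ∀ N, FiniteDimensional K (A N) := fun N =>
      have := (finrank_restrictDegree_le K s N).1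
      inferInstance
    have hArank : ∀ N, Module.finrank K (A N) ≤ (N + 1) ^ s := fun N =>
      have := (finrank_restrictDegree_le K s N).1
      (Submodule.finrank_map_le _ _).trans (finrank_restrictDegree_le K s N).2
    obtain ⟨t, ht⟩ : ∃ t : Finset B, ∀ b, ∃ p : B → MvPolynomial (Fin s) K,
        b = ∑ y ∈ t, g (p y) * y := by
      algebraize [g.toRingHom]
      have : Module.Finite (MvPolynomial (Fin s) K) B := hfin
      obtain ⟨t, ht⟩ := Module.Finite.fg_top (R := MvPolynomial (Fin s) K) (M := B)
      refine ⟨t, fun b => ?_⟩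
      have hb : b ∈ Submodule.span (MvPolynomial (Fin s) K) (t : Set B) := ht ▸ trivial
      obtain ⟨p, -, hp⟩ := Submodule.mem_span_finset.1 hb
      exact ⟨p, hp.symm⟩
    set G : Submodule K B := Submodule.span K (insert 1 (t : Set B)) with hG
    have hGfd : FiniteDimensional K G :=
      FiniteDimensional.span_of_finite K (t.finite_toSet.insert 1)
    have hBA : ∀ b : B, ∃ L, b ∈ A L * G := by
      intro b
      obtain ⟨p, rfl⟩ := ht b
      refine ⟨t.sup fun y => (p y).totalDegree, Submodule.sum_mem _ fun y hy => ?_⟩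
      refine Submodule.mul_mem_mul ⟨p y, ?_, rfl⟩ (Submodule.subset_span (Or.inr hy))
      refine restrictTotalDegree_le_restrictDegree (σ := Fin s) (R := K) _ ?_
      rw [mem_restrictTotalDegree]
      exact Finset.le_sup (f := fun y => (p y).totalDegree) hy
    -- One factor from `V` raises the degree of the polynomial coefficients over `G` by at most `L`,
    -- so N factors raise it by at most `L * N`.
    obtain ⟨L, hL⟩ : ∃ L, V * G ≤ A L * G := by
      obtain ⟨u, hu⟩ := (hV.fg_top.map V.subtype).mul (hGfd.fg_top.map G.subtype)
      rw [Submodule.map_subtype_top, Submodule.map_subtype_top] at hu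
      choose L hL using hBA
      refine ⟨u.sup L, ?_⟩
      rw [← hu, Submodule.span_le]
      exact fun y hy => mul_le_mul' (hAmono (Finset.le_sup hy)) le_rfl (hL y)
    have hVN : ∀ N, V ^ N * G ≤ A (L * N) * G := by
      intro N
      induction N with
      | zero =>
        refine mul_le_mul' ?_ le_rfl
        rw [pow_zero, Submodule.one_le]
        refine ⟨1, restrictTotalDegree_le_restrictDegree (σ := Fin s) (R := K) _ ?_, map_one g⟩
        rw [mem_restrictTotalDegree]
        simp
      | succ N ih =>
        calc V ^ (N + 1) * G = V * (V ^ N * G) := by rw [pow_succ', mul_assoc]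
          _ ≤ V * (A (L * N) * G) := mul_le_mul' le_rfl ih
          _ = A (L * N) * (V * G) := by rw [← mul_assoc, ← mul_assoc, mul_comm V]
          _ ≤ A (L * N) * (A L * G) := mul_le_mul' le_rfl hL
          _ = A (L * N) * A L * G := by rw [mul_assoc]
          _ ≤ A (L * (N + 1)) * G := mul_le_mul' (by
            rw [mul_add, mul_one]; exact hAmul _ _) le_rfl
    have hprod : ∀ P Q : Submodule K B, FiniteDimensional K P → FiniteDimensional K Q →
        FiniteDimensional K (P * Q : Submodule K B) := fun P Q hP hQ => by
      have := (hP.fg_top.map P.subtype).mul (hQ.fg_top.map Q.subtype)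
      rw [Submodule.map_subtype_top, Submodule.map_subtype_top] at this
      exact Module.Finite.iff_fg.2 this
    refine ⟨(L + 1) ^ s * Module.finrank K G, fun N => ?_⟩
    have := hprod (A (L * N)) G (hAfd _) hGfd
    have hle : V ^ N ≤ A (L * N) * G := fun v hv => hVN N (by
      rw [← mul_one v]
      exact Submodule.mul_mem_mul hv (Submodule.subset_span (Set.mem_insert _ _)))
    calc Module.finrank K (V ^ N : Submodule K B)
        ≤ Module.finrank K (A (L * N) * G : Submodule K B) := Submodule.finrank_mono hle
      _ ≤ Module.finrank K (A (L * N)) * Module.finrank K G := by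
        have := hAfd (L * N)
        rw [Submodule.mul_eq_map₂]
        exact finrank_map₂_le (LinearMap.mul K B) _ _
      _ ≤ (L * N + 1) ^ s * Module.finrank K G := Nat.mul_le_mul_right _ (hArank _)
      _ ≤ ((L + 1) * (N + 1)) ^ s * Module.finrank K G := by
        gcongr
        nlinarith
      _ = (L + 1) ^ s * Module.finrank K G * (N + 1) ^ s := by rw [mul_pow]; ring
      _ ≤ _ := by
        gcongr
        omega

/-- The module version of `exists_finrank_pow_le`, for a module whose relevant part is killed by an
ideal. -/
theorem exists_finrank_pow_smul_le {K R Q : Type*} [Field K] [CommRing R] [Algebra K R]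
    [Algebra.FiniteType K R] [AddCommGroup Q] [Module K Q] [Module R Q] [IsScalarTower K R Q]
    (J : Ideal R) {β : ℕ} (hβ : ringKrullDim (R ⧸ J) ≤ β) (V : Submodule K R)
    [hV : FiniteDimensional K V] (G : Submodule K Q) [FiniteDimensional K G]
    (hG : ∀ r ∈ J, ∀ y ∈ G, r • y = 0) :
    ∃ C : ℕ, ∀ N : ℕ, FiniteDimensional K
        (Submodule.map₂ (Algebra.lsmul K K Q).toLinearMap (V ^ N) G) ∧
      Module.finrank K (Submodule.map₂ (Algebra.lsmul K K Q).toLinearMap (V ^ N) G) ≤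
        C * (N + 1) ^ β := by
  have hpow : ∀ N, FiniteDimensional K (V ^ N : Submodule K R) := fun N => by
    have := (hV.fg_top.map V.subtype).pow N
    rw [Submodule.map_subtype_top] at this
    exact Module.Finite.iff_fg.2 this
  obtain ⟨C, hC⟩ := exists_finrank_pow_le hβ (V.map (Ideal.Quotient.mkₐ K J).toLinearMap)
  refine ⟨C * Module.finrank K G, fun N => ?_⟩
  -- As `J` kills `G`, the action on `G` sees only the image of `V ^ N` in `R ⧸ J`.
  let φ : (R ⧸ J) →ₗ[R] (G →ₗ[K] Q) := Submodule.liftQ J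
    (LinearMap.toSpanSingleton R (G →ₗ[K] Q) G.subtype) fun r hr => by
      ext y
      exact hG r hr y y.2
  let φ' : (R ⧸ J) →ₗ[K] (G →ₗ[K] Q) := φ.restrictScalars K
  have h1 : Submodule.map₂ (Algebra.lsmul K K Q).toLinearMap (V ^ N) G =
      Submodule.map₂ φ' ((V.map (Ideal.Quotient.mkₐ K J).toLinearMap) ^ N) ⊤ := by
    rw [← Submodule.map_pow]
    refine le_antisymm (Submodule.map₂_le.2 fun r hr y hy => ?_)
      (Submodule.map₂_le.2 fun r hr y _ => ?_)
    · exact Submodule.apply_mem_map₂ φ' (Submodule.mem_map_of_mem hr)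
        (trivial : (⟨y, hy⟩ : G) ∈ ⊤)
    · obtain ⟨r, hr, rfl⟩ := hr
      exact Submodule.apply_mem_map₂ (Algebra.lsmul K K Q).toLinearMap hr y.2
  have hfd : FiniteDimensional K
      (V.map (Ideal.Quotient.mkₐ K J).toLinearMap ^ N : Submodule K (R ⧸ J)) := by
    rw [← Submodule.map_pow]
    infer_instance
  rw [h1]
  refine ⟨?_, (finrank_map₂_le _ _ _).trans ?_⟩
  · rw [TensorProduct.map₂_eq_range_lift_comp_mapIncl]
    infer_instance
  · rw [finrank_top, mul_right_comm]
    exact Nat.mul_le_mul_right _ (hC N)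

end GradedTor
end

/-! ### Dimension counts and homogeneous components -/

noncomputable section
namespace GradedTor

section LinearAlgebra

variable {K V Q ι : Type*} [Field K] [AddCommGroup V] [Module K V] [AddCommGroup Q] [Module K Q]

/-- The map ∏ Z a → H that adds up the `φ a` has its kernel inside ∏ W a. -/
lemma sum_finrank_sub_le (B : Finset ι) (Z W : ι → Submodule K V)
    (hZ : ∀ a, FiniteDimensional K (Z a)) (hWZ : W ≤ Z) (φ : ι → V →ₗ[K] Q) (H : Submodule K Q)
    [FiniteDimensional K H] (hφ : ∀ a ∈ B, ∀ z ∈ Z a, φ a z ∈ H)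
    (hind : ∀ z : ι → V, (∀ a ∈ B, z a ∈ Z a) → ∑ a ∈ B, φ a (z a) = 0 → ∀ a ∈ B, z a ∈ W a) :
    ∑ a ∈ B, ((Module.finrank K (Z a) : ℤ) - Module.finrank K (W a)) ≤ Module.finrank K H := by
  classical
  have hW : ∀ a, FiniteDimensional K (W a) := fun a =>
    have := hZ a
    Submodule.finiteDimensional_of_le (hWZ a)
  let Θ : (∀ a : B, Z a) →ₗ[K] H := ∑ a : B,
    ((φ a ∘ₗ (Z a).subtype).codRestrict H fun z => hφ a a.2 z z.2) ∘ₗ LinearMap.proj a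
  have hΘ : ∀ z, ((Θ z : H) : Q) = ∑ a : B, φ a (z a) := by
    intro z
    simp only [Θ, LinearMap.sum_apply, Submodule.coe_sum]
    rfl
  have h1 := LinearMap.finrank_range_add_finrank_ker Θ
  have h2 : Module.finrank K (LinearMap.range Θ) ≤ Module.finrank K H := Submodule.finrank_le _
  have hker : ∀ z ∈ LinearMap.ker Θ, ∀ a : B, (z a : V) ∈ W a := by
    intro z hz a
    have h := hind (fun a => if h : a ∈ B then (z ⟨a, h⟩ : V) else 0) (by
      intro a ha
      rw [dif_pos ha]
      exact (z ⟨a, ha⟩).2) (by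
      rw [← Finset.sum_coe_sort]
      have := hΘ z
      rw [LinearMap.mem_ker.1 hz] at this
      rw [← Submodule.coe_zero (p := H), this]
      exact Finset.sum_congr rfl fun a _ => by rw [dif_pos a.2]) a a.2
    rwa [dif_pos a.2] at h
  let κ : LinearMap.ker Θ →ₗ[K] ∀ a : B, W a := LinearMap.pi fun a =>
    ((Z a).subtype ∘ₗ (LinearMap.proj a : (∀ a : B, Z a) →ₗ[K] Z a) ∘ₗ (LinearMap.ker Θ).subtype).codRestrict (W a)
      fun z => hker z z.2 a
  have hκ : Function.Injective κ := by
    intro z z' h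
    ext a
    exact congrArg (fun w : ∀ a : B, W a => ((w a : W a) : V)) h
  have h3 := LinearMap.finrank_le_finrank_of_injective hκ
  rw [Module.finrank_pi_fintype, Finset.sum_coe_sort B fun a => Module.finrank K (W a)] at h3
  rw [Module.finrank_pi_fintype, Finset.sum_coe_sort B fun a => Module.finrank K (Z a)] at h1
  rw [Finset.sum_sub_distrib]
  have h4 : ((∑ a ∈ B, Module.finrank K (Z a) : ℕ) : ℤ) ≤
      Module.finrank K H + (∑ a ∈ B, Module.finrank K (W a) : ℕ) := by
    rw [← h1]; push_cast; exact_mod_cast add_le_add h2 h3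
  push_cast at h4
  linarith

end LinearAlgebra

section Projection

variable {K ι V : Type*} [DecidableEq ι] [Field K] [AddCommGroup V] [Module K V]
  {𝓥 : ι → Submodule K V}

/-- The projection to the component of degree `c` of a graded vector space. -/
def componentProj (h : DirectSum.IsInternal 𝓥) (c : ι) : V →ₗ[K] V :=
  letI := h.chooseDecomposition
  (𝓥 c).subtype ∘ₗ DirectSum.component K ι (fun i => 𝓥 i) c ∘ₗ
    (DirectSum.decomposeLinearEquiv 𝓥).toLinearMap

variable (h : DirectSum.IsInternal 𝓥)

lemma componentProj_mem (c : ι) (y : V) : componentProj h c y ∈ 𝓥 c := Subtype.property _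

lemma componentProj_same {c : ι} {y : V} (hy : y ∈ 𝓥 c) : componentProj h c y = y := by
  let := h.chooseDecomposition
  exact DirectSum.decompose_of_mem_same 𝓥 hy

lemma componentProj_ne {c c' : ι} {y : V} (hy : y ∈ 𝓥 c') (hc : c' ≠ c) :
    componentProj h c y = 0 := by
  let := h.chooseDecomposition
  exact DirectSum.decompose_of_mem_ne 𝓥 hy hc

lemma exists_sum_componentProj (y : V) : ∃ s : Finset ι, y = ∑ c ∈ s, componentProj h c y := by
  classical
  let := h.chooseDecomposition
  exact ⟨_, (DirectSum.sum_support_decompose 𝓥 y).symm⟩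

end Projection

section FreeGrading

variable (K : Type*) [Field K] (n : ℕ)

lemma finiteDimensional_polyGrading (c : ℤ) : FiniteDimensional K (polyGrading K n c) := by
  rcases le_or_gt 0 c with hc | hc
  · rw [polyGrading, if_pos hc]
    have h : homogeneousSubmodule (Fin n) K c.toNat ≤ restrictDegree (Fin n) K c.toNat := by
      intro p hp
      rw [mem_restrictDegree]
      intro m hm i
      rw [mem_homogeneousSubmodule] at hp
      have := hp (mem_support_iff.1 hm)
      rw [Pi.one_def, ← Finsupp.degree_eq_weight_one] at this
      exact (Finsupp.le_degree i m).trans this.le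
    have := (finrank_restrictDegree_le K n c.toNat).1
    exact Submodule.finiteDimensional_of_le h
  · rw [polyGrading, if_neg (by omega)]
    infer_instance

lemma finiteDimensional_freeGrading {r : ℕ} (a : Fin r → ℤ) (c : ℤ) :
    FiniteDimensional K (freeGrading K n a c) := by
  have := fun s => finiteDimensional_polyGrading K n (c - a s)
  let φ : freeGrading K n a c →ₗ[K] ∀ s, polyGrading K n (c - a s) := LinearMap.pi fun s =>
    (LinearMap.proj s ∘ₗ (freeGrading K n a c).subtype).codRestrict _ fun z => z.2 s trivial
  refine FiniteDimensional.of_injective φ fun z z' h => ?_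
  ext s : 2
  exact congrArg (fun w : ∀ s, polyGrading K n (c - a s) => ((w s : _) : MvPolynomial (Fin n) K)) h

variable {K n}

lemma freeGrading_eq_bot {r : ℕ} {a : Fin r → ℤ} {c₀ : ℤ} (h : ∀ s, c₀ ≤ a s) {c : ℤ}
    (hc : c < c₀) : freeGrading K n a c = ⊥ := by
  rw [eq_bot_iff]
  intro v hv
  rw [mem_freeGrading] at hv
  rw [Submodule.mem_bot]
  ext s m
  by_contra hne
  have h1 := hv s m (by simpa using hne)
  have h2 := h s
  omega

lemma smul_mem_freeGrading {r : ℕ} {a : Fin r → ℤ} {c : ℤ} {d : ℕ} {p : MvPolynomial (Fin n) K}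
    (hp : p.IsHomogeneous d) {v : Fin r → MvPolynomial (Fin n) K} (hv : v ∈ freeGrading K n a c) :
    p • v ∈ freeGrading K n a (c + d) := by
  rw [add_comm]
  refine (isGrading_freeGrading a).smul_mem d c p v ?_ hv
  simpa [polyGrading] using hp

end FreeGrading

end GradedTor
end

/-! ### Bigraded families as modules over the Rees algebra -/

noncomputable section
namespace GradedTor

section Rees

variable {K : Type*} [Field K] {n v r : ℕ} (I : Ideal (MvPolynomial (Fin n) K))
  (f : Fin v → MvPolynomial (Fin n) K) (dg : Fin v → ℕ) (a : Fin r → ℤ)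

/-- Multiplication by the variables and by the generators of an ideal. -/
def reesOp (r : ℕ) (t : Fin n ⊕ Fin v) :
    (Fin r → MvPolynomial (Fin n) K) →ₗ[K] (Fin r → MvPolynomial (Fin n) K) :=
  Algebra.lsmul K K (Fin r → MvPolynomial (Fin n) K) (Sum.elim X f t)

lemma reesOp_apply (t : Fin n ⊕ Fin v) (y : Fin r → MvPolynomial (Fin n) K) :
    reesOp f r t y = (Sum.elim X f t : MvPolynomial (Fin n) K) • y := rfl

lemma reesOp_comm (s t : Fin n ⊕ Fin v) (y : Fin r → MvPolynomial (Fin n) K) :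
    reesOp f r s (reesOp f r t y) = reesOp f r t (reesOp f r s y) := by
  simp only [reesOp_apply, smul_smul, mul_comm]

variable (n) in
/-- The bidegrees of the generators of the Rees algebra. -/
def reesDeg : Fin n ⊕ Fin v → ℤ × ℤ := Sum.elim (fun _ => (1, 0)) fun s => (dg s, 1)

/-- The bigraded pieces of a family of submodules of a graded free module. -/
def slice (U : ℕ → Submodule (MvPolynomial (Fin n) K) (Fin r → MvPolynomial (Fin n) K))
    (p : ℤ × ℤ) : Submodule K (Fin r → MvPolynomial (Fin n) K) :=
  if 0 ≤ p.2 then (U p.2.toNat).restrictScalars K ⊓ freeGrading K n a p.1 else ⊥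

variable {a} {U W : ℕ → Submodule (MvPolynomial (Fin n) K) (Fin r → MvPolynomial (Fin n) K)}

lemma mem_slice {p : ℤ × ℤ} (hp : 0 ≤ p.2) {y : Fin r → MvPolynomial (Fin n) K} :
    y ∈ slice a U p ↔ y ∈ U p.2.toNat ∧ y ∈ freeGrading K n a p.1 := by
  rw [slice, if_pos hp]
  rfl

lemma slice_eq_bot {p : ℤ × ℤ} (hp : p.2 < 0) : slice a U p = ⊥ := by
  rw [slice, if_neg (by omega)]

lemma eq_zero_of_mem_slice {p : ℤ × ℤ} (hp : p.2 < 0) {y : Fin r → MvPolynomial (Fin n) K}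
    (hy : y ∈ slice a U p) : y = 0 := by
  rwa [slice_eq_bot hp, Submodule.mem_bot] at hy

lemma slice_mono (h : ∀ k, W k ≤ U k) : slice a W ≤ slice a U := by
  intro p y hy
  rcases lt_or_ge p.2 0 with hp | hp
  · rw [eq_zero_of_mem_slice hp hy]
    exact Submodule.zero_mem _
  · rw [mem_slice hp] at *
    exact ⟨h _ hy.1, hy.2⟩

lemma finiteDimensional_slice (p : ℤ × ℤ) : FiniteDimensional K (slice a U p) := by
  have := finiteDimensional_freeGrading K n a p.1
  refine Submodule.finiteDimensional_of_le (S₂ := freeGrading K n a p.1) fun y hy => ?_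
  rcases lt_or_ge p.2 0 with hp | hp
  · rw [eq_zero_of_mem_slice hp hy]
    exact Submodule.zero_mem _
  · exact ((mem_slice hp).1 hy).2

variable {f dg I}

lemma closedFamily_slice (hf : ∀ s, (f s).IsHomogeneous (dg s))
    (hU : ∀ k s, ∀ y ∈ U k, f s • y ∈ U (k + 1)) :
    ClosedFamily (reesOp f r) (reesDeg n dg) (slice a U) := by
  intro t p y hy
  rcases lt_or_ge p.2 0 with hp | hp
  · rw [eq_zero_of_mem_slice hp hy, map_zero]
    exact Submodule.zero_mem _
  rw [mem_slice hp] at hy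
  rcases t with i | s
  · rw [mem_slice (by simpa [reesDeg] using hp)]
    rw [reesOp_apply, Sum.elim_inl]
    refine ⟨?_, ?_⟩
    · simpa [reesDeg] using Submodule.smul_mem _ (X i) hy.1
    · simpa [reesDeg] using smul_mem_freeGrading (isHomogeneous_X K i) hy.2
  · rw [mem_slice (by simp [reesDeg]; omega)]
    refine ⟨?_, smul_mem_freeGrading (hf s) hy.2⟩
    have : (p + reesDeg n dg (Sum.inr s)).2.toNat = p.2.toNat + 1 := by
      simp [reesDeg]; omega
    rw [this]
    exact hU _ s y hy.1

/-- The inclusion of the free module into its polynomial extension at level `k`. -/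
def levelMap (k : ℕ) : (Fin r → MvPolynomial (Fin n) K) →ₗ[K]
    (Fin r → Polynomial (MvPolynomial (Fin n) K)) :=
  LinearMap.pi fun s => (Polynomial.monomial k).restrictScalars K ∘ₗ LinearMap.proj s

lemma levelMap_apply (k : ℕ) (y : Fin r → MvPolynomial (Fin n) K) (s : Fin r) :
    levelMap k y s = Polynomial.monomial k (y s) := rfl

lemma monomial_smul_levelMap (j k : ℕ) (g : MvPolynomial (Fin n) K)
    (y : Fin r → MvPolynomial (Fin n) K) :
    Polynomial.monomial j g • levelMap k y = levelMap (j + k) (g • y) := by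
  ext1 s
  simp [levelMap_apply, Polynomial.monomial_mul_monomial]

/-- The elements of bidegree `p` of a family of subspaces, inside the polynomial extension. -/
def levelSet (Y : ℤ × ℤ → Submodule K (Fin r → MvPolynomial (Fin n) K)) :
    Set (Fin r → Polynomial (MvPolynomial (Fin n) K)) :=
  {w | ∃ p, ∃ y ∈ Y p, w = levelMap p.2.toNat y}

variable (I) in
/-- The module over the Rees algebra generated by a family of subspaces. -/
def hatModule (Y : ℤ × ℤ → Submodule K (Fin r → MvPolynomial (Fin n) K)) :
    Submodule (reesAlgebra I) (Fin r → Polynomial (MvPolynomial (Fin n) K)) :=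
  Submodule.span (reesAlgebra I) (levelSet Y)

variable {Y : ℤ × ℤ → Submodule K (Fin r → MvPolynomial (Fin n) K)}

section Closed

variable (hY : ClosedFamily (reesOp f r) (reesDeg n dg) Y) (hY₀ : Y ≤ slice a fun _ => ⊤)
include hY

lemma C_smul_mem_span_levelSet (p : MvPolynomial (Fin n) K)
    {w : Fin r → Polynomial (MvPolynomial (Fin n) K)} (hw : w ∈ Submodule.span K (levelSet Y)) :
    (Polynomial.C p : Polynomial (MvPolynomial (Fin n) K)) • w ∈
      Submodule.span K (levelSet Y) := by
  induction p using MvPolynomial.induction_on generalizing w with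
  | C c =>
    have : (Polynomial.C (C c) : Polynomial (MvPolynomial (Fin n) K)) • w = c • w := by
      rw [← MvPolynomial.algebraMap_eq, ← Polynomial.algebraMap_eq,
        ← IsScalarTower.algebraMap_apply K (MvPolynomial (Fin n) K)
          (Polynomial (MvPolynomial (Fin n) K)), algebraMap_smul]
    rw [this]
    exact Submodule.smul_mem _ _ hw
  | add p q hp hq =>
    rw [map_add, add_smul]
    exact Submodule.add_mem _ (hp hw) (hq hw)
  | mul_X p i hp =>
    rw [map_mul, mul_smul]
    refine hp ?_
    induction hw using Submodule.span_induction with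
    | mem w hw =>
      obtain ⟨q, y, hy, rfl⟩ := hw
      refine Submodule.subset_span ⟨_, _, hY (Sum.inl i) q y hy, ?_⟩
      rw [← Polynomial.monomial_zero_left, monomial_smul_levelMap, reesOp_apply, Sum.elim_inl]
      simp [reesDeg]
    | zero => rw [smul_zero]; exact Submodule.zero_mem _
    | add x y _ _ hx hy => rw [smul_add]; exact Submodule.add_mem _ hx hy
    | smul c x _ hx => rw [smul_comm]; exact Submodule.smul_mem _ _ hx

include hY₀

lemma monomial_smul_mem_span_levelSet (hI : Ideal.span (Set.range f) = I)
    {g : MvPolynomial (Fin n) K} (hg : g ∈ I)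
    {w : Fin r → Polynomial (MvPolynomial (Fin n) K)} (hw : w ∈ Submodule.span K (levelSet Y)) :
    (Polynomial.monomial 1 g : Polynomial (MvPolynomial (Fin n) K)) • w ∈
      Submodule.span K (levelSet Y) := by
  rw [← hI] at hg
  induction hg using Submodule.span_induction with
  | mem g hg =>
    obtain ⟨s, rfl⟩ := hg
    induction hw using Submodule.span_induction with
    | mem w hw =>
      obtain ⟨q, y, hy, rfl⟩ := hw
      rcases lt_or_ge q.2 0 with hq | hq
      · rw [eq_zero_of_mem_slice hq (hY₀ q hy), map_zero, smul_zero]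
        exact Submodule.zero_mem _
      refine Submodule.subset_span ⟨_, _, hY (Sum.inr s) q y hy, ?_⟩
      rw [monomial_smul_levelMap, reesOp_apply, Sum.elim_inr]
      congr 2
      simp only [reesDeg, Sum.elim_inr, Prod.snd_add]
      omega
    | zero => rw [smul_zero]; exact Submodule.zero_mem _
    | add x y _ _ hx hy => rw [smul_add]; exact Submodule.add_mem _ hx hy
    | smul c x _ hx => rw [smul_comm]; exact Submodule.smul_mem _ _ hx
  | zero => rw [map_zero, zero_smul]; exact Submodule.zero_mem _
  | add x y _ _ hx hy => rw [map_add, add_smul]; exact Submodule.add_mem _ hx hy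
  | smul p x _ hx =>
    rw [smul_eq_mul, ← Polynomial.C_mul_monomial, mul_smul]
    exact C_smul_mem_span_levelSet hY p hx

/-- Since the Rees algebra is generated over S by the elements g t with g ∈ I, closedness of the
family already makes the K-span of its level set stable under the Rees algebra. -/
lemma hatModule_subset_span (hI : Ideal.span (Set.range f) = I)
    {w : Fin r → Polynomial (MvPolynomial (Fin n) K)} (hw : w ∈ hatModule I Y) :
    w ∈ Submodule.span K (levelSet Y) := by
  induction hw using Submodule.span_induction with
  | mem w hw => exact Submodule.subset_span hw
  | zero => exact Submodule.zero_mem _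
  | add x y _ _ hx hy => exact Submodule.add_mem _ hx hy
  | smul ρ x _ hx =>
    obtain ⟨ρ, hρ⟩ := ρ
    change ρ • x ∈ _
    rw [← adjoin_monomial_eq_reesAlgebra] at hρ
    clear * - hρ hx hY hY₀ hI
    induction hρ using Algebra.adjoin_induction generalizing x with
    | mem ρ hρ =>
      obtain ⟨g, hg, rfl⟩ := hρ
      exact monomial_smul_mem_span_levelSet hY hY₀ hI hg hx
    | algebraMap p => exact C_smul_mem_span_levelSet hY p hx
    | add ρ σ _ _ h1 h2 => rw [add_smul]; exact Submodule.add_mem _ (h1 x hx) (h2 x hx)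
    | mul ρ σ _ _ h1 h2 => rw [mul_smul]; exact h1 _ (h2 _ hx)

omit hY hY₀ in
variable (a) in
/-- The projection of the polynomial extension to the component of bidegree `p`. -/
def levelProj (p : ℤ × ℤ) : (Fin r → Polynomial (MvPolynomial (Fin n) K)) →ₗ[K]
    (Fin r → MvPolynomial (Fin n) K) :=
  componentProj (isGrading_freeGrading (K := K) (n := n) a).isInternal p.1 ∘ₗ
    LinearMap.pi fun s => (Polynomial.lcoeff _ p.2.toNat).restrictScalars K ∘ₗ LinearMap.proj s

omit hY hY₀ in
lemma levelProj_levelMap (p : ℤ × ℤ) (k : ℕ) (y : Fin r → MvPolynomial (Fin n) K) :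
    levelProj a p (levelMap k y) = if k = p.2.toNat then
      componentProj (isGrading_freeGrading (K := K) (n := n) a).isInternal p.1 y else 0 := by
  have : (LinearMap.pi fun s : Fin r => (Polynomial.lcoeff (MvPolynomial (Fin n) K)
      p.2.toNat).restrictScalars K ∘ₗ LinearMap.proj s) (levelMap k y) =
      if k = p.2.toNat then y else 0 := by
    ext1 s
    simp only [LinearMap.pi_apply, LinearMap.comp_apply, LinearMap.proj_apply, levelMap_apply,
      LinearMap.restrictScalars_apply, Polynomial.lcoeff_apply, Polynomial.coeff_monomial]
    split_ifs <;> rfl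
  rw [levelProj, LinearMap.comp_apply, this]
  split_ifs
  · rfl
  · rw [map_zero]

/-- The bigraded pieces of the generated Rees module are no larger than the family, so the module
determines the family. -/
lemma levelProj_mem (hI : Ideal.span (Set.range f) = I)
    {w : Fin r → Polynomial (MvPolynomial (Fin n) K)} (hw : w ∈ hatModule I Y) {p : ℤ × ℤ}
    (hp : 0 ≤ p.2) : levelProj a p w ∈ Y p := by
  replace hw := hatModule_subset_span hY hY₀ hI hw
  induction hw using Submodule.span_induction with
  | mem w hw =>
    obtain ⟨q, y, hy, rfl⟩ := hw
    rw [levelProj_levelMap]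
    split_ifs with hqp
    · rcases lt_or_ge q.2 0 with hq | hq
      · rw [eq_zero_of_mem_slice hq (hY₀ q hy), map_zero]
        exact Submodule.zero_mem _
      have hy' := ((mem_slice hq).1 (hY₀ q hy)).2
      by_cases h : q.1 = p.1
      · have : q = p := Prod.ext h (by omega)
        subst this
        rwa [componentProj_same _ hy']
      · rw [componentProj_ne _ hy' h]
        exact Submodule.zero_mem _
    · exact Submodule.zero_mem _
  | zero => rw [map_zero]; exact Submodule.zero_mem _
  | add x y _ _ hx hy => rw [map_add]; exact Submodule.add_mem _ hx hy
  | smul c x _ hx => rw [map_smul]; exact Submodule.smul_mem _ _ hx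

end Closed

lemma mem_pow_of_mem_smul_top {J : Ideal (MvPolynomial (Fin n) K)}
    {y : Fin r → MvPolynomial (Fin n) K}
    (hy : y ∈ J • (⊤ : Submodule (MvPolynomial (Fin n) K) (Fin r → MvPolynomial (Fin n) K)))
    (s : Fin r) : y s ∈ J := by
  induction hy using Submodule.smul_induction_on' with
  | smul g hg y _ => exact Ideal.mul_mem_right _ _ hg
  | add x _ y _ hx hy => exact Ideal.add_mem _ hx hy

/-- The passage from closed families to Rees modules reflects inclusions by `levelProj_mem`, and all
these modules lie in the image of a free module of finite rank over the noetherian Rees algebra. -/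
theorem noetherianFamily_slice (hI : Ideal.span (Set.range f) = I) :
    NoetherianFamily (reesOp f r) (reesDeg n dg) (slice a fun k => I ^ k • ⊤) := by
  intro 𝒮 h𝒮 hcl
  let incl : (Fin r → reesAlgebra I) →ₗ[reesAlgebra I]
      (Fin r → Polynomial (MvPolynomial (Fin n) K)) :=
    LinearMap.pi fun s => (Algebra.linearMap (reesAlgebra I) _) ∘ₗ LinearMap.proj s
  set P₀ := LinearMap.range incl with hP₀
  have hle : ∀ Y ∈ 𝒮, hatModule I Y ≤ P₀ := by
    intro Y hY
    refine Submodule.span_le.2 ?_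
    rintro _ ⟨p, y, hy, rfl⟩
    have hy := (hcl Y hY).2 p hy
    rcases lt_or_ge p.2 0 with hp | hp
    · rw [eq_zero_of_mem_slice hp hy, map_zero]
      exact Submodule.zero_mem _
    · rw [mem_slice hp] at hy
      refine ⟨fun s => ⟨Polynomial.monomial p.2.toNat (y s),
        reesAlgebra.monomial_mem.2 (mem_pow_of_mem_smul_top hy.1 s)⟩, rfl⟩
  have hnoeth : IsNoetherian (reesAlgebra I) P₀ := inferInstance
  obtain ⟨_, ⟨Y, hY, rfl⟩, hmax⟩ := set_has_maximal_iff_noetherian.2 hnoeth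
    ((fun Y => (hatModule I Y).comap P₀.subtype) '' 𝒮) (h𝒮.image _)
  refine ⟨Y, hY, fun Y' hY' hYY' p y hy => ?_⟩
  have h1 : hatModule I Y ≤ hatModule I Y' :=
    Submodule.span_mono fun w ⟨q, y, hy, hw⟩ => ⟨q, y, hYY' q hy, hw⟩
  have h2 : hatModule I Y' ≤ hatModule I Y := by
    have h3 := hmax _ ⟨Y', hY', rfl⟩
    rw [lt_iff_le_not_ge, not_and_not_right] at h3
    have h4 := h3 (Submodule.comap_mono h1)
    intro w hw
    exact h4 (show (⟨w, hle Y' hY' hw⟩ : P₀) ∈ (hatModule I Y').comap P₀.subtype from hw)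
  have htop : ∀ Y ∈ 𝒮, Y ≤ slice a fun _ => ⊤ := fun Y hY =>
    (hcl Y hY).2.trans (slice_mono fun _ => le_top)
  rcases lt_or_ge p.2 0 with hp | hp
  · rw [eq_zero_of_mem_slice hp (htop Y' hY' p hy)]
    exact Submodule.zero_mem _
  have h5 := levelProj_mem (hcl Y hY).1 (htop Y hY) hI
    (h2 (Submodule.subset_span ⟨p, y, hy, rfl⟩)) hp
  rwa [levelProj_levelMap, if_pos rfl,
    componentProj_same _ ((mem_slice hp).1 (htop Y' hY' p hy)).2] at h5

end Rees

end GradedTor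
end

/-! ### Growth of the bigraded Hilbert function -/

noncomputable section
namespace GradedTor

/-- If a family of subspaces with finitely many generators maps to a module over an affine algebra,
then the dimensions of the subspaces spanned by the elements of bounded degree grow at most like a
polynomial. -/
theorem exists_growth_filtration {K R Q V ι τ : Type*} [Field K] [CommRing R] [Algebra K R]
    [Algebra.FiniteType K R] [AddCommGroup Q] [Module K Q] [Module R Q] [IsScalarTower K R Q]
    [AddCommGroup V] [Module K V] [AddCommGroup ι] [Finite τ] {x : τ → V →ₗ[K] V} {deg : τ → ι}
    (gen : τ → R) (φ : ι → V →ₗ[K] Q) {Z : ι → Submodule K V}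
    (hZfd : ∀ p, FiniteDimensional K (Z p)) (hZ : ClosedFamily x deg Z)
    (hΦ : ∃ Φ : Finset ι, ∀ Y, ClosedFamily x deg Y → (∀ p ∈ Φ, Z p ≤ Y p) → Z ≤ Y)
    (hφ : ∀ t p, ∀ y ∈ Z p, gen t • φ p y = φ (p + deg t) (x t y))
    (wt : ι → ℕ) (hwt : ∀ t p, ∀ y ∈ Z p, y ≠ 0 → wt p + 1 ≤ wt (p + deg t))
    (J : Ideal R) (hJ : ∀ ρ ∈ J, ∀ p, ∀ z ∈ Z p, ρ • φ p z = 0) {β : ℕ}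
    (hβ : ringKrullDim (R ⧸ J) ≤ β) :
    ∃ (H : ℕ → Submodule K Q) (C : ℕ), Monotone H ∧ (∀ M, FiniteDimensional K (H M)) ∧
      (∀ M, Module.finrank K (H M) ≤ C * (M + 1) ^ β) ∧ ∀ p, ∀ z ∈ Z p, φ p z ∈ H (wt p) := by
  classical
  obtain ⟨Φ, hΦ⟩ := hΦ
  set G : Submodule K Q := ⨆ p ∈ Φ, (Z p).map (φ p) with hG
  have hGfd : FiniteDimensional K G := by
    rw [hG, ← Finset.sup_eq_iSup]
    exact Submodule.finiteDimensional_finset_sup _ _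
  have hGJ : ∀ ρ ∈ J, ∀ y ∈ G, ρ • y = 0 := by
    intro ρ hρ
    have hle : G ≤ LinearMap.ker (Algebra.lsmul K K Q ρ) := iSup₂_le fun p hp => by
      rintro _ ⟨z, hz, rfl⟩
      exact hJ ρ hρ p z hz
    exact fun y hy => hle hy
  set V' : Submodule K R := Submodule.span K (insert 1 (Set.range gen))
  have hVfd : FiniteDimensional K V' :=
    FiniteDimensional.span_of_finite K ((Set.finite_range _).insert 1)
  have h1V : (1 : Submodule K R) ≤ V' :=
    Submodule.one_le.2 (Submodule.subset_span (Set.mem_insert _ _))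
  obtain ⟨C, hC⟩ := exists_finrank_pow_smul_le _ hβ V' G hGJ
  let H : ℕ → Submodule K Q := fun N =>
    Submodule.map₂ (Algebra.lsmul K K Q).toLinearMap (V' ^ N) G
  have hHmono : Monotone H := fun M N h =>
    Submodule.map₂_le_map₂ (pow_le_pow_right' h1V h) le_rfl
  have hGH : ∀ N, G ≤ H N := by
    intro N
    refine le_trans (fun y hy => ?_) (hHmono (Nat.zero_le N))
    have : (1 : R) • y ∈ H 0 :=
      Submodule.apply_mem_map₂ (Algebra.lsmul K K Q).toLinearMap
        (by rw [pow_zero]; exact Submodule.one_le.1 le_rfl) hy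
    rwa [one_smul] at this
  have hVH : ∀ N, ∀ t, ∀ y ∈ H N, gen t • y ∈ H (N + 1) := by
    intro N t y hy
    have hle : H N ≤ (H (N + 1)).comap (Algebra.lsmul K K Q (gen t)) := by
      refine Submodule.map₂_le.2 fun ρ hρ g hg => ?_
      change gen t • ρ • g ∈ H (N + 1)
      rw [smul_smul]
      refine Submodule.apply_mem_map₂ (Algebra.lsmul K K Q).toLinearMap ?_ hg
      rw [pow_succ']
      exact Submodule.mul_mem_mul (Submodule.subset_span (Or.inr ⟨t, rfl⟩)) hρ
    exact hle hy
  -- The right-hand side is closed, because an operator raises the filtration index by one and the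
  -- weight by at least one; it contains the generators because `G` lies in every `H N`.
  have hgen : Z ≤ fun p => Z p ⊓ (H (wt p)).comap (φ p) := by
    refine hΦ _ ?_ fun p hp y hy => ⟨hy, hGH _ ?_⟩
    · rintro t p y ⟨hy, hy'⟩
      refine ⟨hZ t p y hy, ?_⟩
      by_cases h0 : y = 0
      · rw [h0, map_zero]; exact Submodule.zero_mem _
      have h1 := hVH _ t _ hy'
      rw [hφ t p y hy] at h1
      exact hHmono (hwt t p y hy h0) h1
    · exact Submodule.mem_iSup_of_mem p (Submodule.mem_iSup_of_mem hp ⟨y, hy, rfl⟩)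
  exact ⟨H, C, hHmono, fun M => (hC M).1, fun M => (hC M).2, fun p z hz => (hgen p hz).2⟩

section ReesHilbert

variable {K : Type*} [Field K] {n v r : ℕ} {I : Ideal (MvPolynomial (Fin n) K)}
  {f : Fin v → MvPolynomial (Fin n) K} {dg : Fin v → ℕ} {a : Fin r → ℤ}
  {U W : ℕ → Submodule (MvPolynomial (Fin n) K) (Fin r → MvPolynomial (Fin n) K)}

variable (a U W) in
/-- The bigraded Hilbert function of `⨁ₖ Uₖ / Wₖ`. -/
def sliceHilbert (p : ℤ × ℤ) : ℤ :=
  (Module.finrank K (slice a U p) : ℤ) - Module.finrank K (slice a W p)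

lemma sliceHilbert_nonneg (hWU : ∀ k, W k ≤ U k) (p : ℤ × ℤ) : 0 ≤ sliceHilbert a U W p := by
  have := finiteDimensional_slice (a := a) (U := U) p
  have := Submodule.finrank_mono (slice_mono (a := a) hWU p)
  rw [sliceHilbert]
  omega

lemma slice_eq_bot_of_lt {c₀ : ℤ} (hc₀ : ∀ s, c₀ ≤ a s) {c k : ℤ} (hc : c < c₀) :
    slice a U (c, k) = ⊥ := by
  rcases lt_or_ge k 0 with hk | hk
  · exact slice_eq_bot hk
  · rw [slice, if_pos hk, freeGrading_eq_bot hc₀ hc, inf_bot_eq]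

lemma sliceHilbert_eq_zero {c₀ : ℤ} (hc₀ : ∀ s, c₀ ≤ a s) (c k : ℤ) (h : c < c₀ ∨ k < 0) :
    sliceHilbert a U W (c, k) = 0 := by
  rcases h with h | h
  · rw [sliceHilbert, slice_eq_bot_of_lt hc₀ h, slice_eq_bot_of_lt hc₀ h, sub_self]
  · rw [sliceHilbert, slice_eq_bot h, slice_eq_bot h, sub_self]

theorem finite_support_sliceHilbert (hI : Ideal.span (Set.range f) = I)
    (hf : ∀ s, (f s).IsHomogeneous (dg s))
    (hU : ∀ k s, ∀ y ∈ U k, f s • y ∈ U (k + 1)) (hW : ∀ k s, ∀ y ∈ W k, f s • y ∈ W (k + 1))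
    (hWU : ∀ k, W k ≤ U k) (hUI : ∀ k, U k ≤ I ^ k • ⊤) :
    {p | bdiffs (List.replicate n ((1 : ℤ), (0 : ℤ)) ++
      (List.ofFn dg).map fun d : ℕ => ((d : ℤ), (1 : ℤ))) (sliceHilbert a U W) p ≠ 0}.Finite := by
  have h := (noetherianFamily_slice (dg := dg) (a := a) hI).finite_support_bdiffs
    (reesOp_comm f) (fun p => finiteDimensional_slice p)
    ((List.finRange n).map Sum.inl ++ (List.finRange v).map Sum.inr)
    (slice a U) (slice a W) (closedFamily_slice hf hU) (closedFamily_slice hf hW)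
    (slice_mono hWU) (slice_mono hUI) (by
      intro t ht
      rcases t with i | s <;> simp at ht)
  have h2 : (((List.finRange n).map Sum.inl ++ (List.finRange v).map Sum.inr).map (reesDeg n dg)) =
      List.replicate n ((1 : ℤ), (0 : ℤ)) ++
      (List.ofFn dg).map fun d : ℕ => ((d : ℤ), (1 : ℤ)) := by
    rw [List.map_append, List.map_map, List.map_map, List.ofFn_eq_map, List.map_map]
    congr 1
    rw [show (reesDeg n dg ∘ Sum.inl : Fin n → ℤ × ℤ) = fun _ => (1, 0) from rfl, List.map_const',
      List.length_finRange]
  rw [h2] at h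
  exact h

/-- The generators of the Rees algebra. -/
def reesGen (f : Fin v → MvPolynomial (Fin n) K) (hI : Ideal.span (Set.range f) = I) :
    Fin n ⊕ Fin v → reesAlgebra I :=
  Sum.elim (fun i => algebraMap (MvPolynomial (Fin n) K) _ (X i)) fun s => ⟨Polynomial.monomial 1 (f s),
    reesAlgebra.monomial_mem.2 (by
      rw [pow_one, ← hI]
      exact Ideal.subset_span ⟨s, rfl⟩)⟩

lemma reesGen_smul_levelMap (hI : Ideal.span (Set.range f) = I) (t : Fin n ⊕ Fin v) {p : ℤ × ℤ}
    (hp : 0 ≤ p.2) (y : Fin r → MvPolynomial (Fin n) K) :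
    reesGen f hI t • levelMap p.2.toNat y =
      levelMap (p + reesDeg n dg t).2.toNat (reesOp f r t y) := by
  rcases t with i | s
  · change (Polynomial.C (X i) : Polynomial (MvPolynomial (Fin n) K)) • levelMap p.2.toNat y = _
    rw [← Polynomial.monomial_zero_left, monomial_smul_levelMap, reesOp_apply, Sum.elim_inl]
    simp [reesDeg]
  · change (Polynomial.monomial 1 (f s) : Polynomial (MvPolynomial (Fin n) K)) • levelMap p.2.toNat y = _
    rw [monomial_smul_levelMap, reesOp_apply, Sum.elim_inr]
    congr 2
    simp only [reesDeg, Sum.elim_inr, Prod.snd_add]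
    omega

variable (I W a) in
/-- The class of an element of level `k` in the quotient by a family of submodules. -/
def levelClass (k : ℕ) : (Fin r → MvPolynomial (Fin n) K) →ₗ[K]
    ((Fin r → Polynomial (MvPolynomial (Fin n) K)) ⧸ hatModule I (slice a W)) :=
  (hatModule I (slice a W)).mkQ.restrictScalars K ∘ₗ levelMap k

lemma levelClass_eq_zero {p : ℤ × ℤ} {y : Fin r → MvPolynomial (Fin n) K}
    (hy : y ∈ slice a W p) : levelClass I a W p.2.toNat y = 0 :=
  (Submodule.Quotient.mk_eq_zero _).2 (Submodule.subset_span ⟨p, y, hy, rfl⟩)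

lemma algebraMap_smul_levelClass (g : MvPolynomial (Fin n) K) (k : ℕ)
    (y : Fin r → MvPolynomial (Fin n) K) :
    algebraMap (MvPolynomial (Fin n) K) (reesAlgebra I) g • levelClass I a W k y =
      levelClass I a W k (g • y) := by
  change (hatModule I (slice a W)).mkQ ((Polynomial.C g : Polynomial (MvPolynomial (Fin n) K)) •
    levelMap k y) = (hatModule I (slice a W)).mkQ (levelMap k (g • y))
  rw [← Polynomial.monomial_zero_left, monomial_smul_levelMap, zero_add]

lemma reesGen_smul_levelClass (hI : Ideal.span (Set.range f) = I) (t : Fin n ⊕ Fin v) {p : ℤ × ℤ}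
    (hp : 0 ≤ p.2) (y : Fin r → MvPolynomial (Fin n) K) :
    reesGen f hI t • levelClass I a W p.2.toNat y =
      levelClass I a W (p + reesDeg n dg t).2.toNat (reesOp f r t y) := by
  change (hatModule I (slice a W)).mkQ (reesGen f hI t • levelMap p.2.toNat y) =
    (hatModule I (slice a W)).mkQ _
  rw [reesGen_smul_levelMap (dg := dg) hI t hp]

/-- The Rees module is generated by homogeneous elements of `W` only, so `g • z` has to be split
into components that stay in `W k`. -/
lemma smul_levelClass_eq_zero
    (hWg : ∀ k, ∀ w ∈ W k, ∀ c,
      componentProj (isGrading_freeGrading (K := K) (n := n) a).isInternal c w ∈ W k)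
    {J : Ideal (MvPolynomial (Fin n) K)} {k : ℕ} {z : Fin r → MvPolynomial (Fin n) K}
    (hJ : ∀ p ∈ J, p • z ∈ W k) {ρ : reesAlgebra I}
    (hρ : ρ ∈ J.map (algebraMap _ (reesAlgebra I))) : ρ • levelClass I a W k z = 0 := by
  induction hρ using Submodule.span_induction with
  | mem ρ hρ =>
    obtain ⟨g, hg, rfl⟩ := hρ
    rw [algebraMap_smul_levelClass]
    obtain ⟨s, hs⟩ := exists_sum_componentProj
      (isGrading_freeGrading (K := K) (n := n) a).isInternal (g • z)
    rw [hs, map_sum]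
    refine Finset.sum_eq_zero fun c _ => levelClass_eq_zero (p := (c, (k : ℤ))) ?_
    rw [mem_slice (by simp)]
    exact ⟨hWg _ _ (hJ g hg) c, componentProj_mem _ _ _⟩
  | zero => rw [zero_smul]
  | add x y _ _ hx hy => rw [add_smul, hx, hy, add_zero]
  | smul x y _ hy => rw [smul_eq_mul, mul_smul, hy, smul_zero]

/-- Different bidegrees are independent modulo the Rees module of `W`; this is the independence
required by `sum_finrank_sub_le`. -/
lemma mem_slice_of_sum_levelClass_eq_zero (hI : Ideal.span (Set.range f) = I)
    (hf : ∀ s, (f s).IsHomogeneous (dg s)) (hW : ∀ k s, ∀ y ∈ W k, f s • y ∈ W (k + 1))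
    {B : Finset (ℤ × ℤ)} (hB : ∀ p ∈ B, 0 ≤ p.2) {z : ℤ × ℤ → Fin r → MvPolynomial (Fin n) K}
    (hz : ∀ p ∈ B, z p ∈ freeGrading K n a p.1)
    (h0 : ∑ p ∈ B, levelClass I a W p.2.toNat (z p) = 0) {p : ℤ × ℤ} (hp : p ∈ B) :
    z p ∈ slice a W p := by
  have h1 : ∑ q ∈ B, levelMap q.2.toNat (z q) ∈ hatModule I (slice a W) := by
    rw [← Submodule.Quotient.mk_eq_zero, ← h0]
    exact map_sum (hatModule I (slice a W)).mkQ _ _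
  have h2 := levelProj_mem (closedFamily_slice (a := a) hf hW)
    (slice_mono fun _ => le_top) hI h1 (hB p hp)
  rw [map_sum, Finset.sum_eq_single p] at h2
  · rwa [levelProj_levelMap, if_pos rfl, componentProj_same _ (hz p hp)] at h2
  · intro q hq hqp
    have hq0 := hB q hq
    have hp0 := hB p hp
    rw [levelProj_levelMap]
    split_ifs with h3
    · refine componentProj_ne _ (hz q hq) fun h4 => hqp ?_
      exact Prod.ext h4 (by omega)
    · rfl
  · exact fun h => absurd hp h

/-- The classes of `U` modulo `W` at levels from `k₁` on are killed by the extension of `J` to the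
Rees algebra, so the dimension of the quotient ring controls how many of them are independent in a
box. -/
theorem exists_growth_sliceHilbert (hI : Ideal.span (Set.range f) = I)
    (hf : ∀ s, (f s).IsHomogeneous (dg s))
    (hU : ∀ k s, ∀ y ∈ U k, f s • y ∈ U (k + 1)) (hW : ∀ k s, ∀ y ∈ W k, f s • y ∈ W (k + 1))
    (hWU : ∀ k, W k ≤ U k) (hUI : ∀ k, U k ≤ I ^ k • ⊤)
    (hWg : ∀ k, ∀ w ∈ W k, ∀ c,
      componentProj (isGrading_freeGrading (K := K) (n := n) a).isInternal c w ∈ W k)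
    (J : Ideal (MvPolynomial (Fin n) K)) (k₁ : ℕ)
    (hJ : ∀ k, k₁ ≤ k → ∀ p ∈ J, ∀ y ∈ U k, p • y ∈ W k) {β : ℕ}
    (hβ : ringKrullDim (reesAlgebra I ⧸ J.map (algebraMap _ (reesAlgebra I))) ≤ β)
    {c₀ : ℤ} (hc₀ : ∀ s, c₀ ≤ a s) (u : ℕ) :
    ∃ C : ℕ, ∀ N : ℕ, ∑ b ∈ Finset.range (N + 1),
      sumUp (fun c => sliceHilbert a U W (c, (b : ℤ) + k₁)) (u * ((N : ℤ) + 1)) ≤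
        C * ((N : ℤ) + 1) ^ β := by
  classical
  have hft : Algebra.FiniteType K (reesAlgebra I) :=
    Algebra.FiniteType.trans (S := MvPolynomial (Fin n) K) inferInstance inferInstance
  -- Levels below `k₁` are cut off, since `J` is known to carry `U` into `W` only from there on.
  set Z : ℤ × ℤ → Submodule K (Fin r → MvPolynomial (Fin n) K) :=
    fun p => if k₁ ≤ p.2 then slice a U p else ⊥ with hZ
  have hZU : Z ≤ slice a U := by
    intro p
    simp only [hZ]
    split_ifs
    exacts [le_rfl, bot_le]
  have hZk : ∀ p y, y ∈ Z p → y ≠ 0 → (k₁ : ℤ) ≤ p.2 := by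
    intro p y hy h0
    by_contra h
    simp only [hZ, if_neg h, Submodule.mem_bot] at hy
    exact h0 hy
  have hUc := closedFamily_slice (a := a) hf hU
  have hZc : ClosedFamily (reesOp f r) (reesDeg n dg) Z := by
    intro t p y hy
    by_cases h0 : y = 0
    · rw [h0, map_zero]; exact Submodule.zero_mem _
    have hk := hZk p y hy h0
    have : (k₁ : ℤ) ≤ (p + reesDeg n dg t).2 := by
      rcases t with i | s <;> simp [reesDeg] <;> omega
    simp only [hZ, if_pos this]
    exact hUc t p y (hZU p hy)
  have hZfd : ∀ p, FiniteDimensional K (Z p) := fun p =>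
    have := finiteDimensional_slice (a := a) (U := U) p
    Submodule.finiteDimensional_of_le (hZU p)
  obtain ⟨H, C, hHmono, hHfd, hC, hgen⟩ := exists_growth_filtration (reesGen f hI)
    (fun p : ℤ × ℤ => levelClass I a W p.2.toNat) hZfd hZc
    ((noetherianFamily_slice (dg := dg) (a := a) hI).exists_generators hZc
      (hZU.trans (slice_mono hUI))) (by
      intro t p y hy
      by_cases h0 : y = 0
      · rw [h0, map_zero, map_zero, map_zero, smul_zero]
      have hk := hZk p y hy h0
      exact reesGen_smul_levelClass hI t (by omega) y)
    -- The summand k makes the weight grow even under generators of degree 0; subtracting `c₀` keeps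
    -- it nonnegative on nonzero pieces.
    (fun p => (p.1 + p.2 - c₀).toNat) (by
      intro t p y hy h0
      have hk := hZk p y hy h0
      have hc : c₀ ≤ p.1 := by
        by_contra hc
        have := hZU p hy
        rw [← Prod.mk.eta (p := p), slice_eq_bot_of_lt hc₀ (by omega)] at this
        exact h0 this
      rcases t with i | s <;> simp [reesDeg] <;> omega)
    (J.map (algebraMap _ (reesAlgebra I))) (by
      intro ρ hρ p z hz
      by_cases h0 : z = 0
      · rw [h0, map_zero, smul_zero]
      have hk := hZk p z hz h0
      exact smul_levelClass_eq_zero hWg (fun g hg => hJ p.2.toNat (by omega) g hg z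
        ((mem_slice (by omega)).1 (hZU p hz)).1) hρ) hβ
  -- Weights in the box are at most u(N+1) + N + k₁ + |c₀|, hence at most E(N+1).
  set E : ℕ := u + 1 + k₁ + c₀.natAbs with hE
  refine ⟨C * (E + 1) ^ β, fun N => ?_⟩
  set B : Finset (ℤ × ℤ) := (Finset.Icc c₀ (u * ((N : ℤ) + 1))) ×ˢ
    ((Finset.range (N + 1)).image fun b : ℕ => (b : ℤ) + k₁) with hB
  have hBk : ∀ p ∈ B, (k₁ : ℤ) ≤ p.2 ∧ p.2 ≤ N + k₁ ∧ c₀ ≤ p.1 ∧ p.1 ≤ u * ((N : ℤ) + 1) := by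
    intro p hp
    simp only [hB, Finset.mem_product, Finset.mem_Icc, Finset.mem_image, Finset.mem_range] at hp
    obtain ⟨⟨h1, h2⟩, b, hb, h3⟩ := hp
    omega
  have hsum : ∑ b ∈ Finset.range (N + 1),
      sumUp (fun c => sliceHilbert a U W (c, (b : ℤ) + k₁)) (u * ((N : ℤ) + 1)) =
      ∑ p ∈ B, sliceHilbert a U W p := by
    rw [hB, Finset.sum_product_right, Finset.sum_image (by intro x _ y _ h; simpa using h)]
    refine Finset.sum_congr rfl fun b _ => ?_
    exact sumUp_eq_sum (c₀ := c₀) (fun c hc => sliceHilbert_eq_zero hc₀ c _ (Or.inl hc)) _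
  have hHfd' := hHfd (E * (N + 1))
  have hB0 : ∀ p ∈ B, 0 ≤ p.2 := fun p hp => by have := (hBk p hp).1; omega
  have hmain := sum_finrank_sub_le B (slice a U) (slice a W)
    (fun p => finiteDimensional_slice p) (slice_mono hWU)
    (fun p => levelClass I a W p.2.toNat) (H (E * (N + 1))) (by
      intro p hp z hz
      obtain ⟨h1, h2, h3, h4⟩ := hBk p hp
      have hz' : z ∈ Z p := by simpa only [hZ, if_pos h1] using hz
      refine hHmono ?_ (hgen p z hz')
      have : ((E * (N + 1) : ℕ) : ℤ) = u * ((N : ℤ) + 1) + (N + 1) + k₁ * (N + 1) +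
          c₀.natAbs * (N + 1) := by
        rw [hE]; push_cast; ring
      have h5 : (k₁ : ℤ) ≤ k₁ * (N + 1) := by
        nlinarith [(Nat.cast_nonneg k₁ : (0 : ℤ) ≤ k₁), (Nat.cast_nonneg N : (0 : ℤ) ≤ N)]
      have h6 : (c₀.natAbs : ℤ) ≤ c₀.natAbs * (N + 1) := by
        nlinarith [(Nat.cast_nonneg c₀.natAbs : (0 : ℤ) ≤ c₀.natAbs),
          (Nat.cast_nonneg N : (0 : ℤ) ≤ N)]
      omega) (fun z hz h0 p hp => mem_slice_of_sum_levelClass_eq_zero hI hf hW hB0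
        (fun p hp => ((mem_slice (hB0 p hp)).1 (hz p hp)).2) h0 hp)
  rw [hsum]
  refine hmain.trans ?_
  have h8 : E * (N + 1) + 1 ≤ (E + 1) * (N + 1) := by nlinarith
  have h9 : Module.finrank K (H (E * (N + 1))) ≤ C * (E + 1) ^ β * (N + 1) ^ β := by
    refine (hC (E * (N + 1))).trans ?_
    rw [mul_assoc, ← mul_pow]
    exact Nat.mul_le_mul_left _ (Nat.pow_le_pow_left h8 _)
  exact_mod_cast h9

end ReesHilbert

end GradedTor
end

/-! ### Graded submodules and tensor products with S/J -/

noncomputable section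
namespace GradedTor

section LinearAlgebra

variable {K V V' : Type*} [Field K] [AddCommGroup V] [Module K V] [AddCommGroup V'] [Module K V']

lemma finrank_map_add_finrank_inf_ker (f : V →ₗ[K] V') (X : Submodule K V)
    [FiniteDimensional K X] :
    Module.finrank K (X.map f) + Module.finrank K (X ⊓ LinearMap.ker f : Submodule K V) =
      Module.finrank K X := by
  rw [← LinearMap.finrank_range_add_finrank_ker (f.domRestrict X), LinearMap.range_domRestrict,
    LinearMap.ker_domRestrict]
  congr 1
  rw [← Submodule.map_comap_subtype, Submodule.finrank_map_subtype_eq]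

/-- Both kernels on `A` lie in `B`, so A/B is isomorphic to q(A)/q(B) and to δ(A)/δ(B). -/
lemma finrank_map_add_finrank_map {Q : Type*} [AddCommGroup Q] [Module K Q] (q : V →ₗ[K] Q)
    (δ : V →ₗ[K] V') {A B : Submodule K V} [FiniteDimensional K A] [FiniteDimensional K B]
    (hBA : B ≤ A) (hq : A ⊓ LinearMap.ker q ≤ B) (hδ : A ⊓ LinearMap.ker δ ≤ B) :
    Module.finrank K (A.map q) + Module.finrank K (B.map δ) =
      Module.finrank K (B.map q) + Module.finrank K (A.map δ) := by
  have e1 := finrank_map_add_finrank_inf_ker q A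
  have e2 := finrank_map_add_finrank_inf_ker q B
  have e3 := finrank_map_add_finrank_inf_ker δ A
  have e4 := finrank_map_add_finrank_inf_ker δ B
  rw [le_antisymm (le_inf hq inf_le_right) (inf_le_inf hBA le_rfl)] at e1
  rw [le_antisymm (le_inf hδ inf_le_right) (inf_le_inf hBA le_rfl)] at e3
  omega

end LinearAlgebra

section Homogeneous

variable {K : Type*} [Field K] {n r s : ℕ} {a : Fin r → ℤ} {b : Fin s → ℤ}


variable (K n) in
/-- The projection of a graded free module to its component of degree `c`. -/
def freeProj (a : Fin r → ℤ) (c : ℤ) :=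
  componentProj (isGrading_freeGrading (K := K) (n := n) a).isInternal c

lemma freeProj_map (f : (Fin r → MvPolynomial (Fin n) K) →ₗ[MvPolynomial (Fin n) K]
      (Fin s → MvPolynomial (Fin n) K)) (e : ℤ)
    (hf : ∀ c v, v ∈ freeGrading K n a c → f v ∈ freeGrading K n b (e + c)) (c : ℤ)
    (v : Fin r → MvPolynomial (Fin n) K) :
    f (freeProj K n a c v) = freeProj K n b (e + c) (f v) := by
  classical
  have key : ∀ c' y, y ∈ freeGrading K n a c' →
      f (freeProj K n a c y) = freeProj K n b (e + c) (f y) := by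
    intro c' y hy
    by_cases h : c' = c
    · subst h
      rw [freeProj, freeProj, componentProj_same _ hy, componentProj_same _ (hf _ _ hy)]
    · rw [freeProj, freeProj, componentProj_ne _ hy h, componentProj_ne _ (hf _ _ hy) (by omega),
        map_zero]
  obtain ⟨t, ht⟩ := exists_sum_componentProj
    (isGrading_freeGrading (K := K) (n := n) a).isInternal v
  rw [ht]
  simp only [map_sum]
  exact Finset.sum_congr rfl fun c' _ => key c' _ (componentProj_mem _ _ _)

/-- A submodule of a graded free module containing the homogeneous components of its elements. -/
def IsGradedSubmodule (a : Fin r → ℤ)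
    (N : Submodule (MvPolynomial (Fin n) K) (Fin r → MvPolynomial (Fin n) K)) : Prop :=
  ∀ y ∈ N, ∀ c, freeProj K n a c y ∈ N

lemma isGradedSubmodule_range (f : (Fin r → MvPolynomial (Fin n) K) →ₗ[MvPolynomial (Fin n) K]
      (Fin s → MvPolynomial (Fin n) K))
    (hf : ∀ c v, v ∈ freeGrading K n a c → f v ∈ freeGrading K n b c) :
    IsGradedSubmodule b (LinearMap.range f) := by
  rintro _ ⟨v, rfl⟩ c
  have := freeProj_map (a := a) (b := b) f 0 (by simpa using hf) c v
  rw [zero_add] at this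
  exact ⟨_, this⟩

lemma IsGradedSubmodule.smul {N : Submodule (MvPolynomial (Fin n) K) (Fin r → MvPolynomial (Fin n) K)}
    (hN : IsGradedSubmodule a N) {I : Ideal (MvPolynomial (Fin n) K)}
    (hI : I.IsHomogeneous (homogeneousSubmodule (Fin n) K)) : IsGradedSubmodule a (I • N) := by
  classical
  intro y hy c
  refine Submodule.smul_induction_on hy (fun p hp x hx => ?_) fun x y hx hy => ?_
  · rw [← DirectSum.sum_support_decompose (homogeneousSubmodule (Fin n) K) p, Finset.sum_smul,
      map_sum]
    refine Submodule.sum_mem _ fun d _ => ?_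
    have h := freeProj_map (a := a) (b := a) (LinearMap.lsmul (MvPolynomial (Fin n) K) _
      (DirectSum.decompose (homogeneousSubmodule (Fin n) K) p d : MvPolynomial (Fin n) K)) d
      (fun c v hv => by
        rw [add_comm]
        exact smul_mem_freeGrading
          (SetLike.coe_mem (DirectSum.decompose (homogeneousSubmodule (Fin n) K) p d)) hv) (c - d) x
    rw [add_sub_cancel] at h
    simp only [LinearMap.lsmul_apply] at h
    rw [← h]
    exact Submodule.smul_mem_smul (hI d hp) (hN x hx _)
  · rw [map_add]
    exact Submodule.add_mem _ hx hy

lemma isHomogeneous_pow {I : Ideal (MvPolynomial (Fin n) K)}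
    (hI : I.IsHomogeneous (homogeneousSubmodule (Fin n) K)) (k : ℕ) :
    (I ^ k).IsHomogeneous (homogeneousSubmodule (Fin n) K) := by
  induction k with
  | zero => rw [pow_zero, Ideal.one_eq_top]; exact Ideal.IsHomogeneous.top _
  | succ k ih => rw [pow_succ]; exact ih.mul hI

lemma isGradedSubmodule_top : IsGradedSubmodule (K := K) (n := n) a ⊤ := fun _ _ _ => trivial

lemma exists_homogeneous_generators {I : Ideal (MvPolynomial (Fin n) K)}
    (hI : I.IsHomogeneous (homogeneousSubmodule (Fin n) K)) :
    ∃ (v : ℕ) (f : Fin v → MvPolynomial (Fin n) K) (dg : Fin v → ℕ),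
      Ideal.span (Set.range f) = I ∧ ∀ s, (f s).IsHomogeneous (dg s) := by
  classical
  obtain ⟨T, hT⟩ := (Ideal.IsHomogeneous.iff_exists _ _).1 hI
  have hfg : I.FG := IsNoetherian.noetherian I
  rw [hT] at hfg
  obtain ⟨t, ht, hspan⟩ := Submodule.fg_span_iff_fg_span_finset_subset _ |>.1 hfg
  have h1 : ∀ x : t, ∃ d, (x : MvPolynomial (Fin n) K).IsHomogeneous d := by
    intro x
    obtain ⟨y, -, hy⟩ := ht x.2
    obtain ⟨d, hd⟩ := y.2
    exact ⟨d, by rw [← hy]; exact hd⟩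
  choose dg hdg using h1
  refine ⟨t.card, fun s => t.equivFin.symm s, fun s => dg (t.equivFin.symm s), ?_,
    fun s => hdg _⟩
  rw [hT]
  change _ = Submodule.span _ _
  rw [hspan]
  change Submodule.span _ _ = _
  congr 1
  ext x
  constructor
  · rintro ⟨s, rfl⟩
    exact (t.equivFin.symm s).2
  · intro hx
    exact ⟨t.equivFin ⟨x, hx⟩, by simp⟩

end Homogeneous

section Tensor

variable {K : Type*} [Field K] {n r s : ℕ}

variable (r) in
/-- The map `y ↦ y ⊗ 1`. -/
def tensorOne (J : Ideal (MvPolynomial (Fin n) K)) :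
    (Fin r → MvPolynomial (Fin n) K) →ₗ[MvPolynomial (Fin n) K]
      (Fin r → MvPolynomial (Fin n) K) ⊗[MvPolynomial (Fin n) K] (MvPolynomial (Fin n) K ⧸ J) :=
  (TensorProduct.mk _ _ _).flip 1

variable (J : Ideal (MvPolynomial (Fin n) K))

lemma tensorOne_surjective : Function.Surjective (tensorOne r J) := by
  intro z
  obtain ⟨y, hy⟩ := Submodule.Quotient.mk_surjective _ (tensorQuotEquivQuotSMul _ J z)
  refine ⟨y, (tensorQuotEquivQuotSMul _ J).injective ?_⟩
  rw [← hy]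
  exact (tensorQuotEquivQuotSMul_tmul_mk J y 1).trans (by rw [one_smul])

lemma ker_tensorOne : LinearMap.ker (tensorOne r J) = J • ⊤ := by
  ext y
  rw [LinearMap.mem_ker, ← (tensorQuotEquivQuotSMul _ J).map_eq_zero_iff]
  have : tensorQuotEquivQuotSMul _ J (tensorOne r J y) = Submodule.Quotient.mk y :=
    (tensorQuotEquivQuotSMul_tmul_mk J y 1).trans (by rw [one_smul])
  rw [this, Submodule.Quotient.mk_eq_zero]

/-- A homogeneous tensor x ⊗ ḡ equals (g • x) ⊗ 1, and 1 has degree 0. -/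
lemma tensorGrading_freeGrading (a : Fin r → ℤ) (c : ℤ) :
    tensorGrading (n := n) (freeGrading K n a) (quotientGrading J) c =
      (freeGrading K n a c).map ((tensorOne r J).restrictScalars K) := by
  refine le_antisymm (Submodule.span_le.2 ?_) ?_
  · rintro _ ⟨b, b', rfl, x, hx, _, ⟨g, hg, rfl⟩, rfl⟩
    refine ⟨g • x, ?_, ?_⟩
    · rw [add_comm]
      exact (isGrading_freeGrading a).smul_mem b' b g x hg hx
    · change (g • x) ⊗ₜ[MvPolynomial (Fin n) K] (1 : MvPolynomial (Fin n) K ⧸ J) = _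
      rw [TensorProduct.smul_tmul]
      congr 1
      exact (Algebra.algebraMap_eq_smul_one g).symm
  · rintro _ ⟨y, hy, rfl⟩
    refine Submodule.subset_span ⟨c, 0, add_zero c, y, hy, 1, ⟨1, ?_, rfl⟩, rfl⟩
    rw [SetLike.mem_coe, mem_polyGrading]
    intro m hm
    rw [coeff_one] at hm
    split_ifs at hm with h
    · rw [← h]; simp
    · exact absurd rfl hm

lemma rTensor_tensorOne (f : (Fin r → MvPolynomial (Fin n) K) →ₗ[MvPolynomial (Fin n) K]
      (Fin s → MvPolynomial (Fin n) K)) (y : Fin r → MvPolynomial (Fin n) K) :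
    f.rTensor (MvPolynomial (Fin n) K ⧸ J) (tensorOne r J y) = tensorOne s J (f y) := rfl

end Tensor

/-! ### Tor as a subquotient of a free module, and its annihilator -/

section Tor

variable {K : Type*} [Field K] {n : ℕ} {M : Type*} [AddCommGroup M] [Module K M]
  [Module (MvPolynomial (Fin n) K) M] {𝓜 : ℤ → Submodule K M} (F : FreeResolution (n := n) 𝓜)
  (J : Ideal (MvPolynomial (Fin n) K)) (l : ℕ)

lemma tensorOne_mem_cycles {v : Fin (F.rank (l + 1)) → MvPolynomial (Fin n) K} :
    tensorOne _ J v ∈ F.cycles (MvPolynomial (Fin n) K ⧸ J) (l + 1) ↔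
      F.d l v ∈ J • (⊤ : Submodule (MvPolynomial (Fin n) K) _) := by
  rw [← ker_tensorOne]
  exact Iff.rfl

/-- v ⊗ 1 is a boundary exactly when v ∈ im d + J F_{l+1}; as im d = ker d there, this is a
condition on d v alone. -/
lemma tensorOne_mem_boundaries {v : Fin (F.rank (l + 1)) → MvPolynomial (Fin n) K} :
    tensorOne _ J v ∈ F.boundaries (MvPolynomial (Fin n) K ⧸ J) (l + 1) ↔
      F.d l v ∈ J • LinearMap.range (F.d l) := by
  have hr : J • LinearMap.range (F.d l) =
      (J • (⊤ : Submodule (MvPolynomial (Fin n) K) _)).map (F.d l) := by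
    rw [Submodule.map_smul'', Submodule.map_top]
  rw [hr]
  constructor
  · rintro ⟨t, ht⟩
    obtain ⟨u, rfl⟩ := tensorOne_surjective J t
    rw [rTensor_tensorOne] at ht
    refine ⟨v - F.d (l + 1) u, ?_, ?_⟩
    · rw [← ker_tensorOne, SetLike.mem_coe, LinearMap.mem_ker, map_sub, ht, sub_self]
    · rw [map_sub, (F.exact_d l).apply_apply_eq_zero, sub_zero]
  · rintro ⟨w, hw, hvw⟩
    obtain ⟨u, hu⟩ := ((F.exact_d l) (v - w)).1 (by rw [map_sub, hvw, sub_self])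
    refine ⟨tensorOne _ J u, ?_⟩
    rw [← ker_tensorOne, SetLike.mem_coe, LinearMap.mem_ker] at hw
    rw [rTensor_tensorOne, hu, map_sub, hw, sub_zero]

/-- The cycles `d v ∈ J F_l` of the complex `F ⊗ S ⧸ J`, inside `F_l`. -/
def liftedCycles : Submodule (MvPolynomial (Fin n) K) (Fin (F.rank l) → MvPolynomial (Fin n) K) :=
  LinearMap.range (F.d l) ⊓ J • ⊤

/-- The images `J d(F_{l+1})` of the boundaries. -/
def liftedBoundaries :
    Submodule (MvPolynomial (Fin n) K) (Fin (F.rank l) → MvPolynomial (Fin n) K) :=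
  J • LinearMap.range (F.d l)

lemma liftedBoundaries_le : liftedBoundaries F J l ≤ liftedCycles F J l :=
  le_inf (Submodule.smul_le_right) (Submodule.smul_mono le_rfl le_top)

/-- The annihilator of the homology, computed in `F_l`. -/
def liftedAnnihilator : Ideal (MvPolynomial (Fin n) K) where
  carrier := {p | ∀ z ∈ liftedCycles F J l, p • z ∈ liftedBoundaries F J l}
  add_mem' hp hq z hz := by
    rw [add_smul]
    exact add_mem (hp z hz) (hq z hz)
  zero_mem' z _ := by
    rw [zero_smul]
    exact zero_mem _
  smul_mem' c p hp z hz := by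
    rw [smul_assoc]
    exact Submodule.smul_mem _ _ (hp z hz)

lemma mem_liftedAnnihilator {p : MvPolynomial (Fin n) K} : p ∈ liftedAnnihilator F J l ↔
    ∀ z ∈ liftedCycles F J l, p • z ∈ liftedBoundaries F J l := Iff.rfl

lemma annihilator_homology :
    Module.annihilator (MvPolynomial (Fin n) K) (F.homology (MvPolynomial (Fin n) K ⧸ J) (l + 1)) =
      liftedAnnihilator F J l := by
  ext p
  rw [Module.mem_annihilator, mem_liftedAnnihilator]
  constructor
  · rintro h _ ⟨⟨v, rfl⟩, hv⟩
    have h1 := h (Submodule.Quotient.mk ⟨tensorOne _ J v, (tensorOne_mem_cycles F J l).2 hv⟩)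
    rw [← Submodule.Quotient.mk_smul, Submodule.Quotient.mk_eq_zero] at h1
    have h2 : tensorOne _ J (p • v) ∈ F.boundaries (MvPolynomial (Fin n) K ⧸ J) (l + 1) := by
      rw [map_smul]
      exact h1
    rw [tensorOne_mem_boundaries, map_smul] at h2
    exact h2
  · intro h x
    obtain ⟨⟨z, hz⟩, rfl⟩ := Submodule.Quotient.mk_surjective _ x
    obtain ⟨v, rfl⟩ := tensorOne_surjective J z
    rw [← Submodule.Quotient.mk_smul, Submodule.Quotient.mk_eq_zero]
    change p • tensorOne _ J v ∈ F.boundaries (MvPolynomial (Fin n) K ⧸ J) (l + 1)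
    rw [← map_smul, tensorOne_mem_boundaries, map_smul]
    exact h _ ⟨⟨v, rfl⟩, (tensorOne_mem_cycles F J l).1 hz⟩

lemma finrank_subquotientGrading {R P : Type*} [CommRing R] [Algebra K R] [AddCommGroup P]
    [Module K P] [Module R P] [IsScalarTower K R P] (𝓟 : ℤ → Submodule K P) (Z B : Submodule R P)
    (c : ℤ) [FiniteDimensional K (𝓟 c)] :
    Module.finrank K (subquotientGrading 𝓟 Z B c) +
      Module.finrank K ((𝓟 c) ⊓ (Z ⊓ B).restrictScalars K : Submodule K P) =
        Module.finrank K ((𝓟 c) ⊓ Z.restrictScalars K : Submodule K P) := by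
  let X := (𝓟 c).comap (Z.subtype.restrictScalars K)
  have hX : X.map (Z.subtype.restrictScalars K) = (𝓟 c) ⊓ Z.restrictScalars K := by
    ext x
    constructor
    · rintro ⟨y, hy, rfl⟩
      exact ⟨hy, y.2⟩
    · rintro ⟨h1, h2⟩
      exact ⟨⟨x, h2⟩, h1, rfl⟩
  have hX2 : (X ⊓ LinearMap.ker ((B.submoduleOf Z).mkQ.restrictScalars K)).map
      (Z.subtype.restrictScalars K) = (𝓟 c) ⊓ (Z ⊓ B).restrictScalars K := by
    ext x
    constructor
    · rintro ⟨y, ⟨hy, hy2⟩, rfl⟩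
      exact ⟨hy, y.2, (Submodule.Quotient.mk_eq_zero (B.submoduleOf Z)).1 hy2⟩
    · rintro ⟨h1, h2, h3⟩
      exact ⟨⟨x, h2⟩, ⟨h1, (Submodule.Quotient.mk_eq_zero _).2 h3⟩, rfl⟩
  have hinj : Function.Injective (Z.subtype.restrictScalars K) := Subtype.val_injective
  have e1 := LinearEquiv.finrank_eq (Submodule.equivMapOfInjective _ hinj X)
  have e2 := LinearEquiv.finrank_eq (Submodule.equivMapOfInjective _ hinj
    (X ⊓ LinearMap.ker ((B.submoduleOf Z).mkQ.restrictScalars K)))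
  rw [hX] at e1
  rw [hX2] at e2
  have : FiniteDimensional K (𝓟 c ⊓ Z.restrictScalars K : Submodule K P) :=
    Submodule.finiteDimensional_inf_left _ _
  have : FiniteDimensional K X := by
    have h2 := Submodule.equivMapOfInjective _ hinj X
    rw [hX] at h2
    exact Module.Finite.equiv h2.symm
  rw [← e1, ← e2, ← finrank_map_add_finrank_inf_ker ((B.submoduleOf Z).mkQ.restrictScalars K) X]
  rfl

lemma exists_homogeneous_preimage {r s : ℕ} {a : Fin r → ℤ} {b : Fin s → ℤ}
    (f : (Fin r → MvPolynomial (Fin n) K) →ₗ[MvPolynomial (Fin n) K]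
      (Fin s → MvPolynomial (Fin n) K))
    (hf : ∀ c v, v ∈ freeGrading K n a c → f v ∈ freeGrading K n b c)
    {N : Submodule (MvPolynomial (Fin n) K) (Fin r → MvPolynomial (Fin n) K)}
    (hN : IsGradedSubmodule a N) {c : ℤ} {y : Fin s → MvPolynomial (Fin n) K}
    (hy : y ∈ N.map f) (hyc : y ∈ freeGrading K n b c) :
    ∃ v ∈ N, v ∈ freeGrading K n a c ∧ f v = y := by
  obtain ⟨v, hv, rfl⟩ := hy
  refine ⟨freeProj K n a c v, hN v hv c, componentProj_mem _ _ _, ?_⟩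
  have := freeProj_map (a := a) (b := b) f 0 (by simpa using hf) c v
  rw [zero_add] at this
  rw [this]
  exact componentProj_same _ hyc

-- The differential carries cycles modulo boundaries to `liftedCycles` modulo `liftedBoundaries`,
-- degree by degree.
set_option maxHeartbeats 1000000 in
theorem finrank_homologyGrading (hJ : J.IsHomogeneous (homogeneousSubmodule (Fin n) K)) (c : ℤ) :
    (Module.finrank K (F.homologyGrading (quotientGrading J) (l + 1) c) : ℤ) =
      Module.finrank K ((liftedCycles F J l).restrictScalars K ⊓
          freeGrading K n (F.shift l) c : Submodule K _) -
        Module.finrank K ((liftedBoundaries F J l).restrictScalars K ⊓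
          freeGrading K n (F.shift l) c : Submodule K _) := by
  let N := MvPolynomial (Fin n) K ⧸ J
  let V := Fin (F.rank (l + 1)) → MvPolynomial (Fin n) K
  let Fc : Submodule K V := freeGrading K n (F.shift (l + 1)) c
  let q := (tensorOne (F.rank (l + 1)) J).restrictScalars K
  let δ := (F.d l).restrictScalars K
  -- `A` and `B` lift the cycles and the boundaries of degree c to F_{l+1}. Their images under q
  -- compute the homology, those under δ the lifted subquotient.
  let A : Submodule K V := Fc ⊓ ((F.cycles N (l + 1)).restrictScalars K).comap q
  let B : Submodule K V := Fc ⊓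
    ((F.cycles N (l + 1) ⊓ F.boundaries N (l + 1)).restrictScalars K).comap q
  have hFc : FiniteDimensional K Fc := finiteDimensional_freeGrading K n _ c
  have hA : FiniteDimensional K A := Submodule.finiteDimensional_inf_left _ _
  have hB : FiniteDimensional K B := Submodule.finiteDimensional_inf_left _ _
  have htG := tensorGrading_freeGrading J (F.shift (l + 1)) c
  have hfd : FiniteDimensional K
      (tensorGrading (n := n) (freeGrading K n (F.shift (l + 1))) (quotientGrading J) c) := by
    rw [htG]
    infer_instance
  have h1 := finrank_subquotientGrading
    (tensorGrading (n := n) (freeGrading K n (F.shift (l + 1))) (quotientGrading J))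
    (F.cycles N (l + 1)) (F.boundaries N (l + 1)) c
  rw [htG, Submodule.map_inf_eq_map_inf_comap, Submodule.map_inf_eq_map_inf_comap] at h1
  have hmem : ∀ v, v ∈ B ↔ v ∈ Fc ∧ F.d l v ∈ liftedBoundaries F J l := by
    intro v
    constructor
    · rintro ⟨h, -, h'⟩
      exact ⟨h, (tensorOne_mem_boundaries F J l).1 h'⟩
    · rintro ⟨h, h'⟩
      exact ⟨h, (tensorOne_mem_cycles F J l).2 (liftedBoundaries_le F J l h').2,
        (tensorOne_mem_boundaries F J l).2 h'⟩
  have hBA : B ≤ A := fun v hv => ⟨hv.1, hv.2.1⟩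
  have hq : A ⊓ LinearMap.ker q ≤ B := by
    rintro v ⟨⟨hv, hv1⟩, hv2⟩
    refine ⟨hv, hv1, ?_⟩
    rw [LinearMap.mem_ker.1 hv2]
    exact Submodule.zero_mem _
  have hδ : A ⊓ LinearMap.ker δ ≤ B := by
    rintro v ⟨⟨hv, hv1⟩, hv2⟩
    refine (hmem v).2 ⟨hv, ?_⟩
    rw [show F.d l v = 0 from hv2]
    exact Submodule.zero_mem _
  have hAδ : A.map δ = (liftedCycles F J l).restrictScalars K ⊓ freeGrading K n (F.shift l) c := by
    refine le_antisymm ?_ ?_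
    · rintro _ ⟨v, ⟨hv, hv1⟩, rfl⟩
      exact ⟨⟨⟨v, rfl⟩, (tensorOne_mem_cycles F J l).1 hv1⟩, F.d_mem l c v hv⟩
    · rintro y ⟨⟨hy, hy2⟩, hyc⟩
      obtain ⟨v, -, hv, rfl⟩ := exists_homogeneous_preimage (F.d l) (F.d_mem l)
        isGradedSubmodule_top (by rwa [Submodule.map_top]) hyc
      exact ⟨v, ⟨hv, (tensorOne_mem_cycles F J l).2 hy2⟩, rfl⟩
  have hBδ : B.map δ =
      (liftedBoundaries F J l).restrictScalars K ⊓ freeGrading K n (F.shift l) c := by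
    refine le_antisymm ?_ ?_
    · rintro _ ⟨v, hv, rfl⟩
      have := (hmem v).1 hv
      exact ⟨this.2, F.d_mem l c v this.1⟩
    · rintro y ⟨hy, hyc⟩
      have hy' : y ∈ (J • (⊤ : Submodule (MvPolynomial (Fin n) K) _)).map (F.d l) := by
        rwa [Submodule.map_smul'', Submodule.map_top]
      obtain ⟨v, -, hv, rfl⟩ := exists_homogeneous_preimage (F.d l) (F.d_mem l)
        (isGradedSubmodule_top.smul hJ) hy' hyc
      exact ⟨v, (hmem v).2 ⟨hv, hy⟩, rfl⟩
  have h2 := finrank_map_add_finrank_map q δ hBA hq hδ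
  rw [hAδ, hBδ] at h2
  change Module.finrank K (F.homologyGrading (quotientGrading J) (l + 1) c) +
    Module.finrank K (B.map q) = Module.finrank K (A.map q) at h1
  omega

/-- Multiplication by `p` on F lifts the zero map of `M`, hence is null-homotopic; on im d the
relation d h + h d = p reduces to d h = p. -/
lemma exists_homotopy {p : MvPolynomial (Fin n) K}
    (hp : p ∈ Module.annihilator (MvPolynomial (Fin n) K) M) (l : ℕ) :
    ∃ h : (Fin (F.rank l) → MvPolynomial (Fin n) K) →ₗ[MvPolynomial (Fin n) K]
      (Fin (F.rank (l + 1)) → MvPolynomial (Fin n) K),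
      ∀ y ∈ LinearMap.range (F.d l), F.d l (h y) = p • y := by
  have lift : ∀ (l : ℕ) (g : (Fin (F.rank l) → MvPolynomial (Fin n) K) →ₗ[MvPolynomial (Fin n) K]
      (Fin (F.rank l) → MvPolynomial (Fin n) K)), (∀ y, g y ∈ LinearMap.range (F.d l)) →
      ∃ h : (Fin (F.rank l) → MvPolynomial (Fin n) K) →ₗ[MvPolynomial (Fin n) K]
        (Fin (F.rank (l + 1)) → MvPolynomial (Fin n) K), ∀ y, F.d l (h y) = g y := by
    intro l g hg
    obtain ⟨h, hh⟩ := Module.projective_lifting_property (F.d l).rangeRestrict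
      (g.codRestrict _ hg) (F.d l).surjective_rangeRestrict
    exact ⟨h, fun y => congrArg Subtype.val (LinearMap.congr_fun hh y)⟩
  induction l with
  | zero =>
    obtain ⟨h, hh⟩ := lift 0 (LinearMap.lsmul _ _ p) fun y => by
      refine ((F.exact_aug _).1 ?_)
      rw [LinearMap.lsmul_apply, map_smul]
      exact Module.mem_annihilator.1 hp _
    exact ⟨h, fun y _ => hh y⟩
  | succ l ih =>
    obtain ⟨h, hh⟩ := ih
    obtain ⟨h', hh'⟩ := lift (l + 1) (LinearMap.lsmul _ _ p - h ∘ₗ F.d l) fun y => by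
      refine ((F.exact_d l _).1 ?_)
      rw [LinearMap.sub_apply, map_sub, LinearMap.comp_apply, hh _ ⟨y, rfl⟩, LinearMap.lsmul_apply,
        map_smul, sub_self]
    refine ⟨h', ?_⟩
    rintro _ ⟨y, rfl⟩
    rw [hh', LinearMap.sub_apply, LinearMap.comp_apply, (F.exact_d l).apply_apply_eq_zero, map_zero,
      sub_zero, LinearMap.lsmul_apply]

/-- For a homotopy h one has p z = d (h z), and h z ∈ J F_{l+1} by linearity when z ∈ J F_l. -/
lemma annihilator_le_liftedAnnihilator :
    Module.annihilator (MvPolynomial (Fin n) K) M ≤ liftedAnnihilator F J l := by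
  rintro p hp z ⟨hz1, hz2⟩
  obtain ⟨h, hh⟩ := exists_homotopy F hp l
  rw [← hh z hz1, liftedBoundaries, ← Submodule.map_top, ← Submodule.map_smul'']
  refine ⟨h z, ?_, rfl⟩
  have := Submodule.mem_map_of_mem (f := h) hz2
  rw [Submodule.map_smul''] at this
  exact Submodule.smul_mono le_rfl le_top this

variable (I : Ideal (MvPolynomial (Fin n) K))

/-- By Artin–Rees, U_{k+1} = I U_k for large k, while W_{k+1} = I W_k always. So the annihilators
eventually increase, and stabilize in a noetherian ring. -/
lemma exists_liftedAnnihilator_stable :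
    ∃ k₀, ∀ k, k₀ ≤ k → liftedAnnihilator F (I ^ k) l = liftedAnnihilator F (I ^ k₀) l := by
  obtain ⟨k₁, hk₁⟩ := I.exists_pow_inf_eq_pow_smul (LinearMap.range (F.d l))
  have hstep : ∀ k, k₁ ≤ k → liftedCycles F (I ^ (k + 1)) l ≤ I • liftedCycles F (I ^ k) l := by
    intro k hk
    have h1 := hk₁ k hk
    have h2 := hk₁ (k + 1) (by omega)
    rw [show k + 1 - k₁ = (k - k₁) + 1 by omega, pow_succ', Submodule.mul_smul, pow_succ', Submodule.mul_smul,
      ← h1] at h2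
    rw [liftedCycles, inf_comm, liftedCycles, inf_comm (LinearMap.range _), pow_succ',
      Submodule.mul_smul]
    exact h2.le
  have hmono : ∀ k, k₁ ≤ k → liftedAnnihilator F (I ^ k) l ≤ liftedAnnihilator F (I ^ (k + 1)) l := by
    intro k hk p hp z hz
    rw [liftedBoundaries, pow_succ', Submodule.mul_smul]
    refine Submodule.smul_induction_on (p := fun z => p • z ∈ I • liftedBoundaries F (I ^ k) l)
      (hstep k hk hz) (fun r hr x hx => ?_) fun x y hx hy => ?_
    · rw [smul_comm]
      exact Submodule.smul_mem_smul hr (hp x hx)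
    · rw [smul_add]
      exact add_mem hx hy
  obtain ⟨m, hm⟩ := monotone_stabilizes_iff_noetherian.2
    (inferInstanceAs (IsNoetherian (MvPolynomial (Fin n) K) (MvPolynomial (Fin n) K)))
    ⟨fun k => liftedAnnihilator F (I ^ (k₁ + k)) l,
      monotone_nat_of_le_succ fun k => hmono (k₁ + k) (by omega)⟩
  refine ⟨k₁ + m, fun k hk => ?_⟩
  have := hm (k - k₁) (by omega)
  simp only [OrderHom.coe_mk] at this
  rw [show k₁ + (k - k₁) = k by omega] at this
  exact this.symm

end Tor

end GradedTor
end

/-! ### Iterated sums and the bound on the total degree -/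

noncomputable section
namespace GradedTor

section IterSum

/-- The iterated summatory functions of a function on `ℤ` vanishing in small degrees. -/
def iterSum (f : ℤ → ℤ) : ℕ → ℤ → ℤ
  | 0 => f
  | i + 1 => sumUp (iterSum f i)

variable {f : ℤ → ℤ} {c₀ : ℤ}

lemma iterSum_eq_zero (hf : ∀ c < c₀, f c = 0) (i : ℕ) : ∀ c < c₀, iterSum f i c = 0 := by
  induction i with
  | zero => exact hf
  | succ i ih => exact fun c hc => sumUp_eq_zero ih hc

lemma iterSum_nonneg (h0 : ∀ c, 0 ≤ f c) (i : ℕ) (c : ℤ) : 0 ≤ iterSum f i c := by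
  induction i generalizing c with
  | zero => exact h0 c
  | succ i ih => exact sumUp_nonneg ih c

lemma iterSum_mono (hf : ∀ c < c₀, f c = 0) (h0 : ∀ c, 0 ≤ f c) (i : ℕ) (c c' : ℤ) (h : c ≤ c') :
    iterSum f (i + 1) c ≤ iterSum f (i + 1) c' :=
  sumUp_mono (iterSum_eq_zero hf i) (iterSum_nonneg h0 i) h

/-- Each further summation of a monotone function costs at most a factor equal to the number of
terms from c₀ to c. -/
lemma iterSum_le (hf : ∀ c < c₀, f c = 0) (h0 : ∀ c, 0 ≤ f c) (i : ℕ) (c : ℤ) :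
    iterSum f (i + 1) c ≤ ((c - c₀ + 1).toNat : ℤ) ^ i * sumUp f c := by
  induction i with
  | zero => rw [pow_zero, one_mul]; exact le_rfl
  | succ i ih =>
    refine (sumUp_le (iterSum_eq_zero hf _) (iterSum_mono hf h0 i) c).trans ?_
    rw [pow_succ', mul_assoc]
    exact mul_le_mul_of_nonneg_left ih (Int.natCast_nonneg _)

lemma iteratedHilbert_eq_iterSum {K : Type*} [Field K] {T : Type*} [AddCommGroup T] [Module K T]
    (𝓣 : ℤ → Submodule K T) (i : ℕ) :
    iteratedHilbert 𝓣 i = iterSum (fun c => (Module.finrank K (𝓣 c) : ℤ)) i := by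
  induction i with
  | zero => rfl
  | succ i ih =>
    funext c
    change (∑ᶠ b ∈ Set.Iic c, iteratedHilbert 𝓣 i b) = _
    rw [ih]
    rfl

/-- The i inner summations are undone by i extra differences (1, 0), so `regionPoly_sumUp` applies
with `n + i` of them. -/
theorem regionPoly_iterSum {δ : ℕ} (L : List ℕ) (hL : ∀ d ∈ L, d ≤ δ) (n : ℕ)
    (f : ℤ × ℤ → ℤ) (hf : ∀ c k, c < c₀ ∨ k < 0 → f (c, k) = 0)
    (hfin : {p | bdiffs (List.replicate n ((1 : ℤ), (0 : ℤ)) ++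
      L.map fun d : ℕ => ((d : ℤ), (1 : ℤ))) f p ≠ 0}.Finite) (i : ℕ) :
    ∃ m k₁ c₁, RegionPoly m δ k₁ c₁ fun c k => iterSum (fun b => f (b, k)) (i + 1) c := by
  have hz : ∀ i c k, c < c₀ ∨ k < 0 → iterSum (fun b => f (b, k)) i c = 0 := by
    intro i c k h
    rcases h with h | h
    · exact iterSum_eq_zero (fun c hc => hf c k (Or.inl hc)) i c h
    · exact iterSum_eq_zero (c₀ := c + 1) (fun c _ => hf c k (Or.inr h)) i c (by omega)
  refine regionPoly_sumUp L hL (n + i) (fun p => iterSum (fun b => f (b, p.2)) i p.1) (hz i) ?_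
  induction i with
  | zero => exact hfin
  | succ i ih =>
    refine (congrArg (fun g : ℤ × ℤ → ℤ => {p | g p ≠ 0}.Finite) ?_).mp ih
    rw [← add_assoc, List.replicate_succ, List.cons_append]
    change _ = bdiffs _ (bdiff _ _)
    congr 1
    funext p
    rw [bdiff]
    simp only [Prod.fst_sub, Prod.snd_sub, sub_zero]
    exact (sumUp_sub (c₀ := c₀) (fun c hc => hz i c _ (Or.inl hc)) _).symm

end IterSum

section Region

variable {K : Type*} [Field K] {n v r : ℕ} {I : Ideal (MvPolynomial (Fin n) K)}
  {f : Fin v → MvPolynomial (Fin n) K} {dg : Fin v → ℕ} {a : Fin r → ℤ}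
  {U W : ℕ → Submodule (MvPolynomial (Fin n) K) (Fin r → MvPolynomial (Fin n) K)}

/-- Hilbert–Serre gives polynomiality without control of the degree, and `IsPoly.of_growth` then
supplies the degree. The latter needs monotonicity in c, so it is applied to sums of order at least
one; order 0 is a difference of order 1, which lowers the bound by one. -/
theorem exists_regionPoly_sliceHilbert (hI : Ideal.span (Set.range f) = I)
    (hf : ∀ s, (f s).IsHomogeneous (dg s))
    (hU : ∀ k s, ∀ y ∈ U k, f s • y ∈ U (k + 1)) (hW : ∀ k s, ∀ y ∈ W k, f s • y ∈ W (k + 1))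
    (hWU : ∀ k, W k ≤ U k) (hUI : ∀ k, U k ≤ I ^ k • ⊤)
    (hWg : ∀ k, IsGradedSubmodule a (W k))
    (J : Ideal (MvPolynomial (Fin n) K)) (k₁ : ℕ)
    (hJ : ∀ k, k₁ ≤ k → ∀ p ∈ J, ∀ y ∈ U k, p • y ∈ W k) {β : ℕ}
    (hβ : ringKrullDim (reesAlgebra I ⧸ J.map (algebraMap _ (reesAlgebra I))) ≤ β)
    {δ : ℕ} (hδ : ∀ s, dg s ≤ δ) (i : ℕ) :
    ∃ k₀ c₁, k₁ ≤ k₀ ∧ RegionPoly (β + i - 1) δ k₀ c₁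
      fun c k => iterSum (fun b => sliceHilbert a U W (b, k)) i c := by
  obtain ⟨c₀, hc₀⟩ : ∃ c₀ : ℤ, ∀ s, c₀ ≤ a s := by
    obtain ⟨c₀, h⟩ := (Set.finite_range a).bddBelow
    exact ⟨c₀, fun s => h ⟨s, rfl⟩⟩
  have hvan := sliceHilbert_eq_zero (K := K) (U := U) (W := W) hc₀
  have hnn := sliceHilbert_nonneg (a := a) hWU
  have main : ∀ i, ∃ k₀ c₁, k₁ ≤ k₀ ∧ RegionPoly (β + i) δ k₀ c₁
      fun c k => iterSum (fun b => sliceHilbert a U W (b, k)) (i + 1) c := by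
    intro i
    obtain ⟨m, k₂, c₁, hreg⟩ := regionPoly_iterSum (List.ofFn dg)
      (by
        intro d hd
        obtain ⟨s, rfl⟩ := (List.mem_ofFn' _ _).1 hd
        exact hδ s)
      n (sliceHilbert a U W) hvan (finite_support_sliceHilbert hI hf hU hW hWU hUI) i
    refine ⟨max k₁ k₂, c₁, le_max_left _ _, ?_⟩
    have hreg' := hreg.mono le_rfl (le_max_right k₁ k₂) le_rfl
    set k₀ := max k₁ k₂
    refine IsPoly.of_growth hreg' (fun x b => iterSum_nonneg (fun c => hnn _) _ _) (fun x b => ?_)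
      fun u => ?_
    · exact iterSum_mono (fun c hc => hvan c _ (Or.inl hc)) (fun c => hnn _) i _ _
        (by push_cast; omega)
    -- Chosen so that c₁ + δ(b + k₀) + uN ≤ u'(N + 1) for all b ≤ N, which puts the slanted box
    -- inside a rectangular one.
    · let u' : ℕ := c₁.natAbs + δ * (1 + k₀) + u
      obtain ⟨C, hC⟩ := exists_growth_sliceHilbert hI hf hU hW hWU hUI hWg J k₀
        (fun k hk => hJ k ((le_max_left _ _).trans hk)) hβ hc₀ u'
      refine ⟨((u' + c₀.natAbs + 1 : ℕ) : ℤ) ^ i * C, fun N => ?_⟩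
      have hbound : ∀ b ∈ Finset.range (N + 1),
          iterSum (fun c => sliceHilbert a U W (c, (b : ℤ) + k₀)) (i + 1)
            (c₁ + δ * ((b : ℤ) + k₀) + ((u * N : ℕ) : ℤ)) ≤
          (((u' + c₀.natAbs + 1 : ℕ) : ℤ) * ((N : ℤ) + 1)) ^ i *
            sumUp (fun c => sliceHilbert a U W (c, (b : ℤ) + k₀)) (u' * ((N : ℤ) + 1)) := by
        intro b hb
        have hb' : (b : ℤ) ≤ N := by
          have := Finset.mem_range.1 hb
          omega
        have hle : c₁ + δ * ((b : ℤ) + k₀) + ((u * N : ℕ) : ℤ) ≤ u' * ((N : ℤ) + 1) := by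
          have h1 : c₁ ≤ c₁.natAbs * ((N : ℤ) + 1) := by
            have : (c₁.natAbs : ℤ) ≤ c₁.natAbs * ((N : ℤ) + 1) :=
              le_mul_of_one_le_right (by positivity) (by linarith [Int.natCast_nonneg N])
            omega
          have h2 : (b : ℤ) + k₀ ≤ (1 + k₀) * ((N : ℤ) + 1) := by
            nlinarith [Int.natCast_nonneg N, Int.natCast_nonneg k₀]
          have h3 := mul_le_mul_of_nonneg_left h2 (Int.natCast_nonneg δ)
          simp only [u']
          push_cast at h1 ⊢
          nlinarith [Int.natCast_nonneg u]
        refine (iterSum_mono (fun c hc => hvan c _ (Or.inl hc)) (fun c => hnn _) i _ _ hle).trans ?_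
        refine (iterSum_le (fun c hc => hvan c _ (Or.inl hc)) (fun c => hnn _) i _).trans ?_
        refine mul_le_mul_of_nonneg_right (pow_le_pow_left₀ (Int.natCast_nonneg _) ?_ i)
          (sumUp_nonneg (fun c => hnn _) _)
        rw [Int.toNat_eq_max, max_le_iff]
        refine ⟨?_, by positivity⟩
        have h1 : (c₀.natAbs : ℤ) + 1 ≤ (c₀.natAbs + 1) * ((N : ℤ) + 1) :=
          le_mul_of_one_le_right (by positivity) (by linarith [Int.natCast_nonneg N])
        have h2 : -c₀ ≤ c₀.natAbs := by omega
        push_cast at h1 h2 ⊢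
        linarith
      refine (Finset.sum_le_sum hbound).trans ?_
      rw [← Finset.mul_sum, mul_pow, pow_add]
      calc _ ≤ (((u' + c₀.natAbs + 1 : ℕ) : ℤ) ^ i * ((N : ℤ) + 1) ^ i) *
            (C * ((N : ℤ) + 1) ^ β) := mul_le_mul_of_nonneg_left (hC N) (by positivity)
        _ = _ := by ring
  rcases i with _ | i
  · obtain ⟨k₀, c₁, hk, h⟩ := main 0
    refine ⟨k₀, c₁ + 1, hk, ?_⟩
    refine (congrArg (IsPoly (β - 1)) ?_).mp h.diff_fst
    funext x b
    have := sumUp_sub (f := fun c => sliceHilbert a U W (c, (b : ℤ) + k₀)) (c₀ := c₀)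
      (fun c hc => hvan c _ (Or.inl hc)) (c₁ + 1 + δ * ((b : ℤ) + k₀) + x)
    change sumUp _ _ - sumUp _ _ = _
    refine Eq.trans ?_ this
    congr 2 <;> (push_cast; ring)
  · exact main i

end Region

/-! ### Dimension of quotients of the Rees algebra -/

section Dimension

variable {S : Type*} [CommRing S]

/-- The degree one generators of a Rees algebra. -/
def reesGenerator {I : Ideal S} {ι : Type*} {f : ι → S} (hf : Ideal.span (Set.range f) = I) (s : ι) :
    reesAlgebra I :=
  ⟨Polynomial.monomial 1 (f s), reesAlgebra.monomial_mem.2 (by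
    rw [pow_one, ← hf]
    exact Ideal.subset_span ⟨s, rfl⟩)⟩

lemma aeval_reesGenerator_surjective {I : Ideal S} {ι : Type*} {f : ι → S}
    (hf : Ideal.span (Set.range f) = I) :
    Function.Surjective (aeval (reesGenerator hf) : MvPolynomial ι S →ₐ[S] reesAlgebra I) := by
  rw [← AlgHom.range_eq_top, ← Algebra.adjoin_range_eq_range_aeval]
  refine Subalgebra.map_injective (f := (reesAlgebra I).val) Subtype.val_injective ?_
  rw [AlgHom.map_adjoin, Algebra.map_top, Subalgebra.range_val]
  refine Eq.trans ?_ (adjoin_monomial_eq_reesAlgebra I)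
  refine le_antisymm (Algebra.adjoin_mono ?_) (Algebra.adjoin_le ?_)
  · rintro _ ⟨_, ⟨s, rfl⟩, rfl⟩
    exact ⟨f s, hf ▸ Ideal.subset_span ⟨s, rfl⟩, rfl⟩
  · have : Submodule.map (Polynomial.monomial 1 : S →ₗ[S] Polynomial S) I ≤
        Subalgebra.toSubmodule
          (Algebra.adjoin S ((reesAlgebra I).val '' Set.range (reesGenerator hf))) := by
      refine Submodule.map_le_iff_le_comap.2 (hf.symm.le.trans (Submodule.span_le.2 ?_))
      rintro _ ⟨s, rfl⟩
      exact Algebra.subset_adjoin ⟨reesGenerator hf s, ⟨s, rfl⟩, rfl⟩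
    exact this

/-- R/JR is a quotient of the polynomial ring in v variables over S/J. -/
lemma ringKrullDim_quotient_map_le {R : Type*} [CommRing R] [Algebra S R] [IsNoetherianRing S]
    {v : ℕ} (g : MvPolynomial (Fin v) S →ₐ[S] R) (hg : Function.Surjective g) (J : Ideal S) :
    ringKrullDim (R ⧸ J.map (algebraMap S R)) ≤ ringKrullDim (S ⧸ J) + v := by
  let φ : MvPolynomial (Fin v) S →+* R ⧸ J.map (algebraMap S R) :=
    (Ideal.Quotient.mk _).comp g.toRingHom
  have hφ : ∀ p ∈ J.map (C : S →+* MvPolynomial (Fin v) S), φ p = 0 := by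
    have h : J.map (C : S →+* MvPolynomial (Fin v) S) ≤ RingHom.ker φ := by
      refine Ideal.map_le_iff_le_comap.2 fun x hx => Ideal.Quotient.eq_zero_iff_mem.2 ?_
      have : g.toRingHom (C x) = algebraMap S R x := algHom_C g x
      rw [this]
      exact Ideal.mem_map_of_mem _ hx
    exact fun p hp => h hp
  have hφs : Function.Surjective φ := Ideal.Quotient.mk_surjective.comp hg
  have h1 := ringKrullDim_le_of_surjective
    (Ideal.Quotient.lift (J.map (C : S →+* MvPolynomial (Fin v) S)) φ hφ)
    (Ideal.Quotient.lift_surjective_of_surjective _ hφ hφs)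
  rw [← ringKrullDim_eq_of_ringEquiv (quotientEquivQuotientMvPolynomial J).toRingEquiv,
    MvPolynomial.ringKrullDim_of_isNoetherianRing] at h1
  simpa using h1

lemma reesQuotientDim_le {I : Ideal S} (J : Ideal S) {v : ℕ} [IsNoetherianRing S] {f : Fin v → S}
    (hf : Ideal.span (Set.range f) = I) : reesQuotientDim I J ≤ ringKrullDim (S ⧸ J) + v :=
  ringKrullDim_quotient_map_le _ (aeval_reesGenerator_surjective hf) J

lemma reesQuotientDim_anti (I : Ideal S) {J J' : Ideal S} (h : J ≤ J') :
    reesQuotientDim I J' ≤ reesQuotientDim I J :=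
  ringKrullDim_le_of_surjective (Ideal.Quotient.factor (Ideal.map_mono h))
    (Ideal.Quotient.factor_surjective _)

/-- The constant coefficient defines a ring map from the quotient to S/J, so the quotient is not the
zero ring. -/
lemma reesQuotientDim_nonneg (I : Ideal S) {J : Ideal S} (h : J ≠ ⊤) : 0 ≤ reesQuotientDim I J := by
  let φ : reesAlgebra I →+* S ⧸ J :=
    ((Ideal.Quotient.mk J).comp Polynomial.constantCoeff).comp (reesAlgebra I).val.toRingHom
  have hφ : J.map (algebraMap S (reesAlgebra I)) ≤ RingHom.ker φ := by
    refine Ideal.map_le_iff_le_comap.2 fun x hx => ?_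
    refine Ideal.Quotient.eq_zero_iff_mem.2 ?_
    have : Polynomial.constantCoeff ((reesAlgebra I).val.toRingHom (algebraMap S _ x)) = x :=
      Polynomial.coeff_C_zero
    rw [this]
    exact hx
  have hne : J.map (algebraMap S (reesAlgebra I)) ≠ ⊤ := by
    intro h1
    have h2 : φ 1 = 0 := hφ (h1 ▸ Submodule.mem_top)
    rw [map_one] at h2
    exact h ((Ideal.eq_top_iff_one J).2 (Ideal.Quotient.eq_zero_iff_mem.1 h2))
  have := Ideal.Quotient.nontrivial_iff.2 hne
  exact ringKrullDim_nonneg_of_nontrivial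

end Dimension

end GradedTor
end

/-! ### Existence of Hilbert coefficients and numerical preliminaries -/

noncomputable section
namespace GradedTor

section Coefficients

lemma EvPoly.of_isPoly {m : ℕ} {G : ℤ → ℤ} {c₁ : ℤ}
    (h : IsPoly m fun a _ => G (c₁ + a)) : EvPoly m G := by
  induction m generalizing G c₁ with
  | zero =>
    refine Filter.eventually_atTop.2 ⟨c₁, fun c hc => ?_⟩
    obtain ⟨t, rfl⟩ := Int.le.dest hc
    exact h t 0
  | succ m ih =>
    refine ih (c₁ := c₁ + 1) ((congrArg (IsPoly m) ?_).mp h.1)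
    funext a b
    change G _ - G _ = _
    rw [show c₁ + 1 + (a : ℤ) - 1 = c₁ + a by ring,
      show c₁ + ((a + 1 : ℕ) : ℤ) = c₁ + 1 + a by push_cast; ring]

variable {K : Type*} [Field K] {n : ℕ}

/-- Z/N is viewed as a constant family over the unit ideal, generated by 1 in degree 0, so that δ =
0 and k plays no role. The Rees dimension is at most d + 1, and the general bound (d + 1) + i - 1
becomes d + i. -/
theorem evPoly_iterSum_finrank {r : ℕ} {a : Fin r → ℤ}
    {Z N : Submodule (MvPolynomial (Fin n) K) (Fin r → MvPolynomial (Fin n) K)} (hNZ : N ≤ Z)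
    (hN : IsGradedSubmodule a N) {J : Ideal (MvPolynomial (Fin n) K)}
    (hJ : ∀ p ∈ J, ∀ y ∈ Z, p • y ∈ N) {d : ℕ}
    (hd : ringKrullDim (MvPolynomial (Fin n) K ⧸ J) ≤ d) (i : ℕ) :
    EvPoly (d + i) (iterSum (fun c =>
      (Module.finrank K (Z.restrictScalars K ⊓ freeGrading K n a c : Submodule K _) : ℤ) -
        Module.finrank K (N.restrictScalars K ⊓ freeGrading K n a c : Submodule K _)) i) := by
  have hI : Ideal.span (Set.range fun _ : Fin 1 => (1 : MvPolynomial (Fin n) K)) = ⊤ := by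
    rw [Set.range_const, Ideal.span_singleton_one]
  obtain ⟨k₀, c₁, -, h⟩ := exists_regionPoly_sliceHilbert (K := K) (n := n) (dg := fun _ => 0)
    (U := fun _ => Z) (W := fun _ => N) (a := a) hI (fun _ => isHomogeneous_one _ _)
    (fun _ _ y hy => Z.smul_mem _ hy) (fun _ _ y hy => N.smul_mem _ hy) (fun _ => hNZ)
    (fun k => by rw [Ideal.top_pow, Submodule.top_smul]; exact le_top) (fun _ => hN) J 0
    (fun _ _ => hJ) (β := d + 1) (by
      refine (reesQuotientDim_le J hI).trans ?_
      push_cast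
      exact add_le_add_left hd _) (δ := 0) (fun _ => le_rfl) i
  rw [show d + 1 + i - 1 = d + i by omega] at h
  refine EvPoly.of_isPoly (c₁ := c₁) ((congrArg (IsPoly (d + i)) ?_).mp h)
  funext x b
  have hs : ∀ c : ℤ, sliceHilbert a (fun _ => Z) (fun _ => N) (c, (b : ℤ) + k₀) =
      (Module.finrank K (Z.restrictScalars K ⊓ freeGrading K n a c : Submodule K _) : ℤ) -
        Module.finrank K (N.restrictScalars K ⊓ freeGrading K n a c : Submodule K _) := by
    intro c
    rw [sliceHilbert, slice, slice, if_pos (by positivity), if_pos (by positivity)]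
  simp only [hs, Nat.cast_zero, zero_mul, add_zero]

variable {T : Type*} [AddCommGroup T] [Module K T] [Module (MvPolynomial (Fin n) K) T]

lemma isHilbertCoeffs_hilbertCoeff {𝓣 : ℤ → Submodule K T} {i : ℕ}
    (h : EvPoly (hilbertLength (K := K) n T i) (iteratedHilbert 𝓣 i)) :
    IsHilbertCoeffs n 𝓣 i (hilbertCoeff n 𝓣 i) := by
  have hex : ∃ e, IsHilbertCoeffs n 𝓣 i e := h.exists_coeffs
  have : hilbertCoeff n 𝓣 i = hex.choose := funext fun j => dif_pos hex
  rw [this]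
  exact hex.choose_spec

end Coefficients

section Arithmetic

/-- The finite bound excludes ⊤, which `toNat` would send to 0. -/
lemma le_toNat_unbotD {x : WithBot ℕ∞} {m : ℕ} (h : x ≤ m) : x ≤ ((x.unbotD 0).toNat : ℕ) := by
  induction x with
  | bot => exact bot_le
  | coe x =>
    have hx : x ≠ ⊤ := ne_top_of_le_ne_top (ENat.natCast_ne_top m) (WithBot.coe_le_coe.1 h)
    rw [WithBot.unbotD_coe]
    exact WithBot.coe_le_coe.2 (ENat.natCast_toNat hx).ge

lemma eq_toNat_unbotD {x : WithBot ℕ∞} {m : ℕ} (h : x ≤ m) (h0 : 0 ≤ x) :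
    x = ((x.unbotD 0).toNat : ℕ) := by
  refine le_antisymm (le_toNat_unbotD h) ?_
  induction x with
  | bot => simp at h0
  | coe x =>
    rw [WithBot.unbotD_coe]
    exact WithBot.coe_le_coe.2 (ENat.natCast_toNat_le_self x)

lemma ringKrullDim_quotient_mvPolynomial_le {K : Type*} [Field K] {n : ℕ}
    (J : Ideal (MvPolynomial (Fin n) K)) : ringKrullDim (MvPolynomial (Fin n) K ⧸ J) ≤ n := by
  refine (ringKrullDim_quotient_le J).trans ?_
  rw [MvPolynomial.ringKrullDim_of_isNoetherianRing, ringKrullDim_eq_zero_of_field]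
  simp

lemma exists_generators_spanFinrank {S : Type*} [CommRing S] [IsNoetherianRing S] (I : Ideal S) :
    ∃ f : Fin (Submodule.spanFinrank I) → S, Ideal.span (Set.range f) = I := by
  obtain ⟨s, hs, hI⟩ := (IsNoetherian.noetherian I).exists_span_finset_card_eq_spanFinrank
  rw [← hs]
  refine ⟨fun t => s.equivFin.symm t, ?_⟩
  rw [← hI]
  change Submodule.span _ _ = _
  congr 1
  ext x
  constructor
  · rintro ⟨t, rfl⟩
    exact (s.equivFin.symm t).2
  · intro hx
    exact ⟨s.equivFin ⟨x, hx⟩, by simp⟩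

lemma PolyLT.exists_shift {m k₀ : ℕ} {e : ℕ → ℤ} (h : PolyLT m fun b => e (b + k₀)) :
    ∃ q : Polynomial ℚ, (∀ k, k₀ ≤ k → (e k : ℚ) = q.eval (k : ℚ)) ∧
      (q ≠ 0 → q.natDegree + 1 ≤ m) := by
  obtain ⟨q, hq, h⟩ := h
  refine ⟨q.comp (Polynomial.X - Polynomial.C (k₀ : ℚ)), fun k hk => ?_, fun hne => ?_⟩
  · obtain ⟨t, rfl⟩ := Nat.exists_eq_add_of_le' hk
    rw [h t]
    simp
  · rw [Polynomial.natDegree_comp, Polynomial.natDegree_X_sub_C, mul_one]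
    have h0 : q ≠ 0 := by
      rintro rfl
      simp at hne
    rw [Polynomial.mem_degreeLT, Polynomial.degree_eq_natDegree h0] at hq
    exact_mod_cast hq

end Arithmetic

/-! ### The Hilbert coefficients of Tor as functions of k -/

section Tor

variable {K : Type*} [Field K] {n : ℕ} {M : Type*} [AddCommGroup M] [Module K M]
  [Module (MvPolynomial (Fin n) K) M] {𝓜 : ℤ → Submodule K M} (F : FreeResolution (n := n) 𝓜)
  {I : Ideal (MvPolynomial (Fin n) K)} (l : ℕ)

lemma supportDim_homology (J : Ideal (MvPolynomial (Fin n) K)) :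
    Module.supportDim (MvPolynomial (Fin n) K)
      (F.homology (MvPolynomial (Fin n) K ⧸ J) (l + 1)) =
        ringKrullDim (MvPolynomial (Fin n) K ⧸ liftedAnnihilator F J l) := by
  rw [Module.supportDim_eq_ringKrullDim_quotient_annihilator, annihilator_homology]

lemma isGradedSubmodule_liftedBoundaries {J : Ideal (MvPolynomial (Fin n) K)}
    (hJ : J.IsHomogeneous (homogeneousSubmodule (Fin n) K)) :
    IsGradedSubmodule (F.shift l) (liftedBoundaries F J l) :=
  (isGradedSubmodule_range _ (F.d_mem l)).smul hJ

theorem isHilbertCoeffs_homology {J : Ideal (MvPolynomial (Fin n) K)}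
    (hJ : J.IsHomogeneous (homogeneousSubmodule (Fin n) K)) (i : ℕ) :
    IsHilbertCoeffs n (F.homologyGrading (quotientGrading J) (l + 1)) i
      (hilbertCoeff n (F.homologyGrading (quotientGrading J) (l + 1)) i) := by
  refine isHilbertCoeffs_hilbertCoeff ?_
  rw [iteratedHilbert_eq_iterSum, hilbertLength, supportDim_homology]
  simp only [finrank_homologyGrading F J l hJ]
  exact evPoly_iterSum_finrank (liftedBoundaries_le F J l)
    (isGradedSubmodule_liftedBoundaries F l hJ) (J := liftedAnnihilator F J l) (fun p hp => hp)
    (le_toNat_unbotD (ringKrullDim_quotient_mvPolynomial_le _)) i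

lemma iteratedHilbert_homologyGrading (hI : I.IsHomogeneous (homogeneousSubmodule (Fin n) K))
    (i k : ℕ) (c : ℤ) :
    iteratedHilbert (F.homologyGrading (quotientGrading (I ^ k)) (l + 1)) i c =
      iterSum (fun b => sliceHilbert (F.shift l) (fun k => liftedCycles F (I ^ k) l)
        (fun k => liftedBoundaries F (I ^ k) l) (b, (k : ℤ))) i c := by
  rw [iteratedHilbert_eq_iterSum]
  congr 1
  funext b
  rw [finrank_homologyGrading F _ l (isHomogeneous_pow hI k), sliceHilbert, slice, slice,
    if_pos (Int.natCast_nonneg k), if_pos (Int.natCast_nonneg k), Int.toNat_natCast]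

/-- The last clause is the degree count, with t the degree of a coefficient: m = β + i - 1 and D = d
+ i give t + 1 ≤ β - d + j, to be compared with β ≤ d + v(I) and with the Rees dimension modulo Ann
M. -/
theorem exists_regionPoly_homology (hI : I.IsHomogeneous (homogeneousSubmodule (Fin n) K))
    {k₂ : ℕ} (hk₂ : ∀ k, k₂ ≤ k → liftedAnnihilator F (I ^ k) l = liftedAnnihilator F (I ^ k₂) l)
    (i : ℕ) : ∃ m δ k₀ c₁, k₂ ≤ k₀ ∧
      RegionPoly m δ k₀ c₁ (fun c k => iterSum (fun b => sliceHilbert (F.shift l)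
        (fun k => liftedCycles F (I ^ k) l) (fun k => liftedBoundaries F (I ^ k) l) (b, k)) i c) ∧
      ∀ j D t, D = ((ringKrullDim (MvPolynomial (Fin n) K ⧸
        liftedAnnihilator F (I ^ k₂) l)).unbotD 0).toNat + i → j < D → t + 1 ≤ m + j + 1 - D →
        t + 1 ≤ Submodule.spanFinrank I + j ∧
        ((t : ℕ∞) : WithBot ℕ∞) + 1 ≤ reesQuotientDim I
          (Module.annihilator (MvPolynomial (Fin n) K) M) + (j : WithBot ℕ∞) := by
  set J := liftedAnnihilator F (I ^ k₂) l
  have hJ : ∀ k, k₂ ≤ k → ∀ p ∈ J, ∀ y ∈ liftedCycles F (I ^ k) l,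
      p • y ∈ liftedBoundaries F (I ^ k) l := by
    intro k hk p hp
    rw [← hk₂ k hk] at hp
    exact hp
  -- Here the homology vanishes from `k₂` on, so m = 0 is allowed, and then j < D leaves no possible
  -- t.
  by_cases hJt : J = ⊤
  · refine ⟨0, 0, k₂, 0, le_rfl, fun x b => ?_, fun j D t hD hj ht => by omega⟩
    have h0 : ∀ c, sliceHilbert (K := K) (F.shift l) (fun k => liftedCycles F (I ^ k) l)
        (fun k => liftedBoundaries F (I ^ k) l) (c, (b : ℤ) + k₂) = 0 := by
      intro c
      have hkey : liftedCycles F (I ^ (b + k₂)) l = liftedBoundaries F (I ^ (b + k₂)) l := by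
        refine le_antisymm (fun y hy => ?_) (liftedBoundaries_le F _ l)
        have := hJ (b + k₂) (by omega) 1 (hJt ▸ Submodule.mem_top) y hy
        rwa [one_smul] at this
      rw [sliceHilbert, slice, slice, if_pos (by positivity), if_pos (by positivity),
        show ((b : ℤ) + k₂).toNat = b + k₂ by omega, hkey, sub_self]
    exact iterSum_eq_zero (c₀ := _ + 1) (fun c _ => h0 c) i _ (lt_add_one _)
  -- Two generating systems are used: a homogeneous one for the bigraded argument, and one of
  -- minimal size, homogeneous or not, for the bound on the dimension.
  · obtain ⟨v, f, dg, hf, hdg⟩ := exists_homogeneous_generators hI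
    obtain ⟨g, hg⟩ := exists_generators_spanFinrank I
    have hd := eq_toNat_unbotD (ringKrullDim_quotient_mvPolynomial_le J) (by
      have := Ideal.Quotient.nontrivial_iff.2 hJt
      exact ringKrullDim_nonneg_of_nontrivial)
    set d := ((ringKrullDim (MvPolynomial (Fin n) K ⧸ J)).unbotD 0).toNat
    have hβ' : reesQuotientDim I J ≤ (d + Submodule.spanFinrank I : ℕ) := by
      refine (reesQuotientDim_le J hg).trans ?_
      rw [hd]
      push_cast
      exact le_rfl
    have hβ := eq_toNat_unbotD hβ' (reesQuotientDim_nonneg I hJt)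
    set β := ((reesQuotientDim I J).unbotD 0).toNat
    have hβd : β ≤ d + Submodule.spanFinrank I := by
      rw [hβ] at hβ'
      exact_mod_cast hβ'
    have hmem : ∀ N : Submodule (MvPolynomial (Fin n) K) (Fin (F.rank l) → MvPolynomial (Fin n) K),
        ∀ k s, ∀ y ∈ I ^ k • N,
        f s • y ∈ I ^ (k + 1) • N := by
      intro N k s y hy
      rw [pow_succ', Submodule.mul_smul]
      exact Submodule.smul_mem_smul (hf ▸ Ideal.subset_span ⟨s, rfl⟩) hy
    obtain ⟨δ, hδ⟩ : ∃ δ, ∀ s, dg s ≤ δ := by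
      obtain ⟨δ, h⟩ := (Set.finite_range dg).bddAbove
      exact ⟨δ, fun s => h ⟨s, rfl⟩⟩
    obtain ⟨k₀, c₁, hk, hreg⟩ := exists_regionPoly_sliceHilbert (a := F.shift l) hf hdg
      (U := fun k => liftedCycles F (I ^ k) l) (W := fun k => liftedBoundaries F (I ^ k) l)
      (fun k s y hy => ⟨Submodule.smul_mem _ _ hy.1, hmem _ k s y hy.2⟩)
      (fun k s y hy => hmem _ k s y hy) (fun k => liftedBoundaries_le F _ l)
      (fun k => inf_le_right)
      (fun k => isGradedSubmodule_liftedBoundaries F l (isHomogeneous_pow hI k)) J k₂ hJ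
      (hβ.le : ringKrullDim _ ≤ _) hδ i
    refine ⟨_, δ, k₀, c₁, hk, hreg, fun j D t hD hj ht => ⟨by omega, ?_⟩⟩
    have h1 : t + 1 ≤ β + j := by omega
    have h2 := reesQuotientDim_anti I (annihilator_le_liftedAnnihilator F (I ^ k₂) l)
    refine le_trans ?_ (add_le_add_left h2 _)
    rw [show reesQuotientDim I (liftedAnnihilator F (I ^ k₂) l) = β from hβ]
    exact_mod_cast h1

theorem exists_polynomial_hilbertCoeff_homology
    (hI : I.IsHomogeneous (homogeneousSubmodule (Fin n) K)) (i j : ℕ) : ∃ q : Polynomial ℚ,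
      (∀ᶠ k : ℕ in Filter.atTop,
        (hilbertCoeff n (F.homologyGrading (quotientGrading (I ^ k)) (l + 1)) i j : ℚ) =
          q.eval (k : ℚ)) ∧
      (q ≠ 0 → q.natDegree + 1 ≤ Submodule.spanFinrank I + j ∧
        ((q.natDegree : ℕ∞) : WithBot ℕ∞) + 1 ≤ reesQuotientDim I
          (Module.annihilator (MvPolynomial (Fin n) K) M) + (j : WithBot ℕ∞)) := by
  obtain ⟨k₂, hk₂⟩ := exists_liftedAnnihilator_stable F l I
  obtain ⟨m, δ, k₀, c₁, hk, hreg, hnum⟩ := exists_regionPoly_homology F l hI hk₂ i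
  have hcoeff := fun k => isHilbertCoeffs_homology F l (isHomogeneous_pow hI k) i
  have hlen : ∀ k, k₂ ≤ k →
      hilbertLength (K := K) n (F.homology (MvPolynomial (Fin n) K ⧸ I ^ k) (l + 1)) i =
        ((ringKrullDim (MvPolynomial (Fin n) K ⧸
          liftedAnnihilator F (I ^ k₂) l)).unbotD 0).toNat + i := by
    intro k hk
    rw [hilbertLength, supportDim_homology, hk₂ k hk]
  set D := ((ringKrullDim (MvPolynomial (Fin n) K ⧸
    liftedAnnihilator F (I ^ k₂) l)).unbotD 0).toNat + i with hD
  rcases Nat.lt_or_ge j D with hj | hj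
  -- At level k = b + k₀ the region is parametrized by c = c₁ + δ(b + k₀) + a, which gives the slope
  -- δ and the offset c₁ + δ k₀.
  · have hpoly := IsPoly.polyLT_coeff D δ (c₁ + δ * k₀)
      (fun b j => hilbertCoeff n (F.homologyGrading (quotientGrading (I ^ (b + k₀))) (l + 1)) i j)
      hreg (by
        intro b
        have h1 := (hcoeff (b + k₀)).1
        rw [hlen _ (by omega)] at h1
        have ht : Filter.Tendsto (fun x : ℕ => c₁ + δ * ((b : ℤ) + k₀) + x) Filter.atTop
            Filter.atTop :=
          Filter.tendsto_atTop_add_const_left _ _ tendsto_natCast_atTop_atTop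
        filter_upwards [ht.eventually h1] with x hx
        rw [iteratedHilbert_homologyGrading F l hI] at hx
        push_cast at hx
        rw [hx]
        refine Finset.sum_congr rfl fun j _ => ?_
        congr 2
        ring) j hj
    obtain ⟨q, hq, hdeg⟩ := hpoly.exists_shift
      (e := fun k => hilbertCoeff n (F.homologyGrading (quotientGrading (I ^ k)) (l + 1)) i j)
    exact ⟨q, Filter.eventually_atTop.2 ⟨k₀, hq⟩, fun hne => hnum j D _ hD hj (hdeg hne)⟩
  · refine ⟨0, Filter.eventually_atTop.2 ⟨k₂, fun k hk => ?_⟩, fun h => (h rfl).elim⟩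
    rw [(hcoeff k).2 j ((hlen k hk).le.trans hj)]
    simp

end Tor

end GradedTor
end

theorem corollary3p5 {K : Type*} [Field K] {n : ℕ}
    {M : Type*} [AddCommGroup M] [Module K M] [Module (MvPolynomial (Fin n) K) M]
    [IsScalarTower K (MvPolynomial (Fin n) K) M] [Module.Finite (MvPolynomial (Fin n) K) M]
    (𝓜 : ℤ → Submodule K M) (h𝓜 : GradedTor.IsGrading (n := n) 𝓜)
    (I : Ideal (MvPolynomial (Fin n) K))
    (hI : I.IsHomogeneous (MvPolynomial.homogeneousSubmodule (Fin n) K))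
    (l : ℕ) (hl : 1 < l) :
    (∀ k i : ℕ, GradedTor.IsHilbertCoeffs n
      (GradedTor.torGrading h𝓜 (GradedTor.quotientGrading (I ^ k)) l) i
      (GradedTor.hilbertCoeff n
        (GradedTor.torGrading h𝓜 (GradedTor.quotientGrading (I ^ k)) l) i)) ∧
    ∀ i j : ℕ, ∃ q : Polynomial ℚ,
      (∀ᶠ k : ℕ in Filter.atTop,
        (GradedTor.hilbertCoeff n
          (GradedTor.torGrading h𝓜 (GradedTor.quotientGrading (I ^ k)) l) i j : ℚ)
            = q.eval (k : ℚ)) ∧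
      (q ≠ 0 → q.natDegree + 1 ≤ Submodule.spanFinrank I + j) ∧
      ((∃ p : ℕ, I = Ideal.span {f | f ∈ I ∧ f.IsHomogeneous p}) →
        q ≠ 0 → ((q.natDegree : ℕ∞) : WithBot ℕ∞) + 1 ≤ GradedTor.reesQuotientDim I
          (Module.annihilator (MvPolynomial (Fin n) K) M) + (j : WithBot ℕ∞)) := by
  -- In positive homological degree there is a differential that moves the homology one step down.
  obtain ⟨l, rfl⟩ : ∃ m, l = m + 1 := ⟨l - 1, by omega⟩
  let F := GradedTor.resolution h𝓜
  refine ⟨fun k i => GradedTor.isHilbertCoeffs_homology F l (GradedTor.isHomogeneous_pow hI k) i,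
    fun i j => ?_⟩
  obtain ⟨q, hq, hdeg⟩ := GradedTor.exists_polynomial_hilbertCoeff_homology F l hI i j
  exact ⟨q, hq, fun h => (hdeg h).1, fun _ h => (hdeg h).2⟩
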